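/- Let $S=\{x\in\mathbb R^3:|x|=1\}$, identified with $\widehat{\mathbb C}=\mathbb C\cup\{\infty\}$ by stereographic projection, and for $\alpha\subseteq S$ let $\mathcal A_\alpha$ be the group of all Möbius transformations $f$ of $S$ with $f(\alpha)=\alpha$. For a regular polyhedron inscribed in $S$ let $V$ be its set of vertices, and let $F$ and $E$ be the sets of radial projections to $S$ of the central points of its faces and of the midpoints of its edges. Let $G\simeq A_4$ be a group of rotations of $S$ that preserves a regular tetrahedron $T$ inscribed in $S$. Let $V,F,E$ be the sets attached to $T$, and let $B(X)$ be the $G$-orbit of $X\in S\setminus(V\cup F\cup E)$. For a regular dodecahedron $I$ inscribed in $S$ let $V_I,F_I,E_I$ be the sets attached to $I$, and let $B_I(X)$ be the orbit of $X\in S\setminus(V_I\cup F_I\cup E_I)$ under the rotation group of $I$ (an icosahedral group). For a cube $O$ inscribed in $S$ define $V_O,F_O,E_O,B_O(X)$ likewise, using the rotation group of $O$ (an octahedral group). Then for every finite subset $\alpha\subseteq S$, $\mathcal A_\alpha=G$ if and only if all three of the following hold: 1. $\alpha$ is a union of certain members of $\{V,F,E\}\cup\{B(X): X\in S\setminus(V\cup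 F\cup E)\}$; 2. for every regular dodecahedron $I$ inscribed in $S$ whose rotation group contains $G$, $\alpha$ is not a union of members of $\{V_I,F_I,E_I\}\cup\{B_I(X): X\in S\setminus(V_I\cup F_I\cup E_I)\}$; 3. for every cube $O$ inscribed in $S$ whose rotation group contains $G$, $\alpha$ is not a union of members of $\{V_O,F_O,E_O\}\cup\{B_O(X): X\in S\setminus(V_O\cup F_O\cup E_O)\}$. (The empty union is allowed.) -/

import Mathlib

open scoped Pointwise

noncomputable section

/-- Euclidean three-space. -/
abbrev Space3 : Type := EuclideanSpace ℝ (Fin 3)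

/-- The unit sphere `S` in Euclidean three-space. -/
abbrev Sphere2 : Type := Metric.sphere (0 : Space3) 1

/-- Stereographic projection from the north pole `(0, 0, 1)` onto the extended complex plane. -/
def stereo (p : Sphere2) : OnePoint ℂ :=
  if p.1 2 = 1 then OnePoint.infty
  else OnePoint.some (((p.1 0 : ℂ) + (p.1 1 : ℂ) * Complex.I) / (1 - (p.1 2 : ℂ)))

/-- The group of all Möbius transformations of the Riemann sphere, as permutations of `S`. The
action of `GL (Fin 2) ℂ` on `OnePoint ℂ` is the one by fractional linear transformations. -/
def mobiusGroup : Subgroup (Equiv.Perm Sphere2) where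
  carrier := {f | ∃ M : GL (Fin 2) ℂ, ∀ p, stereo (f p) = M • stereo p}
  one_mem' := ⟨1, fun p => by simp⟩
  mul_mem' := by
    rintro f g ⟨M, hM⟩ ⟨N, hN⟩
    exact ⟨M * N, fun p => by rw [Equiv.Perm.mul_apply, hM, hN, mul_smul]⟩
  inv_mem' := by
    rintro f ⟨M, hM⟩
    refine ⟨M⁻¹, fun p => ?_⟩
    rw [eq_inv_smul_iff, ← hM, ← Equiv.Perm.mul_apply, mul_inv_cancel, Equiv.Perm.one_apply]

/-- The stabilizer of `α`: the group of all Möbius transformations that map `α` onto itself. -/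
def mobiusStabilizer (α : Set Sphere2) : Subgroup (Equiv.Perm Sphere2) :=
  mobiusGroup ⊓ MulAction.stabilizer (Equiv.Perm Sphere2) α

/-- The group of all rotations of `S` about axes through its center. -/
def rotationGroup : Subgroup (Equiv.Perm Sphere2) where
  carrier := {g | ∃ f : Space3 ≃ₗᵢ[ℝ] Space3,
    LinearMap.det (f.toLinearEquiv : Space3 →ₗ[ℝ] Space3) = 1 ∧ ∀ p, (g p : Space3) = f p}
  one_mem' := ⟨LinearIsometryEquiv.refl ℝ Space3, LinearMap.det_id, fun p => rfl⟩
  mul_mem' := by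
    rintro g h ⟨a, ha, hga⟩ ⟨b, hb, hhb⟩
    refine ⟨b.trans a, ?_, fun p => ?_⟩
    · have : ((b.trans a).toLinearEquiv : Space3 →ₗ[ℝ] Space3)
          = (a.toLinearEquiv : Space3 →ₗ[ℝ] Space3) ∘ₗ (b.toLinearEquiv : Space3 →ₗ[ℝ] Space3) :=
        rfl
      rw [this, LinearMap.det_comp, ha, hb, one_mul]
    · rw [Equiv.Perm.mul_apply, hga, hhb]; rfl
  inv_mem' := by
    rintro g ⟨a, ha, hga⟩
    refine ⟨a.symm, ?_, fun p => ?_⟩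
    · have h := LinearEquiv.det_symm_mul_det a.toLinearEquiv
      rw [ha, mul_one] at h
      exact h
    · rw [LinearIsometryEquiv.eq_symm_apply, ← hga, ← Equiv.Perm.mul_apply, mul_inv_cancel, Equiv.Perm.one_apply]

/-- The rotation group of the convex polyhedron with vertex set `P`. -/
def polyhedronRotations (P : Set Sphere2) : Subgroup (Equiv.Perm Sphere2) :=
  rotationGroup ⊓ MulAction.stabilizer (Equiv.Perm Sphere2) P

/-- Vertices of a cube centered at the origin. -/
def cubeVertices : Set Space3 := {v | ∀ i, v i = 1 ∨ v i = -1}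

/-- Vertices of a regular tetrahedron centered at the origin:
`(1, 1, 1)`, `(1, -1, -1)`, `(-1, 1, -1)`, `(-1, -1, 1)`. -/
def tetrahedronVertices : Set Space3 := {v | v ∈ cubeVertices ∧ v 0 * v 1 * v 2 = 1}

/-- Vertices of a regular dodecahedron centered at the origin: `(±1, ±1, ±1)` and the cyclic
permutations of `(0, ±1/φ, ±φ)`, where `φ` is the golden ratio. Indices are taken modulo `3`. -/
def dodecahedronVertices : Set Space3 :=
  cubeVertices ∪
    {v | ∃ i : Fin 3, v i = 0 ∧ |v (i + 1)| = Real.goldenRatio⁻¹ ∧ |v (i + 2)| = Real.goldenRatio}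

/-- `P`, a set of points of the unit sphere, is the image of `W` under a similarity of space that
fixes the origin. -/
def IsInscribedCopy (P : Set Sphere2) (W : Set Space3) : Prop :=
  ∃ (f : Space3 ≃ₗᵢ[ℝ] Space3) (r : ℝ), 0 < r ∧
    (Subtype.val '' P : Set Space3) = (fun w => r • f w) '' W

/-- `P` is the vertex set of a regular tetrahedron inscribed in `S`. -/
def IsRegularTetrahedron (P : Set Sphere2) : Prop := IsInscribedCopy P tetrahedronVertices

/-- `P` is the vertex set of a cube inscribed in `S`. -/
def IsCube (P : Set Sphere2) : Prop := IsInscribedCopy P cubeVertices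

/-- `P` is the vertex set of a regular dodecahedron inscribed in `S`. -/
def IsRegularDodecahedron (P : Set Sphere2) : Prop := IsInscribedCopy P dodecahedronVertices

/-- `A` is the set of vertices of a `k`-dimensional face of the convex polyhedron with vertex set
`P`: the set of those points of `P` at which some linear functional is maximal on `P`. -/
def IsFaceOfDim (P : Set Sphere2) (k : ℕ) (A : Finset Sphere2) : Prop :=
  (∃ u : Space3, ∀ x : Sphere2,
    x ∈ A ↔ x ∈ P ∧ ∀ y ∈ P, inner ℝ u (y : Space3) ≤ inner ℝ u (x : Space3)) ∧
  Module.finrank ℝ (vectorSpan ℝ ((fun x : Sphere2 => (x : Space3)) '' (A : Set Sphere2))) = k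

/-- The central projections to `S` of the central points of the `k`-dimensional faces of the convex
polyhedron with vertex set `P`. -/
def projectedCenters (P : Set Sphere2) (k : ℕ) : Set Sphere2 :=
  {p | ∃ A : Finset Sphere2, IsFaceOfDim P k A ∧
    ∃ r : ℝ, 0 < r ∧ A.centroid ℝ (fun x : Sphere2 => (x : Space3)) = r • (p : Space3)}

/-- The projections to `S` of the central points of the (two-dimensional) faces. -/
def faceCenters (P : Set Sphere2) : Set Sphere2 := projectedCenters P 2

/-- The projections to `S` of the middle points of the edges. -/
def edgeMidpoints (P : Set Sphere2) : Set Sphere2 := projectedCenters P 1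

/-- The family `{V, F, E} ∪ {B(X) | X ∈ S \ (V ∪ F ∪ E)}` of the polyhedron with vertex set `V = P`,
where `B(X)` is the orbit of `X` under `H`. -/
def orbitFamily (P : Set Sphere2) (H : Subgroup (Equiv.Perm Sphere2)) : Set (Set Sphere2) :=
  {P, faceCenters P, edgeMidpoints P} ∪
    {B | ∃ X : Sphere2, X ∉ P ∪ faceCenters P ∪ edgeMidpoints P ∧ B = MulAction.orbit H X}

/-- `α` is a union of certain members of the family `C`. -/
def IsUnionOfMembers (α : Set Sphere2) (C : Set (Set Sphere2)) : Prop :=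
  ∃ D ⊆ C, α = ⋃₀ D

end

/-! For each of the three solids, the rotation group preserves V, F and E and acts transitively on
each of them. So a set is a union of members of the family exactly when the group preserves it
(`IsFaceTransitive.isUnionOfMembers_iff`). Condition 1 thus says that `G` lies in the stabilizer A
of `α`, and conditions 2 and 3 say that no icosahedral or octahedral group containing `G` lies in A.
If A = `G`, they hold because A₄ has no element of order 5 or 4.

Conversely, let all three hold. The empty set violates condition 3, and a nonempty `G`-invariant set
has at least three points. A Möbius transformation is determined by its values at three points, so A
is finite (`finite_mobiusStabilizer`). Averaging yields an A-invariant hermitian form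
(`exists_invariant_form`). Once `G` is conjugated into standard position, invariance under the
half-turns about the coordinate axes makes the form scalar, so A consists of rotations
(`le_rotationGroup_of_finite`).

Lift A to a finite group M of unit quaternions; it contains the Hurwitz units, the lift of `G`. The
theorem `finite_trichotomy` takes the place of the classification of finite rotation groups. Let c
be the largest real part of an element of M other than 1, that is, the cosine of half the smallest
angle of rotation. If c ≤ 1/2, then M consists of the Hurwitz units. Otherwise, multiplication by (1
± i ± j ± k)/2 shows that the absolute values of the imaginary components of an extremal element add
up to at most c, whence c² ≥ 1/2; equality puts (1 + i)/√2 into M. If c² > 1/2, commutators of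
extremal elements give c² < 3/4, fifth powers then force c = φ/2, and the same inequalities leave
two possible icosians.

Hence A is `G`, or it contains the rotation group of a cube or a dodecahedron whose rotation group
contains `G`. The two icosians belong to two different dodecahedra, exchanged by the half-turn
`unitS`. -/

open scoped Quaternion

noncomputable section

/-! ### Rotations of the sphere as unit quaternions -/

/-- The permutation of the unit sphere induced by a linear isometry. -/
def spherePerm : (Space3 ≃ₗᵢ[ℝ] Space3) →* Equiv.Perm Sphere2 where
  toFun f :=
    { toFun := fun p => ⟨f p.1, by simp⟩
      invFun := fun p => ⟨f.symm p.1, by simp⟩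
      left_inv := fun p => by simp
      right_inv := fun p => by simp }
  map_one' := rfl
  map_mul' _ _ := rfl

@[simp] lemma coe_spherePerm (f : Space3 ≃ₗᵢ[ℝ] Space3) (p : Sphere2) :
    (spherePerm f p : Space3) = f p := rfl

/-- The quaternion with the given components. -/
def quat (a b c d : ℝ) : ℍ[ℝ] := ⟨a, b, c, d⟩

@[simp] lemma quat_re (a b c d : ℝ) : (quat a b c d).re = a := rfl
@[simp] lemma quat_imI (a b c d : ℝ) : (quat a b c d).imI = b := rfl
@[simp] lemma quat_imJ (a b c d : ℝ) : (quat a b c d).imJ = c := rfl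
@[simp] lemma quat_imK (a b c d : ℝ) : (quat a b c d).imK = d := rfl

/-- Vectors of space as purely imaginary quaternions. -/
def pureQuaternion : Space3 →ₗ[ℝ] ℍ[ℝ] where
  toFun x := ⟨0, x 0, x 1, x 2⟩
  map_add' _ _ := Quaternion.ext _ _ (add_zero 0).symm rfl rfl rfl
  map_smul' c _ := Quaternion.ext _ _ (mul_zero c).symm rfl rfl rfl

@[simp] lemma pureQuaternion_re (x : Space3) : (pureQuaternion x).re = 0 := rfl
@[simp] lemma pureQuaternion_imI (x : Space3) : (pureQuaternion x).imI = x 0 := rfl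
@[simp] lemma pureQuaternion_imJ (x : Space3) : (pureQuaternion x).imJ = x 1 := rfl
@[simp] lemma pureQuaternion_imK (x : Space3) : (pureQuaternion x).imK = x 2 := rfl

/-- The imaginary part of a quaternion as a vector of space. -/
def imVector (q : ℍ[ℝ]) : Space3 := !₂[q.imI, q.imJ, q.imK]

@[simp] lemma imVector_pureQuaternion (x : Space3) : imVector (pureQuaternion x) = x := by
  ext i; fin_cases i <;> rfl

lemma pureQuaternion_imVector {q : ℍ[ℝ]} (h : q.re = 0) : pureQuaternion (imVector q) = q := by
  ext <;> simp [imVector, h]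

lemma pureQuaternion_injective : Function.Injective pureQuaternion :=
  Function.LeftInverse.injective imVector_pureQuaternion


lemma norm_pureQuaternion (x : Space3) : ‖pureQuaternion x‖ = ‖x‖ := by
  have h : ‖pureQuaternion x‖ * ‖pureQuaternion x‖ = ‖x‖ ^ 2 := by
    rw [← Quaternion.normSq_eq_norm_mul_self, Quaternion.normSq_def', EuclideanSpace.norm_sq_eq]
    simp [Fin.sum_univ_three]
  rw [← sq] at h
  exact (sq_eq_sq₀ (norm_nonneg _) (norm_nonneg _)).1 h

/-- Conjugation of a vector by a quaternion. -/
def conjVector (q : ℍ[ℝ]) (x : Space3) : Space3 := imVector (q * pureQuaternion x * star q)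

lemma pureQuaternion_conjVector (q : ℍ[ℝ]) (x : Space3) :
    pureQuaternion (conjVector q x) = q * pureQuaternion x * star q := by
  refine pureQuaternion_imVector ?_
  simp
  ring

lemma conjVector_mul (q r : ℍ[ℝ]) (x : Space3) :
    conjVector (q * r) x = conjVector q (conjVector r x) := by
  apply pureQuaternion_injective
  simp only [pureQuaternion_conjVector, star_mul, mul_assoc]

lemma conjVector_one (x : Space3) : conjVector 1 x = x := by
  apply pureQuaternion_injective
  simp [pureQuaternion_conjVector]

/-- The rotation `x ↦ q x q⁻¹` defined by a unit quaternion `q`. -/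
def quatIso : unitary ℍ[ℝ] →* (Space3 ≃ₗᵢ[ℝ] Space3) where
  toFun q :=
    { toFun := conjVector q
      invFun := conjVector (star q : unitary ℍ[ℝ])
      map_add' := fun x y => by
        apply pureQuaternion_injective
        simp only [pureQuaternion_conjVector, map_add, mul_add, add_mul]
      map_smul' := fun c x => by
        apply pureQuaternion_injective
        simp only [pureQuaternion_conjVector, map_smul, mul_smul_comm, smul_mul_assoc,
          RingHom.id_apply]
      left_inv := fun x => by
        rw [← conjVector_mul, ← Submonoid.coe_mul, Unitary.star_mul_self]
        exact conjVector_one x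
      right_inv := fun x => by
        rw [← conjVector_mul, ← Submonoid.coe_mul, Unitary.mul_star_self]
        exact conjVector_one x
      norm_map' := fun x => by
        change ‖conjVector q x‖ = ‖x‖
        rw [← norm_pureQuaternion, pureQuaternion_conjVector, norm_mul, norm_mul, norm_star,
          CStarRing.norm_coe_unitary, one_mul, mul_one, norm_pureQuaternion] }
  map_one' := by ext1 x; exact conjVector_one x
  map_mul' q r := by ext1 x; exact conjVector_mul q r x

lemma quatIso_apply (q : unitary ℍ[ℝ]) (x : Space3) : quatIso q x = conjVector q x := rfl

lemma mem_unitary_iff_normSq {q : ℍ[ℝ]} : q ∈ unitary ℍ[ℝ] ↔ Quaternion.normSq q = 1 := by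
  rw [Unitary.mem_iff, Quaternion.star_mul_self, Quaternion.self_mul_star, and_self,
    ← Quaternion.coe_one, Quaternion.coe_inj]

lemma mem_unitary_iff {q : ℍ[ℝ]} :
    q ∈ unitary ℍ[ℝ] ↔ q.re ^ 2 + q.imI ^ 2 + q.imJ ^ 2 + q.imK ^ 2 = 1 := by
  rw [mem_unitary_iff_normSq, Quaternion.normSq_def']

lemma conjVector_apply (q : ℍ[ℝ]) (x : Space3) : conjVector q x =
    !₂[(q.re ^ 2 + q.imI ^ 2 - q.imJ ^ 2 - q.imK ^ 2) * x 0 +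
          2 * (q.imI * q.imJ - q.re * q.imK) * x 1 + 2 * (q.imI * q.imK + q.re * q.imJ) * x 2,
       2 * (q.imI * q.imJ + q.re * q.imK) * x 0 +
          (q.re ^ 2 - q.imI ^ 2 + q.imJ ^ 2 - q.imK ^ 2) * x 1 +
          2 * (q.imJ * q.imK - q.re * q.imI) * x 2,
       2 * (q.imI * q.imK - q.re * q.imJ) * x 0 + 2 * (q.imJ * q.imK + q.re * q.imI) * x 1 +
          (q.re ^ 2 - q.imI ^ 2 - q.imJ ^ 2 + q.imK ^ 2) * x 2] := by
  ext i
  fin_cases i <;> simp [conjVector, imVector] <;> ring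

lemma det_quatIso (q : unitary ℍ[ℝ]) :
    LinearMap.det ((quatIso q).toLinearEquiv : Space3 →ₗ[ℝ] Space3) = 1 := by
  have hq := mem_unitary_iff.1 q.2
  rw [← LinearMap.det_toMatrix (EuclideanSpace.basisFun (Fin 3) ℝ).toBasis, Matrix.det_fin_three]
  simp only [LinearMap.toMatrix_apply, OrthonormalBasis.coe_toBasis,
    EuclideanSpace.basisFun_apply, OrthonormalBasis.coe_toBasis_repr_apply,
    EuclideanSpace.basisFun_repr, LinearEquiv.coe_coe, LinearIsometryEquiv.coe_toLinearEquiv,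
    quatIso_apply, conjVector_apply]
  simp
  generalize (q : ℍ[ℝ]).re = a at *
  generalize (q : ℍ[ℝ]).imI = b at *
  generalize (q : ℍ[ℝ]).imJ = c at *
  generalize (q : ℍ[ℝ]).imK = d at *
  -- As a polynomial in the components, the determinant is the cube of the norm form.
  have : (a ^ 2 + b ^ 2 + c ^ 2 + d ^ 2) ^ 3 = 1 := by rw [hq, one_pow]
  linear_combination this

lemma isometryNeg_mul (g : Space3 ≃ₗᵢ[ℝ] Space3) :
    LinearIsometryEquiv.neg ℝ * g = g * LinearIsometryEquiv.neg ℝ := by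
  ext1 x; exact (map_neg g x).symm

lemma isometryNeg_mul_self :
    (LinearIsometryEquiv.neg ℝ : Space3 ≃ₗᵢ[ℝ] Space3) * LinearIsometryEquiv.neg ℝ = 1 := by
  ext1 x; exact neg_neg x

lemma reflection_orthogonal_singleton_apply (v x : Space3) :
    (ℝ ∙ v)ᗮ.reflection x = x - (2 * (inner ℝ v x / ‖v‖ ^ 2)) • v := by
  rw [Submodule.reflection_orthogonal_apply, Submodule.reflection_singleton_apply, neg_sub,
    mul_smul, ofNat_smul_eq_nsmul ℝ]
  rfl

lemma conjVector_pureQuaternion (u x : Space3) :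
    conjVector (pureQuaternion u) x = (2 * inner ℝ u x) • u - (‖u‖ ^ 2) • x := by
  rw [conjVector_apply, EuclideanSpace.norm_sq_eq]
  ext i
  fin_cases i <;> simp [PiLp.inner_apply, Fin.sum_univ_three] <;> ring

/-- Conjugation by a pure unit quaternion u is the half-turn about u, which is minus the reflection
in the plane orthogonal to u. For v = 0 the reflection is the identity. -/
lemma reflection_orthogonal_singleton (v : Space3) : ∃ q,
    (ℝ ∙ v)ᗮ.reflection = quatIso q ∨
      (ℝ ∙ v)ᗮ.reflection = quatIso q * LinearIsometryEquiv.neg ℝ := by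
  by_cases hv : v = 0
  · refine ⟨1, Or.inl ?_⟩
    ext1 x
    rw [map_one, reflection_orthogonal_singleton_apply, hv, smul_zero, sub_zero]
    rfl
  · have hv' : ‖v‖ ≠ 0 := norm_ne_zero_iff.2 hv
    have hu : ‖‖v‖⁻¹ • v‖ = 1 := by
      rw [norm_smul, norm_inv, norm_norm, inv_mul_cancel₀ hv']
    refine ⟨⟨pureQuaternion (‖v‖⁻¹ • v), ?_⟩, Or.inr ?_⟩
    · rw [mem_unitary_iff_normSq, Quaternion.normSq_eq_norm_mul_self, norm_pureQuaternion, hu,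
        one_mul]
    · ext1 x
      rw [reflection_orthogonal_singleton_apply]
      change _ = conjVector (pureQuaternion (‖v‖⁻¹ • v)) (-x)
      rw [conjVector_pureQuaternion, hu, one_pow, one_smul, sub_neg_eq_add, inner_neg_right,
        real_inner_smul_left, smul_smul, add_comm, sub_eq_add_neg, ← neg_smul]
      congr 2
      field_simp

/-- Every isometry is a product of reflections (Cartan–Dieudonné), and −1 is central, so the signs
can be collected. -/
lemma exists_quatIso_or_neg (f : Space3 ≃ₗᵢ[ℝ] Space3) :
    ∃ q, f = quatIso q ∨ f = quatIso q * LinearIsometryEquiv.neg ℝ := by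
  obtain ⟨l, -, rfl⟩ := f.reflections_generate_dim
  induction l with
  | nil => exact ⟨1, Or.inl (map_one _).symm⟩
  | cons v l ih =>
    rw [List.map_cons, List.prod_cons]
    generalize (List.map (fun v : Space3 => (ℝ ∙ v)ᗮ.reflection) l).prod = g at ih ⊢
    obtain ⟨q, hq⟩ := reflection_orthogonal_singleton v
    generalize (ℝ ∙ v)ᗮ.reflection = f at hq ⊢
    obtain ⟨r, hr⟩ := ih
    refine ⟨q * r, ?_⟩
    rw [map_mul]
    rcases hq with rfl | rfl <;> rcases hr with rfl | rfl
    · exact Or.inl rfl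
    · exact Or.inr (mul_assoc _ _ _).symm
    · right; rw [mul_assoc, isometryNeg_mul, mul_assoc]
    · left
      rw [mul_assoc, ← mul_assoc (LinearIsometryEquiv.neg ℝ), isometryNeg_mul, mul_assoc,
        isometryNeg_mul_self, mul_one]

/-- The homomorphism from the unit quaternions to the rotations of the sphere. -/
def quatPerm : unitary ℍ[ℝ] →* Equiv.Perm Sphere2 := spherePerm.comp quatIso

lemma coe_quatPerm (q : unitary ℍ[ℝ]) (p : Sphere2) :
    (quatPerm q p : Space3) = conjVector q p := rfl

lemma quatPerm_mem_rotationGroup (q : unitary ℍ[ℝ]) : quatPerm q ∈ rotationGroup :=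
  ⟨quatIso q, det_quatIso q, fun _ => rfl⟩

lemma det_neg_space3 : LinearMap.det (-LinearMap.id : Space3 →ₗ[ℝ] Space3) = -1 := by
  have : (-LinearMap.id : Space3 →ₗ[ℝ] Space3) = (-1 : ℝ) • LinearMap.id := by simp
  rw [this, LinearMap.det_smul, LinearMap.det_id, finrank_euclideanSpace_fin]
  norm_num

lemma mem_rotationGroup_iff {g : Equiv.Perm Sphere2} :
    g ∈ rotationGroup ↔ ∃ q, g = quatPerm q := by
  constructor
  · rintro ⟨f, hf, hg⟩
    have hg' : g = spherePerm f := by ext1 p; exact Subtype.ext (hg p)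
    obtain ⟨q, rfl | rfl⟩ := exists_quatIso_or_neg f
    · exact ⟨q, hg'⟩
    · exfalso
      have : ((quatIso q * LinearIsometryEquiv.neg ℝ : Space3 ≃ₗᵢ[ℝ] Space3).toLinearEquiv :
          Space3 →ₗ[ℝ] Space3) = ((quatIso q).toLinearEquiv : Space3 →ₗ[ℝ] Space3) ∘ₗ
            (-LinearMap.id) := by
        ext1 x; simp
      rw [this, LinearMap.det_comp, det_quatIso, det_neg_space3] at hf
      norm_num at hf
  · rintro ⟨q, rfl⟩
    exact quatPerm_mem_rotationGroup q

/-! ### Stereographic projection and Möbius transformations in homogeneous coordinates -/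

/-- The point of the extended complex plane with homogeneous coordinates `(a, b)`. -/
def homPoint (a b : ℂ) : OnePoint ℂ := if b = 0 then OnePoint.infty else OnePoint.some (a / b)

lemma homPoint_eq_iff {a b c d : ℂ} (h : a ≠ 0 ∨ b ≠ 0) (h' : c ≠ 0 ∨ d ≠ 0) :
    homPoint a b = homPoint c d ↔ a * d = c * b := by
  unfold homPoint
  by_cases hb : b = 0 <;> by_cases hd : d = 0
  · simp [hb, hd]
  · have ha : a ≠ 0 := by tauto
    simp [hb, hd, ha]
  · have hc : c ≠ 0 := by tauto
    simp [hb, hd, hc]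
  · simp [hb, hd, div_eq_div_iff]

lemma smul_homPoint (M : GL (Fin 2) ℂ) {a b : ℂ} (h : a ≠ 0 ∨ b ≠ 0) :
    M • homPoint a b = homPoint (M 0 0 * a + M 0 1 * b) (M 1 0 * a + M 1 1 * b) := by
  unfold homPoint
  by_cases hb : b = 0
  · have ha : a ≠ 0 := by tauto
    simp only [hb, if_true, OnePoint.smul_infty_eq_ite, mul_zero, add_zero, mul_eq_zero, ha,
      or_false]
    split_ifs
    · rfl
    · rw [mul_div_mul_right _ _ ha]
  · simp only [hb, if_false, OnePoint.smul_some_eq_ite]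
    have h1 : M 1 0 * (a / b) + M 1 1 = (M 1 0 * a + M 1 1 * b) / b := by field_simp
    have h0 : M 0 0 * (a / b) + M 0 1 = (M 0 0 * a + M 0 1 * b) / b := by field_simp
    simp only [h1, h0, div_eq_zero_iff, hb, or_false, div_div_div_cancel_right₀ hb]

lemma exists_homPoint (z : OnePoint ℂ) : ∃ a b, (a ≠ 0 ∨ b ≠ 0) ∧ z = homPoint a b := by
  induction z using OnePoint.rec with
  | infty => exact ⟨1, 0, by simp, by simp [homPoint]⟩
  | coe z => exact ⟨z, 1, by simp, by simp [homPoint]⟩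

lemma Sphere2.sum_sq (p : Sphere2) : p.1 0 ^ 2 + p.1 1 ^ 2 + p.1 2 ^ 2 = 1 := by
  have := EuclideanSpace.norm_sq_eq p.1
  rw [norm_eq_of_mem_sphere p] at this
  simpa [Fin.sum_univ_three] using this.symm

/-- The right side says that (a, b) is fixed by the Pauli-type matrix with rows (z, x + iy) and (x −
iy, −z) attached to p = (x, y, z). This linear description treats the north pole and the other
points alike. -/
lemma stereo_eq_homPoint_iff (p : Sphere2) {a b : ℂ} (h : a ≠ 0 ∨ b ≠ 0) :
    stereo p = homPoint a b ↔
      p.1 2 * a + (p.1 0 + p.1 1 * Complex.I) * b = a ∧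
      (p.1 0 - p.1 1 * Complex.I) * a - p.1 2 * b = b := by
  have hp := p.sum_sq
  have hpc : (p.1 0 : ℂ) ^ 2 + (p.1 1 : ℂ) ^ 2 + (p.1 2 : ℂ) ^ 2 = 1 := by
    have h := congrArg Complex.ofReal hp
    push_cast at h
    exact h
  by_cases h1 : p.1 2 = 1
  · have h0 : p.1 0 = 0 := by nlinarith [sq_nonneg (p.1 0), sq_nonneg (p.1 1)]
    have h2 : p.1 1 = 0 := by nlinarith [sq_nonneg (p.1 0), sq_nonneg (p.1 1)]
    have hs : stereo p = homPoint 1 0 := by simp [stereo, homPoint, h1]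
    rw [hs, homPoint_eq_iff (by simp) h, h1, h0, h2]
    simp [eq_comm (a := b), neg_eq_self]
  · have h1' : (1 - (p.1 2 : ℂ)) ≠ 0 := by
      rw [sub_ne_zero]; exact_mod_cast Ne.symm h1
    have hs : stereo p = homPoint (p.1 0 + p.1 1 * Complex.I) (1 - p.1 2) := by
      simp [stereo, homPoint, h1, h1']
    rw [hs, homPoint_eq_iff (Or.inr h1') h]
    constructor
    · intro e
      refine ⟨by linear_combination e, ?_⟩
      apply mul_left_cancel₀ h1'
      linear_combination (-p.1 0 + p.1 1 * Complex.I) * e + b * hpc - b * p.1 1 ^ 2 * Complex.I_sq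
    · rintro ⟨e, -⟩
      linear_combination e

/-- If p and q have the same image, the matrix attached to p − q kills a nonzero vector; its square
is the scalar |p − q|², which must vanish. -/
lemma stereo_injective : Function.Injective stereo := by
  intro p q hpq
  obtain ⟨a, b, h, hz⟩ := exists_homPoint (stereo p)
  obtain ⟨h1, h2⟩ := (stereo_eq_homPoint_iff p h).1 hz
  obtain ⟨h3, h4⟩ := (stereo_eq_homPoint_iff q h).1 (hpq ▸ hz)
  set x : ℝ := p.1 0 - q.1 0 with hx
  set y : ℝ := p.1 1 - q.1 1 with hy
  set z : ℝ := p.1 2 - q.1 2 with hz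
  have h5 : (z : ℂ) * a + (x + y * Complex.I) * b = 0 := by
    rw [hx, hy, hz]; push_cast; linear_combination h1 - h3
  have h6 : ((x : ℂ) - y * Complex.I) * a - z * b = 0 := by
    rw [hx, hy, hz]; push_cast; linear_combination h2 - h4
  have h7 : ((x ^ 2 + y ^ 2 + z ^ 2 : ℝ) : ℂ) = 0 := by
    push_cast
    rcases h with h | h
    · apply mul_right_cancel₀ h
      linear_combination z * h5 + (x + y * Complex.I) * h6 + a * y ^ 2 * Complex.I_sq
    · apply mul_right_cancel₀ h
      linear_combination (x - y * Complex.I) * h5 - z * h6 + b * y ^ 2 * Complex.I_sq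
  have h8 : x ^ 2 + y ^ 2 + z ^ 2 = 0 := by exact_mod_cast h7
  have hx0 : x = 0 := by nlinarith [sq_nonneg x, sq_nonneg y, sq_nonneg z]
  have hy0 : y = 0 := by nlinarith [sq_nonneg x, sq_nonneg y, sq_nonneg z]
  have hz0 : z = 0 := by nlinarith [sq_nonneg x, sq_nonneg y, sq_nonneg z]
  ext i
  fin_cases i
  · exact sub_eq_zero.1 hx0
  · exact sub_eq_zero.1 hy0
  · exact sub_eq_zero.1 hz0

/-- The complex matrix of a quaternion. -/
def quatMatrix (q : ℍ[ℝ]) : Matrix (Fin 2) (Fin 2) ℂ :=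
  !![q.re + q.imK * Complex.I, -q.imJ + q.imI * Complex.I;
     q.imJ + q.imI * Complex.I, q.re - q.imK * Complex.I]

lemma det_quatMatrix (q : unitary ℍ[ℝ]) : (quatMatrix q).det = 1 := by
  have h := mem_unitary_iff.1 q.2
  have hc : ((q : ℍ[ℝ]).re : ℂ) ^ 2 + ((q : ℍ[ℝ]).imI : ℂ) ^ 2 + ((q : ℍ[ℝ]).imJ : ℂ) ^ 2 +
    ((q : ℍ[ℝ]).imK : ℂ) ^ 2 = 1 := by exact_mod_cast h
  rw [quatMatrix, Matrix.det_fin_two_of]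
  linear_combination hc - (((q : ℍ[ℝ]).imI : ℂ) ^ 2 + ((q : ℍ[ℝ]).imK : ℂ) ^ 2) * Complex.I_sq

/-- The matrix of determinant one of a unit quaternion. -/
def quatSL (q : unitary ℍ[ℝ]) : Matrix.SpecialLinearGroup (Fin 2) ℂ :=
  ⟨quatMatrix q, det_quatMatrix q⟩

/-- `N` represents the permutation `f` of the sphere as a Möbius transformation. -/
def Represents (N : Matrix.SpecialLinearGroup (Fin 2) ℂ) (f : Equiv.Perm Sphere2) : Prop :=
  ∀ p, stereo (f p) = N.toGL • stereo p

lemma smul_homPoint' (N : Matrix.SpecialLinearGroup (Fin 2) ℂ) {a b : ℂ} (h : a ≠ 0 ∨ b ≠ 0) :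
    N.toGL • homPoint a b = homPoint (N 0 0 * a + N 0 1 * b) (N 1 0 * a + N 1 1 * b) :=
  smul_homPoint _ h

lemma mulVec_ne_zero (N : Matrix.SpecialLinearGroup (Fin 2) ℂ) {a b : ℂ} (h : a ≠ 0 ∨ b ≠ 0) :
    N 0 0 * a + N 0 1 * b ≠ 0 ∨ N 1 0 * a + N 1 1 * b ≠ 0 := by
  by_contra hc
  push Not at hc
  have hN := N.det_coe
  rw [Matrix.det_fin_two] at hN
  rcases h with h | h
  · exact h (by linear_combination N 1 1 * hc.1 - N 0 1 * hc.2 - a * hN)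
  · exact h (by linear_combination N 0 0 * hc.2 - N 1 0 * hc.1 - b * hN)

/-- The matrix of `q` conjugates the Pauli-type matrix of p into that of the rotated point, so it
carries the fixed vectors of the former to those of the latter. -/
lemma represents_quatSL (q : unitary ℍ[ℝ]) : Represents (quatSL q) (quatPerm q) := by
  intro p
  obtain ⟨a, b, h, hz⟩ := exists_homPoint (stereo p)
  obtain ⟨h1, h2⟩ := (stereo_eq_homPoint_iff p h).1 hz
  rw [hz, smul_homPoint' _ h, stereo_eq_homPoint_iff _ (mulVec_ne_zero _ h), coe_quatPerm,
    conjVector_apply]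
  have hq := mem_unitary_iff.1 q.2
  simp only [quatSL, quatMatrix, Matrix.of_apply, Matrix.cons_val', Matrix.cons_val_zero,
    Matrix.cons_val_one, Matrix.cons_val_fin_one, Matrix.cons_val]
  generalize (q : ℍ[ℝ]).re = s at *
  generalize (q : ℍ[ℝ]).imI = t at *
  generalize (q : ℍ[ℝ]).imJ = u at *
  generalize (q : ℍ[ℝ]).imK = v at *
  generalize p.1 0 = x at *
  generalize p.1 1 = y at *
  generalize p.1 2 = z at *
  have hc : (s : ℂ) ^ 2 + (t : ℂ) ^ 2 + (u : ℂ) ^ 2 + (v : ℂ) ^ 2 = 1 := by exact_mod_cast hq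
  push_cast
  constructor
  · linear_combination (norm := (ring_nf; simp only [Complex.I_sq]; ring))
      (s ^ 2 + t ^ 2 + u ^ 2 + v ^ 2) * ((s + v * Complex.I) * h1 + (-u + t * Complex.I) * h2)
        + ((s + v * Complex.I) * a + (-u + t * Complex.I) * b) * hc
  · linear_combination (norm := (ring_nf; simp only [Complex.I_sq]; ring))
      (s ^ 2 + t ^ 2 + u ^ 2 + v ^ 2) * ((u + t * Complex.I) * h1 + (s - v * Complex.I) * h2)
        + ((u + t * Complex.I) * a + (s - v * Complex.I) * b) * hc

/-- Dividing a matrix by a square root of its determinant normalizes the determinant to 1. The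
representative is then unique up to sign. -/
lemma exists_represents {f : Equiv.Perm Sphere2} (hf : f ∈ mobiusGroup) : ∃ N, Represents N f := by
  obtain ⟨M, hM⟩ := hf
  obtain ⟨c, hc⟩ := IsAlgClosed.exists_pow_nat_eq M.det.val (n := 2) (by norm_num)
  have hM0 : M 0 0 * M 1 1 - M 0 1 * M 1 0 = c ^ 2 := by
    rw [hc, Matrix.GeneralLinearGroup.val_det_apply, Matrix.det_fin_two]
  have hc0 : c ≠ 0 := by
    rintro rfl
    exact M.det.ne_zero (by rw [← hc]; simp)
  obtain ⟨N, hN⟩ : ∃ N : Matrix.SpecialLinearGroup (Fin 2) ℂ, ∀ i j, N i j = c⁻¹ * M i j := by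
    refine ⟨⟨c⁻¹ • M.val, ?_⟩, fun i j => rfl⟩
    rw [Matrix.det_smul, Matrix.det_fin_two, hM0, Fintype.card_fin]
    field_simp
  refine ⟨N, fun p => ?_⟩
  obtain ⟨a, b, h, hz⟩ := exists_homPoint (stereo p)
  rw [hM, hz, smul_homPoint _ h, smul_homPoint' _ h]
  simp only [hN, mul_assoc, ← mul_add]
  unfold homPoint
  simp only [mul_eq_zero, inv_eq_zero, hc0, false_or, mul_div_mul_left _ _ (inv_ne_zero hc0)]

lemma rotationGroup_le_mobiusGroup : rotationGroup ≤ mobiusGroup := by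
  intro g hg
  obtain ⟨q, rfl⟩ := mem_rotationGroup_iff.1 hg
  exact ⟨_, represents_quatSL q⟩

lemma Represents.mul {M N : Matrix.SpecialLinearGroup (Fin 2) ℂ} {f g : Equiv.Perm Sphere2}
    (hM : Represents M f) (hN : Represents N g) : Represents (M * N) (f * g) := fun p => by
  rw [Equiv.Perm.mul_apply, hM, hN, map_mul, mul_smul]

lemma Represents.inv {M : Matrix.SpecialLinearGroup (Fin 2) ℂ} {f : Equiv.Perm Sphere2}
    (hM : Represents M f) : Represents M⁻¹ f⁻¹ := fun p => by
  rw [map_inv, eq_inv_smul_iff, ← hM, ← Equiv.Perm.mul_apply, mul_inv_cancel, Equiv.Perm.one_apply]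

lemma Represents.ext {M : Matrix.SpecialLinearGroup (Fin 2) ℂ} {f g : Equiv.Perm Sphere2}
    (hf : Represents M f) (hg : Represents M g) : f = g :=
  Equiv.ext fun p => stereo_injective (by rw [hf, hg])

/-- A Möbius transformation of determinant one with three fixed points is given by `± 1`. -/
lemma eq_one_or_neg_one_of_fixed {N : Matrix.SpecialLinearGroup (Fin 2) ℂ} {x y z : OnePoint ℂ}
    (hxy : x ≠ y) (hxz : x ≠ z) (hyz : y ≠ z) (hx : N.toGL • x = x) (hy : N.toGL • y = y)
    (hz : N.toGL • z = z) : (N : Matrix (Fin 2) (Fin 2) ℂ) = 1 ∨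
      (N : Matrix (Fin 2) (Fin 2) ℂ) = -1 := by
  -- Fixed points are the zeros of a binary quadratic form in the homogeneous coordinates.
  have key : ∀ {w : OnePoint ℂ}, N.toGL • w = w → ∃ a b, (a ≠ 0 ∨ b ≠ 0) ∧ w = homPoint a b ∧
      N 1 0 * a ^ 2 + (N 1 1 - N 0 0) * a * b - N 0 1 * b ^ 2 = 0 := by
    intro w hw
    obtain ⟨a, b, h, rfl⟩ := exists_homPoint w
    refine ⟨a, b, h, rfl, ?_⟩
    rw [smul_homPoint' _ h, homPoint_eq_iff (mulVec_ne_zero _ h) h] at hw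
    linear_combination -hw
  obtain ⟨a, b, h1, rfl, e1⟩ := key hx
  obtain ⟨c, d, h2, rfl, e2⟩ := key hy
  obtain ⟨e, f, h3, rfl, e3⟩ := key hz
  rw [Ne, homPoint_eq_iff h1 h2, ← sub_eq_zero] at hxy
  rw [Ne, homPoint_eq_iff h1 h3, ← sub_eq_zero] at hxz
  rw [Ne, homPoint_eq_iff h2 h3, ← sub_eq_zero] at hyz
  -- Up to sign, this product is the determinant of the linear system that three zeros impose on the
  -- coefficients of the form. The combinations below are Cramer's rule.
  have hD := mul_ne_zero (mul_ne_zero hxy hxz) hyz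
  have h10 : N 1 0 = 0 := by
    refine (mul_eq_zero.1 ?_).resolve_right hD
    linear_combination (c * d * f ^ 2 - d ^ 2 * e * f) * e1 - (a * b * f ^ 2 - b ^ 2 * e * f) * e2
      + (a * b * d ^ 2 - b ^ 2 * c * d) * e3
  have h11 : N 1 1 - N 0 0 = 0 := by
    refine (mul_eq_zero.1 ?_).resolve_right hD
    linear_combination -(c ^ 2 * f ^ 2 - d ^ 2 * e ^ 2) * e1
      + (a ^ 2 * f ^ 2 - b ^ 2 * e ^ 2) * e2 - (a ^ 2 * d ^ 2 - b ^ 2 * c ^ 2) * e3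
  have h01 : N 0 1 = 0 := by
    refine (mul_eq_zero.1 ?_).resolve_right hD
    linear_combination -(c ^ 2 * e * f - c * d * e ^ 2) * e1
      + (a ^ 2 * e * f - a * b * e ^ 2) * e2 - (a ^ 2 * c * d - a * b * c ^ 2) * e3
  have hN := N.det_coe
  rw [Matrix.det_fin_two, h10, h01, sub_eq_zero.1 h11, mul_zero, sub_zero, mul_self_eq_one_iff]
    at hN
  refine hN.imp (fun h => ?_) (fun h => ?_) <;>
  · ext i j
    fin_cases i <;> fin_cases j <;> simp [h, h10, h01, sub_eq_zero.1 h11]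

lemma Represents.eq_one_or_eq_neg_one {N : Matrix.SpecialLinearGroup (Fin 2) ℂ}
    {f : Equiv.Perm Sphere2} (hN : Represents N f) {x y z : Sphere2} (hxy : x ≠ y) (hxz : x ≠ z)
    (hyz : y ≠ z) (hx : f x = x) (hy : f y = y) (hz : f z = z) :
    (N : Matrix (Fin 2) (Fin 2) ℂ) = 1 ∨ (N : Matrix (Fin 2) (Fin 2) ℂ) = -1 := by
  refine eq_one_or_neg_one_of_fixed (stereo_injective.ne hxy) (stereo_injective.ne hxz)
    (stereo_injective.ne hyz) ?_ ?_ ?_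
  · rw [← hN, hx]
  · rw [← hN, hy]
  · rw [← hN, hz]

lemma exists_three_points : ∃ x y z : Sphere2, x ≠ y ∧ x ≠ z ∧ y ≠ z := by
  refine ⟨⟨EuclideanSpace.single 0 1, by simp⟩, ⟨EuclideanSpace.single 1 1, by simp⟩,
    ⟨EuclideanSpace.single 2 1, by simp⟩, fun h => ?_, fun h => ?_, fun h => ?_⟩
  · simpa using congrArg (fun p : Sphere2 => p.1 0) h
  · simpa using congrArg (fun p : Sphere2 => p.1 0) h
  · simpa using congrArg (fun p : Sphere2 => p.1 1) h

lemma Represents.eq_or_eq_neg {M N : Matrix.SpecialLinearGroup (Fin 2) ℂ}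
    {f : Equiv.Perm Sphere2} (hM : Represents M f) (hN : Represents N f) :
    (M : Matrix (Fin 2) (Fin 2) ℂ) = N ∨ (M : Matrix (Fin 2) (Fin 2) ℂ) = -N := by
  obtain ⟨x, y, z, hxy, hxz, hyz⟩ := exists_three_points
  have h := hM.inv.mul hN
  rw [inv_mul_cancel] at h
  have hNM : (N : Matrix (Fin 2) (Fin 2) ℂ) =
      M * (M⁻¹ * N : Matrix.SpecialLinearGroup (Fin 2) ℂ) := by
    rw [← Matrix.SpecialLinearGroup.coe_mul, mul_inv_cancel_left]
  rcases h.eq_one_or_eq_neg_one hxy hxz hyz rfl rfl rfl with h | h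
  · left; rw [hNM, h, mul_one]
  · right; rw [hNM, h, mul_neg, mul_one, neg_neg]

lemma eq_of_eq_on_three {f g : Equiv.Perm Sphere2} (hf : f ∈ mobiusGroup) (hg : g ∈ mobiusGroup)
    {x y z : Sphere2} (hxy : x ≠ y) (hxz : x ≠ z) (hyz : y ≠ z) (hx : f x = g x) (hy : f y = g y)
    (hz : f z = g z) : f = g := by
  obtain ⟨N, hN⟩ := exists_represents (mul_mem (inv_mem hg) hf)
  have h1 : g⁻¹ * f = 1 := by
    rcases hN.eq_one_or_eq_neg_one hxy hxz hyz (by simp [hx]) (by simp [hy]) (by simp [hz])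
      with h | h
    · refine hN.ext fun p => ?_
      obtain ⟨a, b, hab, hz⟩ := exists_homPoint (stereo p)
      rw [Equiv.Perm.one_apply, hz, smul_homPoint' _ hab, h]
      simp
    · refine hN.ext fun p => ?_
      obtain ⟨a, b, hab, hz⟩ := exists_homPoint (stereo p)
      rw [Equiv.Perm.one_apply, hz, smul_homPoint' _ hab, h]
      have h' : -a ≠ 0 ∨ -b ≠ 0 := by simpa using hab
      simp [homPoint_eq_iff hab h', mul_comm]
  exact (inv_mul_eq_one.1 h1).symm

/-- The images of the three points lie in `α` and determine the transformation, so the stabilizer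
embeds in `α × α × α`. -/
lemma finite_mobiusStabilizer {α : Set Sphere2} (hα : α.Finite) {x y z : Sphere2} (hx : x ∈ α)
    (hy : y ∈ α) (hz : z ∈ α) (hxy : x ≠ y) (hxz : x ≠ z) (hyz : y ≠ z) :
    Finite (mobiusStabilizer α) := by
  have := hα.to_subtype
  have hmem : ∀ (f : mobiusStabilizer α) {p}, p ∈ α → f.1 p ∈ α := by
    intro f p hp
    have h : f.1 • p ∈ f.1 • α := Set.smul_mem_smul_set hp
    rwa [MulAction.mem_stabilizer_iff.1 f.2.2] at h
  refine Finite.of_injective (β := α × α × α)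
    (fun f => (⟨f.1 x, hmem f hx⟩, ⟨f.1 y, hmem f hy⟩, ⟨f.1 z, hmem f hz⟩)) ?_
  intro f g hfg
  simp only [Prod.mk.injEq, Subtype.mk.injEq] at hfg
  exact Subtype.ext (eq_of_eq_on_three f.2.1 g.2.1 hxy hxz hyz hfg.1 hfg.2.1 hfg.2.2)

/-! ### Finite Möbius groups and invariant hermitian forms -/

open Matrix in
/-- A finite group of Möbius transformations has an invariant hermitian form. -/
lemma exists_invariant_form (A : Subgroup (Equiv.Perm Sphere2)) [Finite A] (hA : A ≤ mobiusGroup) :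
    ∃ H : Matrix (Fin 2) (Fin 2) ℂ, H 0 0 ≠ 0 ∧
      ∀ f ∈ A, ∀ N, Represents N f → (N : Matrix (Fin 2) (Fin 2) ℂ)ᴴ * H * N = H := by
  have := Fintype.ofFinite A
  choose M hM using fun f : A => exists_represents (hA f.2)
  -- Each `M f` is determined only up to sign, but the sign cancels in the summand, so right
  -- translation in the group permutes the summands.
  refine ⟨∑ f, (M f : Matrix (Fin 2) (Fin 2) ℂ)ᴴ * M f, ?_, ?_⟩
  · have h : (∑ f, (M f : Matrix (Fin 2) (Fin 2) ℂ)ᴴ * M f) 0 0 =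
        ((∑ f, (Complex.normSq (M f 0 0) + Complex.normSq (M f 1 0)) : ℝ) : ℂ) := by
      rw [Matrix.sum_apply, Complex.ofReal_sum]
      refine Finset.sum_congr rfl fun f _ => ?_
      rw [Complex.ofReal_add, Complex.normSq_eq_conj_mul_self, Complex.normSq_eq_conj_mul_self,
        Matrix.mul_apply, Fin.sum_univ_two]
      rfl
    rw [h, Complex.ofReal_ne_zero]
    refine (Finset.sum_pos (fun f _ => ?_) Finset.univ_nonempty).ne'
    have h0 := Complex.normSq_nonneg (M f 0 0)
    have h1 := Complex.normSq_nonneg (M f 1 0)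
    refine lt_of_le_of_ne (add_nonneg h0 h1) fun h => ?_
    have hd := (M f).det_coe
    rw [Matrix.det_fin_two, Complex.normSq_eq_zero.1 (by linarith : Complex.normSq (M f 0 0) = 0),
      Complex.normSq_eq_zero.1 (by linarith : Complex.normSq (M f 1 0) = 0)] at hd
    simp at hd
  · intro g hg N hN
    rw [Finset.mul_sum, Finset.sum_mul]
    refine Fintype.sum_equiv (Equiv.mulRight ⟨g, hg⟩) _ _ fun f => ?_
    have h : (N : Matrix (Fin 2) (Fin 2) ℂ)ᴴ * ((M f : Matrix (Fin 2) (Fin 2) ℂ)ᴴ * M f) * N =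
        ((M f * N : Matrix.SpecialLinearGroup (Fin 2) ℂ) : Matrix (Fin 2) (Fin 2) ℂ)ᴴ *
          (M f * N : Matrix.SpecialLinearGroup (Fin 2) ℂ) := by
      rw [Matrix.SpecialLinearGroup.coe_mul, conjTranspose_mul]
      simp only [mul_assoc]
    rw [h]
    rcases ((hM f).mul hN).eq_or_eq_neg (hM (f * ⟨g, hg⟩)) with h | h
    · rw [h]; rfl
    · rw [h, conjTranspose_neg, neg_mul_neg]; rfl

/-- The unit quaternion `i`. -/
def unitI : unitary ℍ[ℝ] := ⟨quat 0 1 0 0, mem_unitary_iff.2 (by simp)⟩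

/-- The unit quaternion `j`. -/
def unitJ : unitary ℍ[ℝ] := ⟨quat 0 0 1 0, mem_unitary_iff.2 (by simp)⟩

-- A unitary matrix of determinant one satisfies N₁₁ = conj N₀₀ and N₀₁ = −conj N₁₀, which is
-- exactly the shape of `quatMatrix`.
open Matrix in
lemma exists_quatPerm_of_unitary {N : Matrix.SpecialLinearGroup (Fin 2) ℂ} {f : Equiv.Perm Sphere2}
    (hN : Represents N f) (h : (N : Matrix (Fin 2) (Fin 2) ℂ)ᴴ * N = 1) : ∃ q, f = quatPerm q := by
  have hd := N.det_coe
  rw [Matrix.det_fin_two] at hd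
  have h0 := congrFun (congrFun h 0) 0
  have h1 := congrFun (congrFun h 0) 1
  simp only [Matrix.mul_apply, Fin.sum_univ_two, Matrix.conjTranspose_apply, Matrix.one_apply_eq,
    Matrix.one_apply_ne (zero_ne_one : (0 : Fin 2) ≠ 1)] at h0 h1
  have e1 : N 1 1 = star (N 0 0) := by
    linear_combination star (N 0 0) * hd - N 1 1 * h0 + N 1 0 * h1
  have e0 : N 0 1 = -star (N 1 0) := by
    linear_combination -star (N 1 0) * hd - N 0 1 * h0 + N 0 0 * h1
  have hq : quat (N 0 0).re (N 1 0).im (N 1 0).re (N 0 0).im ∈ unitary ℍ[ℝ] := by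
    rw [mem_unitary_iff]
    have := congrArg Complex.re h0
    simp at this
    simp only [quat_re, quat_imI, quat_imJ, quat_imK]
    linarith
  have hN' : N = quatSL ⟨_, hq⟩ := by
    ext i j
    fin_cases i <;> fin_cases j <;> apply Complex.ext <;>
      simp [quatSL, quatMatrix, e0, e1]
  rw [hN'] at hN
  exact ⟨_, hN.ext (represents_quatSL _)⟩

/-- A finite group of Möbius transformations that contains the half-turns about the coordinate axes
consists of rotations. -/
lemma le_rotationGroup_of_finite (A : Subgroup (Equiv.Perm Sphere2)) [Finite A]
    (hA : A ≤ mobiusGroup) (hi : quatPerm unitI ∈ A) (hj : quatPerm unitJ ∈ A) :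
    A ≤ rotationGroup := by
  obtain ⟨H, hH0, hH⟩ := exists_invariant_form A hA
  have h1 := hH _ hi _ (represents_quatSL _)
  have h2 := hH _ hj _ (represents_quatSL _)
  intro f hf
  obtain ⟨N, hN⟩ := exists_represents (hA hf)
  have h3 := hH _ hf _ hN
  have a1 := congrFun (congrFun h1 0) 0
  have a2 := congrFun (congrFun h1 0) 1
  have b2 := congrFun (congrFun h2 0) 1
  simp [quatSL, quatMatrix, unitI, unitJ, Matrix.mul_apply, Fin.sum_univ_two] at a1 a2 b2
  rw [mul_right_comm, Complex.I_mul_I, neg_one_mul, neg_neg] at a1 a2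
  -- Invariance under i gives `H 0 1 = H 1 0`, invariance under j gives `H 0 1 = -H 1 0`.
  have h01 : H 0 1 = 0 := by linear_combination (-a2 - b2) / 2
  have h10 : H 1 0 = 0 := by linear_combination (a2 - b2) / 2
  have hs : H = H 0 0 • (1 : Matrix (Fin 2) (Fin 2) ℂ) := by
    ext i j
    fin_cases i <;> fin_cases j <;> simp [h01, h10, a1]
  rw [hs, Matrix.mul_smul, mul_one, Matrix.smul_mul] at h3
  obtain ⟨q, rfl⟩ := exists_quatPerm_of_unitary hN (smul_right_injective _ hH0 h3)
  exact quatPerm_mem_rotationGroup q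

/-! ### Finite groups of unit quaternions that contain the Hurwitz units -/

/-- A submonoid of the quaternions that is a group of unit quaternions and contains the units of the
Hurwitz order. -/
structure ContainsHurwitzUnits (M : Submonoid ℍ[ℝ]) : Prop where
  le_unitary : M ≤ unitary ℍ[ℝ]
  star_mem : ∀ q ∈ M, star q ∈ M
  i_mem : quat 0 1 0 0 ∈ M
  j_mem : quat 0 0 1 0 ∈ M
  w_mem : quat (1 / 2) (1 / 2) (1 / 2) (1 / 2) ∈ M

lemma quat_eta (q : ℍ[ℝ]) : quat q.re q.imI q.imJ q.imK = q := rfl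

lemma quat_mul (a b c d a' b' c' d' : ℝ) : quat a b c d * quat a' b' c' d' =
    quat (a * a' - b * b' - c * c' - d * d') (a * b' + b * a' + c * d' - d * c')
      (a * c' - b * d' + c * a' + d * b') (a * d' + b * c' - c * b' + d * a') := by
  ext <;> simp

lemma star_quat (a b c d : ℝ) : star (quat a b c d) = quat a (-b) (-c) (-d) := by
  ext <;> simp

lemma one_eq_quat : (1 : ℍ[ℝ]) = quat 1 0 0 0 := rfl

namespace ContainsHurwitzUnits

variable {M N : Submonoid ℍ[ℝ]} {a b c d : ℝ}

lemma sum_sq (h : ContainsHurwitzUnits M) (hq : quat a b c d ∈ M) :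
    a ^ 2 + b ^ 2 + c ^ 2 + d ^ 2 = 1 :=
  mem_unitary_iff.1 (h.le_unitary hq)

lemma conj_mem (h : ContainsHurwitzUnits M) (hq : quat a b c d ∈ M) :
    quat a (-b) (-c) (-d) ∈ M := by
  rw [← star_quat]; exact h.star_mem _ hq

lemma neg_mem (h : ContainsHurwitzUnits M) (hq : quat a b c d ∈ M) :
    quat (-a) (-b) (-c) (-d) ∈ M := by
  have := M.mul_mem (M.mul_mem h.i_mem h.i_mem) hq
  simpa [quat_mul] using this

lemma mul_i_mem (h : ContainsHurwitzUnits M) (hq : quat a b c d ∈ M) :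
    quat (-b) a d (-c) ∈ M := by
  have := M.mul_mem hq h.i_mem
  simpa [quat_mul] using this

lemma flip_jk_mem (h : ContainsHurwitzUnits M) (hq : quat a b c d ∈ M) :
    quat a b (-c) (-d) ∈ M := by
  have := M.mul_mem (M.mul_mem h.i_mem hq) (h.star_mem _ h.i_mem)
  simpa [quat_mul, star_quat] using this

lemma flip_ik_mem (h : ContainsHurwitzUnits M) (hq : quat a b c d ∈ M) :
    quat a (-b) c (-d) ∈ M := by
  have := M.mul_mem (M.mul_mem h.j_mem hq) (h.star_mem _ h.j_mem)
  simpa [quat_mul, star_quat] using this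

lemma cyclic_mem (h : ContainsHurwitzUnits M) (hq : quat a b c d ∈ M) :
    quat a d b c ∈ M := by
  have := M.mul_mem (M.mul_mem h.w_mem hq) (h.star_mem _ h.w_mem)
  rw [star_quat, quat_mul, quat_mul] at this
  convert this using 2 <;> ring

lemma half_mem (h : ContainsHurwitzUnits M) (ha : a = 1 / 2 ∨ a = -(1 / 2))
    (hb : b = 1 / 2 ∨ b = -(1 / 2)) (hc : c = 1 / 2 ∨ c = -(1 / 2))
    (hd : d = 1 / 2 ∨ d = -(1 / 2)) : quat a b c d ∈ M := by
  have h1 := h.w_mem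
  have h2 := h.flip_jk_mem h1
  have h3 := h.cyclic_mem h2
  have h4 := h.cyclic_mem h3
  have h5 := h.conj_mem h1
  have h6 := h.conj_mem h2
  have h7 := h.conj_mem h3
  have h8 := h.conj_mem h4
  rcases ha with rfl | rfl
  · rcases hb with rfl | rfl <;> rcases hc with rfl | rfl <;> rcases hd with rfl | rfl <;>
      simp only [neg_neg] at * <;> assumption
  · have := h.neg_mem h1
    have := h.neg_mem h2
    have := h.neg_mem h3
    have := h.neg_mem h4
    have := h.neg_mem h5
    have := h.neg_mem h6
    have := h.neg_mem h7
    have := h.neg_mem h8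
    rcases hb with rfl | rfl <;> rcases hc with rfl | rfl <;> rcases hd with rfl | rfl <;>
      simp only [neg_neg] at * <;> assumption

/-- A bound on the angles of rotation: the real part of every element other than `1` is at most
`c`. -/
def ReBound (M : Submonoid ℍ[ℝ]) (r : ℝ) : Prop :=
  ∀ a b c d, quat a b c d ∈ M → a ≠ 1 → a ≤ r

lemma eq_half_or_neg {x : ℝ} (h : x ^ 2 = 1 / 4) : x = 1 / 2 ∨ x = -(1 / 2) := by
  apply sq_eq_sq_iff_eq_or_eq_neg.1
  rw [h]; norm_num

lemma sq_le_of_reBound (h : ContainsHurwitzUnits M) {r : ℝ} (hr : r ≤ 1 / 2) (hb : ReBound M r)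
    (hq : quat a b c d ∈ M) : a ^ 2 ≤ 1 / 4 ∨ a = 1 ∨ a = -1 := by
  by_cases e1 : a = 1
  · exact Or.inr (Or.inl e1)
  by_cases e2 : a = -1
  · exact Or.inr (Or.inr e2)
  have h1 := hb _ _ _ _ hq e1
  have h2 := hb _ _ _ _ (h.neg_mem hq) fun e => e2 (by linarith)
  left; nlinarith

lemma unit_mem (h : ContainsHurwitzUnits M) (ha : a = 1 ∨ a = -1) :
    quat a 0 0 0 ∈ M ∧ quat 0 a 0 0 ∈ M ∧ quat 0 0 a 0 ∈ M ∧ quat 0 0 0 a ∈ M := by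
  have h1 : quat 1 0 0 0 ∈ M := M.one_mem
  have hi := h.i_mem
  have hj := h.cyclic_mem hi
  have hk := h.cyclic_mem hj
  rcases ha with rfl | rfl
  · exact ⟨h1, hi, hj, hk⟩
  · have n1 := h.neg_mem h1
    have ni := h.neg_mem hi
    have nj := h.neg_mem hj
    have nk := h.neg_mem hk
    rw [neg_zero] at *
    exact ⟨n1, ni, nj, nk⟩

/-- If no element other than `1` is nearer to `1` than the Hurwitz units, then all elements are
Hurwitz units. -/
lemma le_of_reBound (hM : ContainsHurwitzUnits M) (hN : ContainsHurwitzUnits N) {r : ℝ}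
    (hr : r ≤ 1 / 2) (hb : ReBound M r) : M ≤ N := by
  intro q hq
  rw [← quat_eta q] at hq ⊢
  generalize q.re = a at *
  generalize q.imI = b at *
  generalize q.imJ = c at *
  generalize q.imK = d at *
  have hs := hM.sum_sq hq
  have hq' := hM.cyclic_mem hq
  have hq'' := hM.cyclic_mem hq'
  have hone : ∀ {x y z w : ℝ}, x = 1 ∨ x = -1 → x ^ 2 + y ^ 2 + z ^ 2 + w ^ 2 = 1 →
      y = 0 ∧ z = 0 ∧ w = 0 := by
    intro x y z w hx hs
    have hx2 : x ^ 2 = 1 := by rcases hx with rfl | rfl <;> norm_num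
    refine ⟨?_, ?_, ?_⟩ <;> nlinarith [sq_nonneg y, sq_nonneg z, sq_nonneg w]
  have hneg : ∀ {x : ℝ}, -x = 1 ∨ -x = -1 → x = 1 ∨ x = -1 := by
    rintro x (h | h)
    · right; linarith
    · left; linarith
  -- Multiplying by i moves an imaginary component of `q` or of a cyclic conjugate to the real
  -- place. So each component is ±1, and then the others vanish, or has square at most 1/4. Four
  -- such squares with sum 1 all equal 1/4.
  rcases hM.sq_le_of_reBound hr hb hq with ha | ha
  swap
  · obtain ⟨rfl, rfl, rfl⟩ := hone ha hs
    exact (hN.unit_mem ha).1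
  rcases hM.sq_le_of_reBound hr hb (hM.mul_i_mem hq) with hb' | hb'
  swap
  · obtain ⟨rfl, rfl, rfl⟩ := hone (y := a) (z := c) (w := d) (hneg hb') (by linarith)
    exact (hN.unit_mem (hneg hb')).2.1
  rcases hM.sq_le_of_reBound hr hb (hM.mul_i_mem hq') with hd' | hd'
  swap
  · obtain ⟨rfl, rfl, rfl⟩ := hone (y := a) (z := b) (w := c) (hneg hd') (by linarith)
    exact (hN.unit_mem (hneg hd')).2.2.2
  rcases hM.sq_le_of_reBound hr hb (hM.mul_i_mem hq'') with hc' | hc'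
  swap
  · obtain ⟨rfl, rfl, rfl⟩ := hone (y := a) (z := b) (w := d) (hneg hc') (by linarith)
    exact (hN.unit_mem (hneg hc')).2.2.1
  rw [neg_sq] at hb' hc' hd'
  exact hN.half_mem (eq_half_or_neg (by linarith)) (eq_half_or_neg (by linarith))
    (eq_half_or_neg (by linarith)) (eq_half_or_neg (by linarith))

/-- Multiplication by the unit with real part 1/2 and imaginary parts ±1/2 of signs opposite to x,
y, z gives the real part (c + |x| + |y| + |z|)/2. It is at most c unless the product is 1, in which
case c would be 1/2. -/
lemma abs_add_abs_add_abs_le (h : ContainsHurwitzUnits M) {x y z : ℝ} (hb : ReBound M c)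
    (hc : 1 / 2 < c) (hq : quat c x y z ∈ M) : |x| + |y| + |z| ≤ c := by
  have key : ∀ {e f g : ℝ}, (e = 1 / 2 ∨ e = -(1 / 2)) → (f = 1 / 2 ∨ f = -(1 / 2)) →
      (g = 1 / 2 ∨ g = -(1 / 2)) → -(e * x + f * y + g * z) ≤ c / 2 := by
    intro e f g he hf hg
    have hm := M.mul_mem hq (h.half_mem (Or.inl rfl) he hf hg)
    rw [quat_mul] at hm
    have hs := h.sum_sq hq
    by_contra hlt
    push Not at hlt
    have h1 : c * (1 / 2) - x * e - y * f - z * g = 1 := by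
      by_contra hne
      have := hb _ _ _ _ hm hne
      linarith
    have he2 : e ^ 2 = 1 / 4 := by rcases he with rfl | rfl <;> norm_num
    have hf2 : f ^ 2 = 1 / 4 := by rcases hf with rfl | rfl <;> norm_num
    have hg2 : g ^ 2 = 1 / 4 := by rcases hg with rfl | rfl <;> norm_num
    nlinarith [sq_nonneg (c - 1 / 2), sq_nonneg (x + e), sq_nonneg (y + f), sq_nonneg (z + g)]
  rcases abs_cases x with ⟨e1, -⟩ | ⟨e1, -⟩ <;> rcases abs_cases y with ⟨e2, -⟩ | ⟨e2, -⟩ <;>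
    rcases abs_cases z with ⟨e3, -⟩ | ⟨e3, -⟩ <;> rw [e1, e2, e3]
  · linarith [key (Or.inr rfl) (Or.inr rfl) (Or.inr rfl)]
  · linarith [key (Or.inr rfl) (Or.inr rfl) (Or.inl rfl)]
  · linarith [key (Or.inr rfl) (Or.inl rfl) (Or.inr rfl)]
  · linarith [key (Or.inr rfl) (Or.inl rfl) (Or.inl rfl)]
  · linarith [key (Or.inl rfl) (Or.inr rfl) (Or.inr rfl)]
  · linarith [key (Or.inl rfl) (Or.inr rfl) (Or.inl rfl)]
  · linarith [key (Or.inl rfl) (Or.inl rfl) (Or.inr rfl)]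
  · linarith [key (Or.inl rfl) (Or.inl rfl) (Or.inl rfl)]

/-- The commutator of two rotations by the same angle is not nearer to the identity. -/
lemma commutator_bound (h : ContainsHurwitzUnits M) {x y z x' y' z' : ℝ} (hb : ReBound M c)
    (hq : quat c x y z ∈ M) (hq' : quat c x' y' z' ∈ M)
    (hne : (y * z' - z * y') ^ 2 + (z * x' - x * z') ^ 2 + (x * y' - y * x') ^ 2 ≠ 0) :
    1 - c ≤ 2 * ((y * z' - z * y') ^ 2 + (z * x' - x * z') ^ 2 + (x * y' - y * x') ^ 2) := by
  have hs := h.sum_sq hq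
  have hs' := h.sum_sq hq'
  have hm := M.mul_mem (M.mul_mem hq hq') (M.mul_mem (h.conj_mem hq) (h.conj_mem hq'))
  simp only [quat_mul] at hm
  have hre := hb _ _ _ _ hm
  set D := (y * z' - z * y') ^ 2 + (z * x' - x * z') ^ 2 + (x * y' - y * x') ^ 2 with hD
  -- The real part of the commutator is 1 − 2D, where D is the squared length of the cross product
  -- of the two imaginary parts.
  have key : ∀ r, r = (c ^ 2 + x ^ 2 + y ^ 2 + z ^ 2) * (c ^ 2 + x' ^ 2 + y' ^ 2 + z' ^ 2) - 2 * D →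
      (r ≠ 1 → r ≤ c) → 1 - c ≤ 2 * D := by
    intro r hr hrc
    rw [hs, hs', one_mul] at hr
    have := hrc fun h1 => hne (by linarith)
    linarith
  exact key _ (by rw [hD]; ring) hre

/-- This is the commutator bound for two extremal elements with orthogonal axes, s being the squared
length of the imaginary part. Division by 1 − c turns it into 1 ≤ 2(1 − c²)(1 + c), which fails for
3/4 ≤ c² < 1. -/
lemma sq_lt_three_quarters {s : ℝ} (hc : 1 / 2 < c) (hc1 : c < 1) (hs : s = 1 - c ^ 2)
    (h : 1 - c ≤ 2 * s ^ 2) : c ^ 2 < 3 / 4 := by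
  by_contra hlt
  push Not at hlt
  subst hs
  have h1 : 0 < 1 - c := by linarith
  have h2 : 1 ≤ 2 * ((1 - c ^ 2) * (1 + c)) := by
    refine le_of_mul_le_mul_left ?_ h1
    nlinarith
  nlinarith

lemma square_mem (h : ContainsHurwitzUnits M) (hq : quat a b c d ∈ M) :
    quat (2 * a ^ 2 - 1) (2 * a * b) (2 * a * c) (2 * a * d) ∈ M := by
  have hm := M.mul_mem hq hq
  have hs := h.sum_sq hq
  rw [quat_mul] at hm
  convert hm using 2
  · linarith
  all_goals ring

/-- The commutator with the cyclic conjugate, whose axis is perpendicular, gives c² < 3/4, so x >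
1/2 if x is taken nonnegative. Then q² times −i has real part 2cx > c, so 2cx = 1; this forces c =
x, against c² > 1/2. -/
lemma not_axis_mem (h : ContainsHurwitzUnits M) {x : ℝ} (hb : ReBound M c) (hc1 : c < 1)
    (hc : 1 / 2 < c ^ 2) (hc0 : 1 / 2 < c) : quat c x 0 0 ∉ M := by
  intro hq
  wlog hx : 0 ≤ x generalizing x
  · exact this (by simpa using h.conj_mem hq) (by linarith)
  have hs := h.sum_sq hq
  have h1 := h.commutator_bound hb hq (h.cyclic_mem hq) (by
    have : x * x ≠ 0 := by nlinarith
    simpa using this)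
  have h2 : c ^ 2 < 3 / 4 :=
    sq_lt_three_quarters (s := x ^ 2) hc0 hc1 (by linarith) (by nlinarith)
  have h3 := hb _ _ _ _ (h.neg_mem (h.mul_i_mem (h.square_mem hq)))
  rw [neg_neg] at h3
  have hx2 : 1 / 2 < x := by nlinarith
  have h4 : 2 * c * x ≠ 1 := fun e => by nlinarith [sq_nonneg (c - x)]
  nlinarith [h3 h4]

/-- The dichotomy for elements off the coordinate axes. -/
lemma commutator_coord_bound (h : ContainsHurwitzUnits M) {x y z : ℝ} (hb : ReBound M c)
    (hq : quat c x y z ∈ M) :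
    x ^ 2 * (y ^ 2 + z ^ 2) = 0 ∨ 1 - c ≤ 8 * x ^ 2 * (y ^ 2 + z ^ 2) := by
  by_cases h0 : x ^ 2 * (y ^ 2 + z ^ 2) = 0
  · exact Or.inl h0
  right
  -- The second element is the conjugate by i, with y and z negated; the cross product has squared
  -- length 4x²(y² + z²).
  have := h.commutator_bound hb hq (h.flip_jk_mem hq) (fun e => h0 (by linarith))
  linarith

/-- The order of a rotation by a minimal angle between `60` and `90` degrees is five. -/
lemma re_eq_of_reBound (h : ContainsHurwitzUnits M) {x y z : ℝ} (hb : ReBound M c)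
    (hc0 : 0 < c) (hc : 1 / 2 < c ^ 2) (hc3 : c ^ 2 < 3 / 4) (hq : quat c x y z ∈ M) :
    c = Real.goldenRatio / 2 := by
  have hs := h.sum_sq hq
  have hm := M.mul_mem (h.square_mem (h.square_mem hq)) hq
  rw [quat_mul] at hm
  have hre := hb _ _ _ _ (h.neg_mem hm)
  -- The real part of q⁵ is the Chebyshev value T₅(c) = 16c⁵ − 20c³ + 5c. As −T₅(c) − c = 2c(3 −
  -- 4c²)(2c² − 1) > 0, the bound on −q⁵ leaves only −T₅(c) = 1, and 1 + T₅(c) = (c + 1)(4c² − 2c −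
  -- 1)².
  have key : ∀ r, r = -(16 * c ^ 5 - 20 * c ^ 3 + 5 * c) → (r ≠ 1 → r ≤ c) →
      c = Real.goldenRatio / 2 := by
    intro r hr hrc
    by_cases h1 : r = 1
    · have h2 : (c + 1) * (4 * c ^ 2 - 2 * c - 1) ^ 2 = 0 := by rw [h1] at hr; linear_combination hr
      have h3 : 4 * c ^ 2 - 2 * c - 1 = 0 := by
        rcases mul_eq_zero.1 h2 with h2 | h2
        · linarith
        · exact pow_eq_zero_iff (two_ne_zero) |>.1 h2
      have h4 : (2 * c - Real.goldenRatio) * (2 * c + Real.goldenRatio - 1) = 0 := by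
        linear_combination h3 - Real.goldenRatio_sq
      rcases mul_eq_zero.1 h4 with h4 | h4
      · linarith
      · linarith [Real.one_lt_goldenRatio]
    · have h2 := hrc h1
      have h3 : 0 < c * (2 * ((3 - 4 * c ^ 2) * (2 * c ^ 2 - 1))) := by
        have : 0 < (3 - 4 * c ^ 2) * (2 * c ^ 2 - 1) := mul_pos (by linarith) (by linarith)
        positivity
      nlinarith
  refine key _ ?_ hre
  linear_combination (8 * c ^ 3 - 4 * c) * hs

/-- Conjugation by i or j changes two signs at once; the vanishing component makes single sign
changes available. -/
lemma abs_mem (h : ContainsHurwitzUnits M) {x y : ℝ} (hq : quat c x y 0 ∈ M) :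
    quat c |x| |y| 0 ∈ M := by
  have h1 := h.flip_jk_mem hq
  have h2 := h.flip_ik_mem hq
  have h3 := h.flip_ik_mem h1
  rw [neg_zero] at *
  rw [neg_zero] at h3
  rcases abs_cases x with ⟨e1, -⟩ | ⟨e1, -⟩ <;> rcases abs_cases y with ⟨e2, -⟩ | ⟨e2, -⟩ <;>
    rw [e1, e2] <;> assumption

lemma exists_axis_mem (h : ContainsHurwitzUnits M) {x y z : ℝ} (hq : quat c x y z ∈ M)
    (hxy : x * y = 0) (hyz : y * z = 0) (hxz : x * z = 0) : ∃ t, 0 ≤ t ∧ quat c t 0 0 ∈ M := by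
  have h1 := h.cyclic_mem hq
  have h2 := h.cyclic_mem h1
  have key : ∀ {t : ℝ}, quat c t 0 0 ∈ M → ∃ t, 0 ≤ t ∧ quat c t 0 0 ∈ M := fun {t} ht =>
    ⟨|t|, abs_nonneg t, by simpa using h.abs_mem ht⟩
  by_cases hx : x = 0
  · by_cases hy : y = 0
    · rw [hx, hy] at h1
      exact key h1
    · rw [hx, (mul_eq_zero.1 hyz).resolve_left hy] at h2
      exact key h2
  · rw [(mul_eq_zero.1 hxy).resolve_left hx, (mul_eq_zero.1 hxz).resolve_left hx] at hq
    exact key hq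

/-- Square `abs_add_abs_add_abs_le` and use the norm. Since the left side is nonnegative, c² ≥ 1/2,
and c² = 1/2 forces the axis of rotation to be a coordinate axis. -/
lemma sq_ge_half (h : ContainsHurwitzUnits M) {x y z : ℝ} (hb : ReBound M c) (hc : 1 / 2 < c)
    (hq : quat c x y z ∈ M) : |x| * |y| + |y| * |z| + |x| * |z| ≤ c ^ 2 - 1 / 2 := by
  have h1 := h.abs_add_abs_add_abs_le hb hc hq
  have hs := h.sum_sq hq
  have h2 : (|x| + |y| + |z|) ^ 2 ≤ c ^ 2 := pow_le_pow_left₀ (by positivity) h1 2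
  nlinarith [sq_abs x, sq_abs y, sq_abs z]

lemma octahedral_mem (h : ContainsHurwitzUnits M) {x y z : ℝ} (hb : ReBound M c) (hc : 1 / 2 < c)
    (hc2 : c ^ 2 = 1 / 2) (hq : quat c x y z ∈ M) : quat c c 0 0 ∈ M := by
  have h1 := h.sq_ge_half hb hc hq
  rw [hc2, sub_self] at h1
  have hxy : 0 ≤ |x| * |y| := by positivity
  have hyz : 0 ≤ |y| * |z| := by positivity
  have hxz : 0 ≤ |x| * |z| := by positivity
  obtain ⟨t, ht, hm⟩ := h.exists_axis_mem hq (abs_eq_zero.1 (by rw [abs_mul]; linarith))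
    (abs_eq_zero.1 (by rw [abs_mul]; linarith)) (abs_eq_zero.1 (by rw [abs_mul]; linarith))
  have hs := h.sum_sq hm
  have : t = c := by
    rw [← sq_eq_sq₀ ht (by linarith)]
    linarith
  rwa [this] at hm

/-- Unless x²(y² + z²) = 0, the commutator bound and the AM-GM inequality give 1 − c ≤ 8x²(y² + z²)
≤ 2(x² + y² + z²)². If the product vanishes for the element and for its cyclic conjugate, the axis
is a coordinate axis, which `not_axis_mem` excludes. -/
lemma sq_lt_of_reBound (h : ContainsHurwitzUnits M) {x y z : ℝ} (hb : ReBound M c)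
    (hc : 1 / 2 < c) (hc1 : c < 1) (hc2 : 1 / 2 < c ^ 2) (hq : quat c x y z ∈ M) :
    c ^ 2 < 3 / 4 := by
  have key : ∀ {x y z : ℝ}, quat c x y z ∈ M → x ^ 2 * (y ^ 2 + z ^ 2) ≠ 0 → c ^ 2 < 3 / 4 := by
    intro x y z hq hne
    have hs := h.sum_sq hq
    refine sq_lt_three_quarters (s := x ^ 2 + y ^ 2 + z ^ 2) hc hc1 (by linarith) ?_
    have := (h.commutator_coord_bound hb hq).resolve_left hne
    nlinarith [sq_nonneg (x ^ 2 - (y ^ 2 + z ^ 2))]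
  by_contra hlt
  have h0 : x ^ 2 * (y ^ 2 + z ^ 2) = 0 := by
    by_contra hne; exact hlt (key hq hne)
  have h1 : z ^ 2 * (x ^ 2 + y ^ 2) = 0 := by
    by_contra hne; exact hlt (key (h.cyclic_mem hq) hne)
  have h2 : x ^ 2 * y ^ 2 = 0 := by
    nlinarith [mul_nonneg (sq_nonneg x) (sq_nonneg y), mul_nonneg (sq_nonneg x) (sq_nonneg z)]
  have h3 : x ^ 2 * z ^ 2 = 0 := by linarith
  have h4 : y ^ 2 * z ^ 2 = 0 := by linarith
  obtain ⟨t, -, hm⟩ := h.exists_axis_mem hq (by rwa [← mul_pow, sq_eq_zero_iff] at h2)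
    (by rwa [← mul_pow, sq_eq_zero_iff] at h4) (by rwa [← mul_pow, sq_eq_zero_iff] at h3)
  exact h.not_axis_mem hb hc1 hc2 hc hm

lemma coord_bounds (h : ContainsHurwitzUnits M) {f x y z : ℝ} (hb : ReBound M c) (hc : 1 / 2 < c)
    (hc1 : c < 1) (hc2 : 1 / 2 < c ^ 2) (hf : c = f / 2) (hf2 : f ^ 2 = f + 1)
    (hq : quat c x y z ∈ M) : 2 * |x| = 0 ∨ (f - 1 ≤ 2 * |x| ∧ 2 * |x| ≤ 1) := by
  have hs := h.sum_sq hq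
  by_cases hx : x = 0
  · left; simp [hx]
  right
  have hyz : y ^ 2 + z ^ 2 ≠ 0 := by
    intro h0
    have hy : y = 0 := by nlinarith [sq_nonneg y, sq_nonneg z]
    have hz : z = 0 := by nlinarith [sq_nonneg y, sq_nonneg z]
    rw [hy, hz] at hq
    exact h.not_axis_mem hb hc1 hc2 hc hq
  have h1 := (h.commutator_coord_bound hb hq).resolve_left
    (mul_ne_zero (pow_ne_zero 2 hx) hyz)
  have h2 : y ^ 2 + z ^ 2 = 1 - c ^ 2 - x ^ 2 := by linarith
  rw [h2, ← sq_abs x] at h1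
  set u := 2 * |x| with hu
  have hu0 : 0 ≤ u := by positivity
  have hux : |x| = u / 2 := by rw [hu]; ring
  rw [hux, hf] at h1
  -- The commutator bound is quadratic in u², with roots 1 and (f − 1)² = 2 − f.
  have h3 : (u ^ 2 - 1) * (u ^ 2 - (f - 1) ^ 2) ≤ 0 := by nlinarith
  have hf1 : 0 < f - 1 := by linarith
  have hf3 : f - 1 < 1 := by linarith
  constructor
  · by_contra hlt
    push Not at hlt
    have : 0 < (1 - u ^ 2) * ((f - 1) ^ 2 - u ^ 2) := mul_pos (by nlinarith) (by nlinarith)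
    nlinarith
  · by_contra hlt
    push Not at hlt
    have : 0 < (u ^ 2 - 1) * (u ^ 2 - (f - 1) ^ 2) := mul_pos (by nlinarith) (by nlinarith)
    nlinarith

/-- From u + v ≤ f follows uv ≤ f − 1. But (1 − u²)(u² − (f − 1)²) = (uv)² − (f − 1)², and the left
side is nonnegative, so both sides vanish and u is an endpoint of its interval. -/
lemma pair_eq {f u v : ℝ} (hf2 : f ^ 2 = f + 1) (hf : 1 < f) (hu : f - 1 ≤ u) (hu1 : u ≤ 1)
    (hv : f - 1 ≤ v) (huv : u + v ≤ f) (hs : u ^ 2 + v ^ 2 = 3 - f) :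
    (u = 1 ∧ v = f - 1) ∨ (u = f - 1 ∧ v = 1) := by
  have h1 : u * v ≤ f - 1 := by nlinarith
  have h2 : 0 ≤ (1 - u ^ 2) * (u ^ 2 - (f - 1) ^ 2) := mul_nonneg (by nlinarith) (by nlinarith)
  have h3 : (1 - u ^ 2) * (u ^ 2 - (f - 1) ^ 2) = (u * v) ^ 2 - (f - 1) ^ 2 := by
    have : v ^ 2 = 3 - f - u ^ 2 := by linarith
    rw [mul_pow, this]
    linear_combination u ^ 2 * hf2
  have h4 : (u * v) ^ 2 ≤ (f - 1) ^ 2 := pow_le_pow_left₀ (by nlinarith) h1 2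
  have h5 : (1 - u ^ 2) * (u ^ 2 - (f - 1) ^ 2) = 0 := by linarith
  have hu0 : 0 < u := by linarith
  have hv0 : 0 < v := by linarith
  rcases mul_eq_zero.1 h5 with h5 | h5
  · left
    have : u = 1 := by nlinarith
    refine ⟨this, ?_⟩
    rw [this] at huv
    linarith
  · right
    have : u = f - 1 := by nlinarith
    refine ⟨this, ?_⟩
    rw [← sq_eq_sq₀ hv0.le zero_le_one]
    rw [this] at hs
    linarith

/-- Exactly one imaginary component vanishes. If two did, the third would be at most 1/2 in absolute
value, too small for norm 1; if none did, the doubled absolute values would add up to at least 3(f −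
1) > f. Cyclic conjugation moves the zero to the end, and `pair_eq` finds the other two components.
-/
lemma icosahedral_mem (h : ContainsHurwitzUnits M) {f x y z : ℝ} (hb : ReBound M c)
    (hc : 1 / 2 < c) (hc1 : c < 1) (hc2 : 1 / 2 < c ^ 2) (hf : c = f / 2) (hf2 : f ^ 2 = f + 1)
    (hq : quat c x y z ∈ M) :
    quat (f / 2) (1 / 2) ((f - 1) / 2) 0 ∈ M ∨ quat (f / 2) ((f - 1) / 2) (1 / 2) 0 ∈ M := by
  have hq1 := h.cyclic_mem hq
  have hq2 := h.cyclic_mem hq1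
  have hx := h.coord_bounds hb hc hc1 hc2 hf hf2 hq
  have hz := h.coord_bounds hb hc hc1 hc2 hf hf2 hq1
  have hy := h.coord_bounds hb hc hc1 hc2 hf hf2 hq2
  have hsum := h.abs_add_abs_add_abs_le hb hc hq
  have hs := h.sum_sq hq
  have hf1 : 3 / 2 < f := by nlinarith
  have key : ∀ {x y : ℝ}, quat c x y 0 ∈ M →
      (f - 1 ≤ 2 * |x| ∧ 2 * |x| ≤ 1) → (f - 1 ≤ 2 * |y| ∧ 2 * |y| ≤ 1) → |x| + |y| ≤ c →
      quat (f / 2) (1 / 2) ((f - 1) / 2) 0 ∈ M ∨ quat (f / 2) ((f - 1) / 2) (1 / 2) 0 ∈ M := by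
    intro x y hq hx hy hxy
    have hs := h.sum_sq hq
    have hm := h.abs_mem hq
    rw [← sq_abs x, ← sq_abs y, hf] at hs
    rw [hf] at hm
    rcases pair_eq hf2 (by linarith) hx.1 hx.2 hy.1 (by linarith) (by nlinarith) with
      ⟨e1, e2⟩ | ⟨e1, e2⟩
    · left
      rwa [show |x| = 1 / 2 by linarith, show |y| = (f - 1) / 2 by linarith] at hm
    · right
      rwa [show |x| = (f - 1) / 2 by linarith, show |y| = 1 / 2 by linarith] at hm
  have htwo : ∀ {x y z : ℝ}, c ^ 2 + x ^ 2 + y ^ 2 + z ^ 2 = 1 → 2 * |x| = 0 → 2 * |y| = 0 →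
      (2 * |z| = 0 ∨ 2 * |z| ≤ 1) → False := by
    intro x y z hs hx hy hz
    rw [← sq_abs x, ← sq_abs y, ← sq_abs z, hf] at hs
    have hx0 : |x| = 0 := by linarith
    have hy0 : |y| = 0 := by linarith
    rw [hx0, hy0] at hs
    have hz1 : 2 * |z| ≤ 1 := by rcases hz with h | h <;> linarith
    nlinarith [abs_nonneg z]
  have h0 : ∀ {x : ℝ}, 2 * |x| = 0 → x = 0 := fun h => abs_eq_zero.1 (by linarith)
  rcases hx with hx | hx
  · rcases hy with hy | hy
    · exact (htwo hs hx hy (hz.imp_right And.right)).elim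
    · rcases hz with hz | hz
      · exact (htwo (x := x) (y := z) (z := y) (by linarith) hx hz (Or.inr hy.2)).elim
      · rw [h0 hx] at hq2 hsum
        exact key hq2 hy hz (by simpa using hsum)
  · rcases hy with hy | hy
    · rcases hz with hz | hz
      · exact (htwo (x := y) (y := z) (z := x) (by linarith) hy hz (Or.inr hx.2)).elim
      · rw [h0 hy] at hq1 hsum
        exact key hq1 hz hx (by simpa [add_comm] using hsum)
    · rcases hz with hz | hz
      · rw [h0 hz] at hq hsum
        exact key hq hx hy (by simpa using hsum)
      · linarith

/-- A finite group of unit quaternions that contains the Hurwitz units consists of them, or contains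
an element of order eight that normalizes them, or contains an icosian of order ten. -/
theorem finite_trichotomy (hM : ContainsHurwitzUnits M) (hN : ContainsHurwitzUnits N)
    (hfin : (M : Set ℍ[ℝ]).Finite) : M ≤ N ∨ quat (√2 / 2) (√2 / 2) 0 0 ∈ M ∨
      quat (Real.goldenRatio / 2) (1 / 2) ((Real.goldenRatio - 1) / 2) 0 ∈ M ∨
      quat (Real.goldenRatio / 2) ((Real.goldenRatio - 1) / 2) (1 / 2) 0 ∈ M := by
  have hne : ∀ {q : ℍ[ℝ]}, q ∈ M → q.re = 1 → q = 1 := by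
    intro q hq h1
    rw [← quat_eta q] at hq
    have hs := hM.sum_sq hq
    rw [h1] at hs
    rw [← quat_eta q, h1, one_eq_quat]
    congr 1 <;> nlinarith [sq_nonneg q.imI, sq_nonneg q.imJ, sq_nonneg q.imK]
  obtain ⟨q, ⟨hq, hq1⟩, hmax⟩ := Set.exists_max_image ((M : Set ℍ[ℝ]) \ {1}) (fun q => q.re)
    (hfin.subset Set.sdiff_subset) ⟨quat 0 1 0 0, hM.i_mem, fun h => by
      simpa using congrArg (fun q : ℍ[ℝ] => q.imI) h⟩
  have hb : ReBound M q.re := fun a b c d hm ha => hmax (quat a b c d) ⟨hm, fun h => by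
    rw [Set.mem_singleton_iff] at h
    exact ha (congrArg (fun q : ℍ[ℝ] => q.re) h)⟩
  have hqm := hq
  rw [SetLike.mem_coe, ← quat_eta q] at hqm
  have hs := hM.sum_sq hqm
  have hle : q.re ≤ 1 := by
    nlinarith [sq_nonneg q.imI, sq_nonneg q.imJ, sq_nonneg q.imK]
  have hc1 : q.re < 1 := lt_of_le_of_ne hle fun h => hq1 (hne hq h)
  rcases le_or_gt q.re (1 / 2) with hc | hc
  · exact Or.inl (hM.le_of_reBound hN hc hb)
  have h2 := hM.sq_ge_half hb hc hqm
  have hc2 : 1 / 2 ≤ q.re ^ 2 := by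
    have : 0 ≤ |q.imI| * |q.imJ| + |q.imJ| * |q.imK| + |q.imI| * |q.imK| := by positivity
    linarith
  right
  rcases hc2.eq_or_lt with hc2 | hc2
  · left
    have hm := hM.octahedral_mem hb hc hc2.symm hqm
    have : q.re = √2 / 2 := by
      rw [← sq_eq_sq₀ (by linarith) (by positivity), ← hc2, div_pow, Real.sq_sqrt] <;> norm_num
    rwa [this] at hm
  · right
    have hc3 := hM.sq_lt_of_reBound hb hc hc1 hc2 hqm
    exact hM.icosahedral_mem hb hc hc1 hc2 (hM.re_eq_of_reBound hb (by linarith) hc2 hc3 hqm)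
      Real.goldenRatio_sq hqm

end ContainsHurwitzUnits

/-! ### Faces and their centers under isometries -/

lemma exists_spherePerm {g : Equiv.Perm Sphere2} (hg : g ∈ rotationGroup) :
    ∃ f, g = spherePerm f := by
  obtain ⟨f, -, hf⟩ := hg
  exact ⟨f, Equiv.ext fun p => Subtype.ext (hf p)⟩

/-- `p` is the central projection of the centroid of `A`. -/
def IsProjectedCentroid (A : Finset Sphere2) (p : Sphere2) : Prop :=
  ∃ r : ℝ, 0 < r ∧ A.centroid ℝ (fun x : Sphere2 => (x : Space3)) = r • (p : Space3)

lemma IsProjectedCentroid.unique {A : Finset Sphere2} {p q : Sphere2}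
    (hp : IsProjectedCentroid A p) (hq : IsProjectedCentroid A q) : p = q := by
  obtain ⟨r, hr, hp⟩ := hp
  obtain ⟨s, hs, hq⟩ := hq
  rw [hq] at hp
  have h := congrArg norm hp
  rw [norm_smul, norm_smul, norm_eq_of_mem_sphere, norm_eq_of_mem_sphere, mul_one, mul_one,
    Real.norm_of_nonneg hr.le, Real.norm_of_nonneg hs.le] at h
  rw [h] at hp
  exact (Subtype.ext (smul_right_injective _ hr.ne' hp)).symm

/-- The empty set spans a direction of dimension 0. Excluding it matters because its centroid is not
moved along by affine maps. -/
lemma IsFaceOfDim.nonempty {P : Set Sphere2} {k : ℕ} {A : Finset Sphere2}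
    (hA : IsFaceOfDim P k A) (hk : k ≠ 0) : A.Nonempty := by
  rw [Finset.nonempty_iff_ne_empty]
  rintro rfl
  apply hk
  rw [← hA.2]
  simp

lemma IsProjectedCentroid.map {A : Finset Sphere2} {p : Sphere2} (hp : IsProjectedCentroid A p)
    (hA : A.Nonempty) (f : Space3 ≃ₗᵢ[ℝ] Space3) :
    IsProjectedCentroid (A.map (spherePerm f).toEmbedding) (spherePerm f p) := by
  obtain ⟨r, hr, hp⟩ := hp
  refine ⟨r, hr, ?_⟩
  rw [Finset.centroid_map, coe_spherePerm, ← map_smul, ← hp, Finset.centroid_def,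
    Finset.centroid_def]
  exact (Finset.map_affineCombination A _ _ (A.sum_centroidWeights_eq_one_of_nonempty ℝ hA)
    f.toLinearEquiv.toLinearMap.toAffineMap).symm

lemma IsFaceOfDim.map {P : Set Sphere2} {k : ℕ} {A : Finset Sphere2} (hA : IsFaceOfDim P k A)
    (f : Space3 ≃ₗᵢ[ℝ] Space3) :
    IsFaceOfDim (spherePerm f • P) k (A.map (spherePerm f).toEmbedding) := by
  obtain ⟨⟨u, hu⟩, hk⟩ := hA
  refine ⟨⟨f u, fun x => ?_⟩, ?_⟩
  · obtain ⟨z, rfl⟩ := (spherePerm f).surjective x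
    have h1 : spherePerm f z ∈ A.map (spherePerm f).toEmbedding ↔ z ∈ A := by
      rw [← Equiv.coe_toEmbedding, Finset.mem_map']
    have h2 : ∀ w, spherePerm f w ∈ spherePerm f • P ↔ w ∈ P := fun w =>
      Set.smul_mem_smul_set_iff (a := spherePerm f)
    rw [h1, hu, h2]
    refine and_congr_right fun _ => ?_
    constructor
    · rintro hm y hy
      obtain ⟨w, rfl⟩ := (spherePerm f).surjective y
      simpa only [coe_spherePerm, LinearIsometryEquiv.inner_map_map] using hm w ((h2 w).1 hy)
    · intro hm y hy
      simpa only [coe_spherePerm, LinearIsometryEquiv.inner_map_map] using hm _ ((h2 y).2 hy)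
  · have h : (fun x : Sphere2 => (x : Space3)) '' (A.map (spherePerm f).toEmbedding : Finset _) =
        f.toLinearEquiv.toLinearMap.toAffineMap '' ((fun x : Sphere2 => (x : Space3)) '' A) := by
      rw [Finset.coe_map, Set.image_image, Set.image_image]
      rfl
    rw [h, ← AffineMap.map_vectorSpan, ← hk]
    exact LinearEquiv.finrank_map_eq f.toLinearEquiv _

lemma spherePerm_mem_projectedCenters {P : Set Sphere2} {k : ℕ} (hk : k ≠ 0) {p : Sphere2}
    (hp : p ∈ projectedCenters P k) (f : Space3 ≃ₗᵢ[ℝ] Space3) :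
    spherePerm f p ∈ projectedCenters (spherePerm f • P) k := by
  obtain ⟨A, hA, hc⟩ := hp
  exact ⟨_, hA.map f, IsProjectedCentroid.map hc (hA.nonempty hk) f⟩

lemma smul_projectedCenters (P : Set Sphere2) {k : ℕ} (hk : k ≠ 0) (f : Space3 ≃ₗᵢ[ℝ] Space3) :
    projectedCenters (spherePerm f • P) k = spherePerm f • projectedCenters P k := by
  ext p
  rw [Set.mem_smul_set_iff_inv_smul_mem]
  constructor
  · intro hp
    have := spherePerm_mem_projectedCenters hk hp f⁻¹
    rwa [map_inv, inv_smul_smul] at this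
  · intro hp
    have := spherePerm_mem_projectedCenters hk hp f
    simpa using this

/-! ### Vertex-transitive groups of simple polyhedra -/

/-- `y` are the neighbours of the vertex `x` of the simple polyhedron with vertex set `P`. -/
structure IsVertexFigure (P : Set Sphere2) (x : Sphere2) (y : Fin 3 → Sphere2) : Prop where
  mem : x ∈ P
  neighbour_mem : ∀ i, y i ∈ P
  linearIndependent : LinearIndependent ℝ fun i => (x : Space3) - y i
  exists_cone : ∀ p ∈ P, ∃ c : Fin 3 → ℝ, (∀ i, 0 ≤ c i) ∧
    (x : Space3) - p = ∑ i, c i • ((x : Space3) - y i)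

namespace IsVertexFigure

variable {P : Set Sphere2} {x : Sphere2} {y : Fin 3 → Sphere2}

/-- The faces through a vertex correspond to sets of neighbours. -/
lemma exists_face_eq (h : IsVertexFigure P x y) {k : ℕ} {A : Finset Sphere2}
    (hA : IsFaceOfDim P k A) (hx : x ∈ A) : ∃ Z : Finset (Fin 3), Z.card = k ∧ ∀ p, p ∈ A ↔
      p ∈ P ∧ (x : Space3) - p ∈ Submodule.span ℝ ((fun i => (x : Space3) - y i) '' Z) := by
  classical
  obtain ⟨⟨u, hu⟩, hk⟩ := hA
  have hmax := ((hu x).1 hx).2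
  set d : Fin 3 → Space3 := fun i => (x : Space3) - y i with hd
  set Z : Finset (Fin 3) := Finset.univ.filter fun i => inner ℝ u (d i) = 0 with hZ
  -- The functional u is maximal at x and `P` lies in the cone of the edges at x. So a point of `P`
  -- is on the face exactly when it is reached using only edges orthogonal to u.
  have ht : ∀ i, 0 ≤ inner ℝ u (d i) := fun i => by
    rw [hd, inner_sub_right, sub_nonneg]; exact hmax _ (h.neighbour_mem i)
  have hmem : ∀ p, p ∈ A ↔ p ∈ P ∧ (x : Space3) - p ∈ Submodule.span ℝ (d '' Z) := by
    intro p
    have h1 : p ∈ A ↔ p ∈ P ∧ inner ℝ u ((x : Space3) - p) = 0 := by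
      rw [hu]
      refine and_congr_right fun hp => ⟨fun hm => ?_, fun hm y hy => ?_⟩
      · rw [inner_sub_right, sub_eq_zero]
        exact le_antisymm (hm x h.mem) (hmax p hp)
      · rw [inner_sub_right, sub_eq_zero] at hm
        rw [← hm]; exact hmax y hy
    rw [h1]
    refine and_congr_right fun hp => ⟨fun h0 => ?_, fun hs => ?_⟩
    · obtain ⟨c, hc, hxp⟩ := h.exists_cone p hp
      rw [hxp, inner_sum] at h0
      simp only [inner_smul_right] at h0
      rw [Finset.sum_eq_zero_iff_of_nonneg fun i _ => mul_nonneg (hc i) (ht i)] at h0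
      rw [hxp]
      refine Submodule.sum_mem _ fun i _ => ?_
      rcases mul_eq_zero.1 (h0 i (Finset.mem_univ i)) with hci | hi
      · rw [hci, zero_smul]; exact Submodule.zero_mem _
      · exact Submodule.smul_mem _ _ (Submodule.subset_span ⟨i, by simpa [hZ] using hi, rfl⟩)
    · have : Submodule.span ℝ (d '' Z) ≤ LinearMap.ker (innerₛₗ ℝ u) := by
        rw [Submodule.span_le]
        rintro _ ⟨i, hi, rfl⟩
        simpa [hZ] using hi
      simpa using this hs
  refine ⟨Z, ?_, hmem⟩
  have hspan : vectorSpan ℝ ((fun x : Sphere2 => (x : Space3)) '' (A : Set Sphere2)) =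
      Submodule.span ℝ (d '' Z) := by
    rw [vectorSpan_eq_span_vsub_set_left ℝ (Set.mem_image_of_mem _ hx)]
    apply le_antisymm
    · rw [Submodule.span_le]
      rintro _ ⟨_, ⟨p, hp, rfl⟩, rfl⟩
      exact ((hmem p).1 hp).2
    · rw [Submodule.span_le]
      rintro _ ⟨i, hi, rfl⟩
      exact Submodule.subset_span ⟨_, ⟨y i, (hmem _).2
        ⟨h.neighbour_mem i, Submodule.subset_span ⟨i, hi, rfl⟩⟩, rfl⟩, rfl⟩
  rw [hspan] at hk
  have hli := h.linearIndependent.comp (Subtype.val : Z → Fin 3) Subtype.val_injective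
  have hr : Set.range ((fun i => (x : Space3) - y i) ∘ (Subtype.val : Z → Fin 3)) = d '' Z := by
    rw [Set.range_comp]
    exact congrArg _ Subtype.range_coe
  have hcard := finrank_span_eq_card hli
  rw [hr, hk, Fintype.card_coe] at hcard
  exact hcard.symm

end IsVertexFigure

/-- Hence the cyclic symmetry about a vertex already permutes transitively the faces of a given
dimension through it. -/
lemma exists_add_image_eq : ∀ Z Z' : Finset (Fin 3), Z.card = Z'.card →
    ∃ m : Fin 3, Z' = Z.image (· + m) := by
  decide

/-- `H` is a group of rotations of the polyhedron with vertex set `P` that is transitive on the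
vertices and permutes the neighbours `y` of the vertex `x` cyclically. -/
structure IsVertexTransitive (H : Subgroup (Equiv.Perm Sphere2)) (P : Set Sphere2) (x : Sphere2)
    (y : Fin 3 → Sphere2) : Prop where
  le : H ≤ polyhedronRotations P
  exists_eq : ∀ p ∈ P, ∃ g ∈ H, g x = p
  exists_cyclic : ∃ r ∈ H, r x = x ∧ ∀ i, r (y i) = y (i + 1)

lemma smul_eq_of_mem_polyhedronRotations {P : Set Sphere2} {g : Equiv.Perm Sphere2}
    (hg : g ∈ polyhedronRotations P) : g • P = P :=
  MulAction.mem_stabilizer_iff.1 hg.2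

namespace IsVertexTransitive

variable {H : Subgroup (Equiv.Perm Sphere2)} {P : Set Sphere2} {x : Sphere2} {y : Fin 3 → Sphere2}

lemma exists_pow (h : IsVertexTransitive H P x y) (m : Fin 3) :
    ∃ r ∈ H, r x = x ∧ ∀ i, r (y i) = y (i + m) := by
  obtain ⟨r, hr, hx, hy⟩ := h.exists_cyclic
  fin_cases m
  · exact ⟨1, one_mem _, rfl, fun i => by simp⟩
  · exact ⟨r, hr, hx, hy⟩
  · refine ⟨r * r, mul_mem hr hr, by rw [Equiv.Perm.mul_apply, hx, hx], fun i => ?_⟩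
    rw [Equiv.Perm.mul_apply, hy, hy, add_assoc]
    rfl

lemma exists_face_through (h : IsVertexTransitive H P x y) {k : ℕ} (hk : k ≠ 0)
    {p : Sphere2} (hp : p ∈ projectedCenters P k) :
    ∃ g ∈ H, ∃ A, IsFaceOfDim P k A ∧ x ∈ A ∧ IsProjectedCentroid A (g p) := by
  obtain ⟨A, hA, hc⟩ := hp
  obtain ⟨z, hz⟩ := hA.nonempty hk
  obtain ⟨⟨u, hu⟩, -⟩ := id hA
  obtain ⟨g, hg, rfl⟩ := h.exists_eq z ((hu z).1 hz).1
  have hg' := inv_mem hg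
  obtain ⟨f, hf⟩ := exists_spherePerm (h.le hg').1
  refine ⟨g⁻¹, hg', A.map (g⁻¹).toEmbedding, ?_, ?_, ?_⟩
  · have := hA.map f
    rwa [← hf, smul_eq_of_mem_polyhedronRotations (h.le hg')] at this
  · exact Finset.mem_map.2 ⟨_, hz, by simp⟩
  · rw [hf]; exact IsProjectedCentroid.map hc ⟨_, hz⟩ f

/-- The centers of the faces of each dimension form one orbit. -/
theorem exists_eq_of_mem_projectedCenters (h : IsVertexTransitive H P x y)
    (hP : IsVertexFigure P x y) {k : ℕ} (hk : k ≠ 0) {p q : Sphere2} (hp : p ∈ projectedCenters P k)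
    (hq : q ∈ projectedCenters P k) : ∃ g ∈ H, g p = q := by
  -- Both faces are moved so as to pass through x; they then correspond to sets of k neighbours,
  -- matched by a power of the rotation about x.
  obtain ⟨g, hg, A, hA, hxA, hcA⟩ := h.exists_face_through hk hp
  obtain ⟨g', hg', B, hB, hxB, hcB⟩ := h.exists_face_through hk hq
  obtain ⟨Z, hZ, hAZ⟩ := hP.exists_face_eq hA hxA
  obtain ⟨Z', hZ', hBZ⟩ := hP.exists_face_eq hB hxB
  obtain ⟨m, rfl⟩ := exists_add_image_eq Z Z' (hZ.trans hZ'.symm)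
  obtain ⟨r, hr, hrx, hry⟩ := h.exists_pow m
  obtain ⟨f, rfl⟩ := exists_spherePerm (h.le hr).1
  have hAB : A.map (spherePerm f).toEmbedding = B := by
    ext z
    obtain ⟨w, rfl⟩ := (spherePerm f).surjective z
    rw [← Equiv.coe_toEmbedding, Finset.mem_map', Equiv.coe_toEmbedding, hAZ, hBZ]
    refine and_congr ?_ ?_
    · have := Set.smul_mem_smul_set_iff (a := spherePerm f) (s := P) (x := w)
      rw [smul_eq_of_mem_polyhedronRotations (h.le hr)] at this
      exact this.symm
    · have hfx : f x = x := congrArg Subtype.val hrx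
      have h1 : (x : Space3) - spherePerm f w = f.toLinearEquiv.toLinearMap (x - w) := by
        simp [hfx]
      have h2 : (fun i => (x : Space3) - y i) '' (Z.image (· + m) : Finset (Fin 3)) =
          f.toLinearEquiv.toLinearMap '' ((fun i => (x : Space3) - y i) '' Z) := by
        rw [Finset.coe_image, Set.image_image, Set.image_image]
        refine Set.image_congr fun i _ => ?_
        rw [← hry]
        simp [hfx]
      rw [h1, h2, Submodule.span_image]
      exact ⟨fun hw => Submodule.mem_map_of_mem hw,
        fun ⟨v, hv, e⟩ => f.toLinearEquiv.injective e ▸ hv⟩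
  have := IsProjectedCentroid.map hcA ⟨_, hxA⟩ f
  rw [hAB] at this
  refine ⟨g'⁻¹ * (spherePerm f * g), mul_mem (inv_mem hg') (mul_mem hr hg), ?_⟩
  rw [Equiv.Perm.mul_apply, Equiv.Perm.mul_apply, this.unique hcB]
  exact g'.symm_apply_apply q

lemma neg_apply_of_mem_rotationGroup {g : Equiv.Perm Sphere2} (hg : g ∈ rotationGroup)
    (p : Sphere2) : g (-p) = -g p := by
  obtain ⟨f, rfl⟩ := exists_spherePerm hg
  exact Subtype.ext (map_neg f _)

/-- Rotations that agree at p agree at −p as well, so they agree at three points. -/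
lemma eq_of_rotation_eq_on_two {g g' : Equiv.Perm Sphere2} (hg : g ∈ rotationGroup)
    (hg' : g' ∈ rotationGroup) {p q : Sphere2} (hpq : p ≠ q) (hpq' : -p ≠ q) (hp : g p = g' p)
    (hq : g q = g' q) : g = g' := by
  refine eq_of_eq_on_three (rotationGroup_le_mobiusGroup hg) (rotationGroup_le_mobiusGroup hg')
    (x := p) (y := -p) (z := q) ?_ hpq hpq' hp ?_ hq
  · intro h
    have h2 : (p : Space3) = -p := congrArg Subtype.val h
    have h3 : (2 : ℝ) • (p : Space3) = 0 := by
      rw [two_smul]; exact add_eq_zero_iff_eq_neg.2 h2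
    exact ne_zero_of_mem_unit_sphere p ((smul_eq_zero.1 h3).resolve_left two_ne_zero)
  · rw [neg_apply_of_mem_rotationGroup hg, neg_apply_of_mem_rotationGroup hg', hp]

/-- A vertex-transitive group that permutes the neighbours of a vertex cyclically is the whole
rotation group of the polyhedron. -/
theorem polyhedronRotations_le (h : IsVertexTransitive H P x y) (hy : y 0 ∈ P) (hne : x ≠ y 0)
    (hne' : -x ≠ y 0) (hnear : ∀ p ∈ P, inner ℝ (x : Space3) p = inner ℝ (x : Space3) (y 0) →
      ∃ i, p = y i) (hx : x ∈ P) :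
    polyhedronRotations P ≤ H := by
  intro g hg
  have hmem : ∀ {g : Equiv.Perm Sphere2} {p}, g ∈ polyhedronRotations P → p ∈ P → g p ∈ P := by
    intro g p hg hp
    have : g • p ∈ g • P := Set.smul_mem_smul_set hp
    rwa [smul_eq_of_mem_polyhedronRotations hg] at this
  -- By transitivity, g may be assumed to fix x. It preserves distances to x, so it sends `y 0` to
  -- some `y i`, and agrees with a power of the cyclic rotation at x and at `y 0`.
  obtain ⟨k, hk, hkx⟩ := h.exists_eq _ (hmem hg hx)
  have hk' := mul_mem (inv_mem (h.le hk)) hg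
  have hx' : (k⁻¹ * g) x = x := by
    rw [Equiv.Perm.mul_apply, ← hkx]
    exact k.symm_apply_apply x
  obtain ⟨f, hf⟩ := exists_spherePerm hk'.1
  obtain ⟨i, hi⟩ := hnear _ (hmem hk' hy) (by
    conv_lhs => rw [← hx', hf]
    exact f.inner_map_map _ _)
  obtain ⟨r, hr, hrx, hry⟩ := h.exists_pow i
  have : k⁻¹ * g = r := eq_of_rotation_eq_on_two hk'.1 (h.le hr).1 hne hne' (hx'.trans hrx.symm)
    (by rw [hi, hry, zero_add])
  rw [← mul_inv_cancel_left k g, this]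
  exact mul_mem hk hr

end IsVertexTransitive

/-! ### Lifting rotation groups to the unit quaternions -/

/-- The unit quaternions that define rotations in `H`, as a submonoid of the quaternions. -/
def quatMonoid (H : Subgroup (Equiv.Perm Sphere2)) : Submonoid ℍ[ℝ] :=
  (H.comap quatPerm).toSubmonoid.map (unitary ℍ[ℝ]).subtype

lemma mem_quatMonoid {H : Subgroup (Equiv.Perm Sphere2)} {q : ℍ[ℝ]} :
    q ∈ quatMonoid H ↔ ∃ hq : q ∈ unitary ℍ[ℝ], quatPerm ⟨q, hq⟩ ∈ H := by
  constructor
  · rintro ⟨q, hq, rfl⟩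
    exact ⟨q.2, hq⟩
  · rintro ⟨hq, h⟩
    exact ⟨⟨q, hq⟩, h, rfl⟩

lemma coe_mem_quatMonoid {H : Subgroup (Equiv.Perm Sphere2)} {q : unitary ℍ[ℝ]} :
    (q : ℍ[ℝ]) ∈ quatMonoid H ↔ quatPerm q ∈ H := by
  rw [mem_quatMonoid]
  exact ⟨fun ⟨_, h⟩ => h, fun h => ⟨q.2, h⟩⟩


lemma le_of_quatMonoid_le {H K : Subgroup (Equiv.Perm Sphere2)} (hH : H ≤ rotationGroup)
    (h : quatMonoid H ≤ quatMonoid K) : H ≤ K := by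
  intro g hg
  obtain ⟨q, rfl⟩ := mem_rotationGroup_iff.1 (hH hg)
  exact coe_mem_quatMonoid.1 (h (coe_mem_quatMonoid.2 hg))

lemma quatMatrix_injective : Function.Injective quatMatrix := by
  intro q r h
  have h0 := congrFun (congrFun h 0) 0
  have h1 := congrFun (congrFun h 1) 0
  have e1 := congrArg Complex.re h0
  have e2 := congrArg Complex.im h0
  have e3 := congrArg Complex.re h1
  have e4 := congrArg Complex.im h1
  simp [quatMatrix] at e1 e2 e3 e4
  exact Quaternion.ext _ _ e1 e4 e3 e2

lemma quatMatrix_neg (q : ℍ[ℝ]) : quatMatrix (-q) = -quatMatrix q := by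
  ext i j
  fin_cases i <;> fin_cases j <;> simp [quatMatrix] <;> ring

lemma eq_or_eq_neg_of_quatPerm_eq {q r : unitary ℍ[ℝ]} (h : quatPerm q = quatPerm r) :
    (q : ℍ[ℝ]) = r ∨ (q : ℍ[ℝ]) = -r := by
  have hr := represents_quatSL r
  rw [← h] at hr
  rcases (represents_quatSL q).eq_or_eq_neg hr with h | h
  · exact Or.inl (quatMatrix_injective h)
  · exact Or.inr (quatMatrix_injective (h.trans (quatMatrix_neg _).symm))

lemma quatPerm_eq_one {q : unitary ℍ[ℝ]} (h : (q : ℍ[ℝ]) = 1 ∨ (q : ℍ[ℝ]) = -1) :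
    quatPerm q = 1 := by
  ext1 p
  refine Subtype.ext ?_
  rw [coe_quatPerm]
  apply pureQuaternion_injective
  rw [pureQuaternion_conjVector]
  rcases h with h | h <;> simp [h]

/-- Each nonempty fibre of `quatPerm` is contained in a pair ±r. -/
lemma finite_quatMonoid (H : Subgroup (Equiv.Perm Sphere2)) [Finite H] :
    (quatMonoid H : Set ℍ[ℝ]).Finite := by
  have h : (quatPerm ⁻¹' (H : Set (Equiv.Perm Sphere2))).Finite := by
    refine Set.Finite.preimage' (Set.toFinite _) fun g _ => ?_
    rcases (quatPerm ⁻¹' {g}).eq_empty_or_nonempty with he | ⟨r, hr⟩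
    · rw [he]; exact Set.finite_empty
    · have hsub : (quatPerm ⁻¹' {g}) ⊆ Subtype.val ⁻¹' ({(r : ℍ[ℝ]), -(r : ℍ[ℝ])} : Set ℍ[ℝ]) :=
        fun q hq => eq_or_eq_neg_of_quatPerm_eq (hq.trans hr.symm)
      exact ((Set.toFinite _).preimage Subtype.val_injective.injOn).subset hsub
  exact h.image _

/-- The unit quaternion `(1 + i + j + k) / 2`. -/
def unitW : unitary ℍ[ℝ] :=
  ⟨quat (1 / 2) (1 / 2) (1 / 2) (1 / 2), mem_unitary_iff.2 (by norm_num)⟩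

lemma containsHurwitzUnits_quatMonoid {H : Subgroup (Equiv.Perm Sphere2)}
    (hi : quatPerm unitI ∈ H) (hj : quatPerm unitJ ∈ H) (hw : quatPerm unitW ∈ H) :
    ContainsHurwitzUnits (quatMonoid H) where
  le_unitary q hq := (mem_quatMonoid.1 hq).1
  star_mem q hq := by
    obtain ⟨hu, hq⟩ := mem_quatMonoid.1 hq
    have := inv_mem hq
    rw [← map_inv] at this
    exact coe_mem_quatMonoid.2 this
  i_mem := coe_mem_quatMonoid.2 hi
  j_mem := coe_mem_quatMonoid.2 hj
  w_mem := coe_mem_quatMonoid.2 hw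

/-! ### Polyhedra in standard position -/

/-- The points of the unit sphere on the rays through the points of `W`, for a set `W` of points at
distance `√3` from the origin. -/
def stdPolyhedron (W : Set Space3) : Set Sphere2 := {p | √3 • (p : Space3) ∈ W}

/-- The projection to the unit sphere of a point at distance `√3` from the origin. -/
def toSphere (w : Space3) (hw : ‖w‖ = √3) : Sphere2 :=
  ⟨(√3)⁻¹ • w, by rw [mem_sphere_zero_iff_norm, norm_smul, hw, norm_inv, Real.norm_of_nonneg
    (Real.sqrt_nonneg 3), inv_mul_cancel₀ (by positivity)]⟩

lemma sqrt_three_ne_zero : √(3 : ℝ) ≠ 0 := by positivity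

lemma toSphere_smul (p : Sphere2) : toSphere (√3 • (p : Space3)) (by
    rw [norm_smul, norm_eq_of_mem_sphere, mul_one, Real.norm_of_nonneg (Real.sqrt_nonneg 3)]) = p :=
  Subtype.ext (inv_smul_smul₀ sqrt_three_ne_zero _)

lemma toSphere_mem_stdPolyhedron {W : Set Space3} {w : Space3} {hw : ‖w‖ = √3} :
    toSphere w hw ∈ stdPolyhedron W ↔ w ∈ W := by
  change √3 • (√3)⁻¹ • w ∈ W ↔ _
  rw [smul_inv_smul₀ sqrt_three_ne_zero]

lemma toSphere_injective {w v : Space3} {hw : ‖w‖ = √3} {hv : ‖v‖ = √3} :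
    toSphere w hw = toSphere v hv ↔ w = v :=
  ⟨fun h => smul_right_injective _ (inv_ne_zero sqrt_three_ne_zero) (congrArg Subtype.val h),
    fun h => by subst h; rfl⟩

lemma exists_toSphere {W : Set Space3} {p : Sphere2} (hp : p ∈ stdPolyhedron W) :
    ∃ w, ∃ hw : ‖w‖ = √3, w ∈ W ∧ p = toSphere w hw :=
  ⟨√3 • (p : Space3), by
    rw [norm_smul, norm_eq_of_mem_sphere, mul_one, Real.norm_of_nonneg (Real.sqrt_nonneg 3)],
    hp, (toSphere_smul p).symm⟩

lemma norm_conjVector (q : unitary ℍ[ℝ]) (w : Space3) : ‖conjVector q w‖ = ‖w‖ :=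
  (quatIso q).norm_map w

lemma quatPerm_toSphere (q : unitary ℍ[ℝ]) {w : Space3} (hw : ‖w‖ = √3) :
    quatPerm q (toSphere w hw) = toSphere (conjVector q w) ((norm_conjVector q w).trans hw) :=
  Subtype.ext ((quatIso q).map_smul _ w)

lemma toSphere_sub {w v : Space3} (hw : ‖w‖ = √3) (hv : ‖v‖ = √3) :
    (toSphere w hw : Space3) - toSphere v hv = (√3)⁻¹ • (w - v) :=
  (smul_sub _ _ _).symm

/-- Comparing norms forces the ratio of the similarity to be 1/√3. -/
lemma IsInscribedCopy.exists_eq {P : Set Sphere2} {W : Set Space3} (hW : ∀ w ∈ W, ‖w‖ = √3)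
    (hne : W.Nonempty) (hP : IsInscribedCopy P W) : ∃ f, P = spherePerm f • stdPolyhedron W := by
  obtain ⟨f, r, hr, h⟩ := hP
  have hrs : r = (√3)⁻¹ := by
    obtain ⟨w, hw⟩ := hne
    obtain ⟨p, hp, e⟩ : r • f w ∈ (Subtype.val '' P : Set Space3) := h ▸ ⟨w, hw, rfl⟩
    have h1 := congrArg norm e
    rw [norm_eq_of_mem_sphere, norm_smul, f.norm_map, hW w hw, Real.norm_of_nonneg hr.le] at h1
    exact eq_inv_of_mul_eq_one_left h1.symm
  refine ⟨f, ?_⟩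
  ext p
  rw [Set.mem_smul_set_iff_inv_smul_mem, ← map_inv]
  have h1 : p ∈ P ↔ (p : Space3) ∈ (Subtype.val '' P : Set Space3) :=
    (Subtype.val_injective.mem_set_image).symm
  rw [h1, h]
  change _ ↔ √3 • f.symm p ∈ W
  constructor
  · rintro ⟨w, hw, e⟩
    rw [← e]
    simp only [hrs, map_smul, LinearIsometryEquiv.symm_apply_apply]
    rwa [smul_inv_smul₀ sqrt_three_ne_zero]
  · intro hp
    refine ⟨_, hp, ?_⟩
    simp only [hrs, map_smul, LinearIsometryEquiv.apply_symm_apply]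
    rw [inv_smul_smul₀ sqrt_three_ne_zero]

lemma isInscribedCopy_smul_stdPolyhedron {W : Set Space3} (hW : ∀ w ∈ W, ‖w‖ = √3)
    (f : Space3 ≃ₗᵢ[ℝ] Space3) : IsInscribedCopy (spherePerm f • stdPolyhedron W) W := by
  refine ⟨f, (√3)⁻¹, by positivity, ?_⟩
  ext v
  constructor
  · rintro ⟨_, ⟨p, hp, rfl⟩, rfl⟩
    refine ⟨_, hp, ?_⟩
    simp only [map_smul]
    rw [inv_smul_smul₀ sqrt_three_ne_zero]
    rfl
  · rintro ⟨w, hw, rfl⟩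
    exact ⟨_, ⟨toSphere w (hW w hw), toSphere_mem_stdPolyhedron.2 hw, rfl⟩, f.map_smul _ _⟩

lemma isVertexFigure_stdPolyhedron {W : Set Space3} (hW : ∀ w ∈ W, ‖w‖ = √3) {x : Space3}
    {y : Fin 3 → Space3} (hx : x ∈ W) (hy : ∀ i, y i ∈ W)
    (hli : LinearIndependent ℝ fun i => x - y i)
    (hc : ∀ w ∈ W, ∃ c : Fin 3 → ℝ, (∀ i, 0 ≤ c i) ∧ x - w = ∑ i, c i • (x - y i)) :
    IsVertexFigure (stdPolyhedron W) (toSphere x (hW x hx))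
      fun i => toSphere (y i) (hW _ (hy i)) where
  mem := toSphere_mem_stdPolyhedron.2 hx
  neighbour_mem i := toSphere_mem_stdPolyhedron.2 (hy i)
  linearIndependent := by
    simp only [toSphere_sub]
    exact hli.units_smul fun _ => Units.mk0 _ (inv_ne_zero sqrt_three_ne_zero)
  exists_cone p hp := by
    obtain ⟨w, hw, hwW, rfl⟩ := exists_toSphere hp
    obtain ⟨c, hc0, hc⟩ := hc w hwW
    refine ⟨c, hc0, ?_⟩
    simp only [toSphere_sub]
    rw [hc, Finset.smul_sum]
    exact Finset.sum_congr rfl fun i _ => smul_comm _ _ _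

lemma isVertexTransitive_stdPolyhedron {W : Set Space3} (hW : ∀ w ∈ W, ‖w‖ = √3) {x : Space3}
    {y : Fin 3 → Space3} (hx : x ∈ W) (hy : ∀ i, y i ∈ W) {H : Subgroup (Equiv.Perm Sphere2)}
    (hH : H ≤ polyhedronRotations (stdPolyhedron W))
    (ht : ∀ w ∈ W, ∃ q ∈ quatMonoid H, conjVector q x = w)
    (hr : ∃ q ∈ quatMonoid H, conjVector q x = x ∧ ∀ i, conjVector q (y i) = y (i + 1)) :
    IsVertexTransitive H (stdPolyhedron W) (toSphere x (hW x hx))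
      fun i => toSphere (y i) (hW _ (hy i)) where
  le := hH
  exists_eq p hp := by
    obtain ⟨w, hw, hwW, rfl⟩ := exists_toSphere hp
    obtain ⟨q, hq, rfl⟩ := ht w hwW
    obtain ⟨hu, hq⟩ := mem_quatMonoid.1 hq
    exact ⟨_, hq, quatPerm_toSphere ⟨q, hu⟩ _⟩
  exists_cyclic := by
    obtain ⟨q, hq, hqx, hqy⟩ := hr
    obtain ⟨hu, hq⟩ := mem_quatMonoid.1 hq
    refine ⟨_, hq, ?_, fun i => ?_⟩
    · rw [quatPerm_toSphere, toSphere_injective]; exact hqx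
    · rw [quatPerm_toSphere, toSphere_injective]; exact hqy i

/-- Membership in the stabilizer needs equality of sets. For an element of finite order an inclusion
is enough, as the inverse is a power. -/
lemma quatPerm_mem_polyhedronRotations {W : Set Space3} {q : unitary ℍ[ℝ]} {n : ℕ}
    (hn : quatPerm q ^ (n + 1) = 1) (hq : ∀ w ∈ W, conjVector q w ∈ W) :
    quatPerm q ∈ polyhedronRotations (stdPolyhedron W) := by
  refine ⟨quatPerm_mem_rotationGroup q, ?_⟩
  have h1 : ∀ p ∈ stdPolyhedron W, quatPerm q p ∈ stdPolyhedron W := by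
    intro p hp
    obtain ⟨w, hw, hwW, rfl⟩ := exists_toSphere hp
    rw [quatPerm_toSphere]
    exact toSphere_mem_stdPolyhedron.2 (hq w hwW)
  have h2 : ∀ k : ℕ, ∀ p ∈ stdPolyhedron W, (quatPerm q ^ k) p ∈ stdPolyhedron W := by
    intro k
    induction k with
    | zero => intro p hp; exact hp
    | succ k ih => intro p hp; rw [pow_succ']; exact h1 _ (ih p hp)
  refine MulAction.mem_stabilizer_iff.2 ?_
  ext p
  rw [Set.mem_smul_set_iff_inv_smul_mem]
  constructor
  · intro hp
    have := h1 _ hp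
    rwa [← Equiv.Perm.smul_def, smul_inv_smul] at this
  · intro hp
    have h3 : (quatPerm q)⁻¹ = quatPerm q ^ n := inv_eq_of_mul_eq_one_left (by rw [← pow_succ, hn])
    rw [h3]
    exact h2 n p hp

lemma vec_eta (w : Space3) : !₂[w 0, w 1, w 2] = w := by
  ext i; fin_cases i <;> rfl

lemma conjVector_vec (q : ℍ[ℝ]) (x y z : ℝ) : conjVector q !₂[x, y, z] =
    !₂[(q.re ^ 2 + q.imI ^ 2 - q.imJ ^ 2 - q.imK ^ 2) * x +
          2 * (q.imI * q.imJ - q.re * q.imK) * y + 2 * (q.imI * q.imK + q.re * q.imJ) * z,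
       2 * (q.imI * q.imJ + q.re * q.imK) * x +
          (q.re ^ 2 - q.imI ^ 2 + q.imJ ^ 2 - q.imK ^ 2) * y +
          2 * (q.imJ * q.imK - q.re * q.imI) * z,
       2 * (q.imI * q.imK - q.re * q.imJ) * x + 2 * (q.imJ * q.imK + q.re * q.imI) * y +
          (q.re ^ 2 - q.imI ^ 2 - q.imJ ^ 2 + q.imK ^ 2) * z] :=
  conjVector_apply q _

lemma conjVector_i (x y z : ℝ) : conjVector (quat 0 1 0 0) !₂[x, y, z] = !₂[x, -y, -z] := by
  simp [conjVector_vec]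

lemma conjVector_j (x y z : ℝ) : conjVector (quat 0 0 1 0) !₂[x, y, z] = !₂[-x, y, -z] := by
  simp [conjVector_vec]

lemma conjVector_w (x y z : ℝ) :
    conjVector (quat (1 / 2) (1 / 2) (1 / 2) (1 / 2)) !₂[x, y, z] = !₂[z, x, y] := by
  rw [conjVector_vec]
  ext i
  fin_cases i <;> simp <;> ring

lemma conjVector_octahedral (x y z : ℝ) :
    conjVector (quat (√2 / 2) (√2 / 2) 0 0) !₂[x, y, z] = !₂[x, -z, y] := by
  have h : √(2 : ℝ) ^ 2 = 2 := Real.sq_sqrt (by norm_num)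
  rw [conjVector_vec]
  ext i
  fin_cases i <;> simp
  · linear_combination x / 2 * h
  · linear_combination z / 2 * h
  · linear_combination y / 2 * h

/-- `w` is the image of `x` under conjugation by an element of `M`. -/
def Reach (M : Submonoid ℍ[ℝ]) (x w : Space3) : Prop := ∃ q ∈ M, conjVector q x = w

lemma Reach.refl (M : Submonoid ℍ[ℝ]) (x : Space3) : Reach M x x :=
  ⟨1, M.one_mem, conjVector_one x⟩

lemma Reach.conj {M : Submonoid ℍ[ℝ]} {x w : Space3} (h : Reach M x w) {q : ℍ[ℝ]} (hq : q ∈ M) :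
    Reach M x (conjVector q w) := by
  obtain ⟨r, hr, rfl⟩ := h
  exact ⟨q * r, M.mul_mem hq hr, conjVector_mul q r x⟩

namespace ContainsHurwitzUnits

variable {M : Submonoid ℍ[ℝ]} {x : Space3} {a b c : ℝ}

lemma reach_flip₁₂ (hM : ContainsHurwitzUnits M) (h : Reach M x !₂[a, b, c]) :
    Reach M x !₂[a, -b, -c] := by
  rw [← conjVector_i]; exact h.conj hM.i_mem

lemma reach_flip₀₂ (hM : ContainsHurwitzUnits M) (h : Reach M x !₂[a, b, c]) :
    Reach M x !₂[-a, b, -c] := by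
  rw [← conjVector_j]; exact h.conj hM.j_mem

lemma reach_flip₀₁ (hM : ContainsHurwitzUnits M) (h : Reach M x !₂[a, b, c]) :
    Reach M x !₂[-a, -b, c] := by
  simpa using hM.reach_flip₁₂ (hM.reach_flip₀₂ h)

lemma reach_cycle (hM : ContainsHurwitzUnits M) (h : Reach M x !₂[a, b, c]) :
    Reach M x !₂[c, a, b] := by
  rw [← conjVector_w]; exact h.conj hM.w_mem

end ContainsHurwitzUnits

lemma quatPerm_pow_eq_one {q : unitary ℍ[ℝ]} {n : ℕ}
    (h : (q : ℍ[ℝ]) ^ n = 1 ∨ (q : ℍ[ℝ]) ^ n = -1) :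
    quatPerm q ^ n = 1 := by
  rw [← map_pow]
  exact quatPerm_eq_one h

lemma quat_neg_one : (-1 : ℍ[ℝ]) = quat (-1) 0 0 0 := by
  ext <;> simp

lemma quatPerm_unitI_sq : quatPerm unitI ^ 2 = 1 :=
  quatPerm_pow_eq_one (Or.inr (by rw [sq, quat_neg_one]; simp [unitI, quat_mul]))

lemma quatPerm_unitJ_sq : quatPerm unitJ ^ 2 = 1 :=
  quatPerm_pow_eq_one (Or.inr (by rw [sq, quat_neg_one]; simp [unitJ, quat_mul]))

lemma quatPerm_unitW_pow : quatPerm unitW ^ 3 = 1 :=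
  quatPerm_pow_eq_one (Or.inr (by
    rw [pow_succ, sq, quat_neg_one]
    simp only [unitW, quat_mul]
    congr 1 <;> norm_num))

/-- The unit quaternion `(1 + i) / √2`. -/
def unitO : unitary ℍ[ℝ] :=
  ⟨quat (√2 / 2) (√2 / 2) 0 0, mem_unitary_iff.2 (by
    have h : √(2 : ℝ) ^ 2 = 2 := Real.sq_sqrt (by norm_num)
    simp only [quat_re, quat_imI, quat_imJ, quat_imK]
    linear_combination h / 2)⟩

lemma unitO_sq : unitO ^ 2 = unitI := by
  have h : √(2 : ℝ) ^ 2 = 2 := Real.sq_sqrt (by norm_num)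
  apply Subtype.ext
  rw [SubmonoidClass.coe_pow, sq]
  simp only [unitO, unitI, quat_mul]
  congr 1
  · ring
  · linear_combination h / 2
  · ring
  · ring

lemma quatPerm_unitO_pow : quatPerm unitO ^ 4 = 1 := by
  rw [show 4 = 2 * 2 from rfl, pow_mul, ← map_pow, unitO_sq, quatPerm_unitI_sq]

lemma conjVector_icosian {f : ℝ} (hf : f ^ 2 = f + 1) (x y z : ℝ) :
    conjVector (quat (f / 2) (1 / 2) ((f - 1) / 2) 0) !₂[x, y, z] =
      !₂[(f * x + (f - 1) * y + z) / 2, ((f - 1) * x + y - f * z) / 2,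
        (-x + f * y + (f - 1) * z) / 2] := by
  rw [conjVector_vec]
  ext i
  fin_cases i <;> simp
  · linear_combination (z / 2) * hf
  · linear_combination (y / 2) * hf
  · linear_combination (-x / 2) * hf

/-- For f = φ the real part is the cosine of 36°, so the fifth power is −1 and the induced rotation
has order five. -/
lemma icosian_pow_five {f : ℝ} (hf : f ^ 2 = f + 1) :
    quat (f / 2) (1 / 2) ((f - 1) / 2) 0 ^ 5 = -1 := by
  have h2 : quat (f / 2) (1 / 2) ((f - 1) / 2) 0 ^ 2 = quat ((f - 1) / 2) (f / 2) (1 / 2) 0 := by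
    rw [sq, quat_mul]
    congr 1
    · ring
    · ring
    · linear_combination hf / 2
    · ring
  have h4 : quat (f / 2) (1 / 2) ((f - 1) / 2) 0 ^ 4 = quat (-f / 2) (1 / 2) ((f - 1) / 2) 0 := by
    rw [show 4 = 2 * 2 from rfl, pow_mul, h2, sq, quat_mul]
    congr 1
    · ring
    · linear_combination hf / 2
    · ring
    · ring
  rw [pow_succ, h4, quat_mul, quat_neg_one]
  congr 1
  · linear_combination -hf / 2
  · ring
  · ring
  · ring

/-- The unit quaternion `(φ + i + φ⁻¹ j) / 2`. -/
def unitD : unitary ℍ[ℝ] :=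
  ⟨quat (Real.goldenRatio / 2) (1 / 2) ((Real.goldenRatio - 1) / 2) 0, mem_unitary_iff.2 (by
    have hf := Real.goldenRatio_sq
    simp only [quat_re, quat_imI, quat_imJ, quat_imK]
    generalize Real.goldenRatio = f at hf
    linear_combination hf / 2)⟩

lemma quatPerm_unitD_pow : quatPerm unitD ^ 5 = 1 :=
  quatPerm_pow_eq_one (Or.inr (icosian_pow_five Real.goldenRatio_sq))

/-! ### Coordinates of the tetrahedron, the cube and the dodecahedron -/

lemma eq_vec_of_eq {w : Space3} {a b c : ℝ} (h0 : w 0 = a) (h1 : w 1 = b) (h2 : w 2 = c) :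
    w = !₂[a, b, c] := by
  rw [← vec_eta w, h0, h1, h2]

lemma norm_eq_sqrt_three {w : Space3} (h : w 0 ^ 2 + w 1 ^ 2 + w 2 ^ 2 = 3) : ‖w‖ = √3 := by
  rw [EuclideanSpace.norm_eq, Fin.sum_univ_three]
  simp only [Real.norm_eq_abs, sq_abs, h]

lemma mem_cubeVertices {w : Space3} : w ∈ cubeVertices ↔
    (w 0 = 1 ∨ w 0 = -1) ∧ (w 1 = 1 ∨ w 1 = -1) ∧ (w 2 = 1 ∨ w 2 = -1) := by
  rw [cubeVertices, Set.mem_ofPred_eq, Fin.forall_fin_succ, Fin.forall_fin_two]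
  rfl

lemma norm_of_mem_cubeVertices {w : Space3} (hw : w ∈ cubeVertices) : ‖w‖ = √3 := by
  apply norm_eq_sqrt_three
  obtain ⟨h0, h1, h2⟩ := mem_cubeVertices.1 hw
  rw [sq_eq_one_iff.2 h0, sq_eq_one_iff.2 h1, sq_eq_one_iff.2 h2]
  norm_num

/-- The golden description of the vertices of the dodecahedron. -/
lemma mem_dodecahedronVertices {w : Space3} : w ∈ dodecahedronVertices ↔ w ∈ cubeVertices ∨
    (w 0 = 0 ∧ |w 1| = Real.goldenRatio - 1 ∧ |w 2| = Real.goldenRatio) ∨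
    (w 1 = 0 ∧ |w 2| = Real.goldenRatio - 1 ∧ |w 0| = Real.goldenRatio) ∨
    (w 2 = 0 ∧ |w 0| = Real.goldenRatio - 1 ∧ |w 1| = Real.goldenRatio) := by
  have h : Real.goldenRatio⁻¹ = Real.goldenRatio - 1 := by
    have hf := Real.goldenRatio_sq
    have h0 := Real.goldenRatio_ne_zero
    generalize Real.goldenRatio = f at *
    field_simp
    linear_combination -hf
  rw [dodecahedronVertices, Set.mem_union, Set.mem_ofPred_eq, h, Fin.exists_fin_succ,
    Fin.exists_fin_two]
  rfl

lemma vec_mem_dodecahedronVertices {a b c f : ℝ} (hf : f = Real.goldenRatio) :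
    !₂[a, b, c] ∈ dodecahedronVertices ↔
      ((a = 1 ∨ a = -1) ∧ (b = 1 ∨ b = -1) ∧ (c = 1 ∨ c = -1)) ∨
      (a = 0 ∧ (b = f - 1 ∨ b = -(f - 1)) ∧ (c = f ∨ c = -f)) ∨
      (b = 0 ∧ (c = f - 1 ∨ c = -(f - 1)) ∧ (a = f ∨ a = -f)) ∨
      (c = 0 ∧ (a = f - 1 ∨ a = -(f - 1)) ∧ (b = f ∨ b = -f)) := by
  have h1 : 0 ≤ f := by rw [hf]; exact Real.goldenRatio_pos.le
  have h2 : 0 ≤ f - 1 := by rw [hf, sub_nonneg]; exact Real.one_lt_goldenRatio.le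
  rw [mem_dodecahedronVertices, mem_cubeVertices, ← hf]
  simp only [abs_eq h1, abs_eq h2]
  rfl

lemma icosian_preserves {a b c f : ℝ} (hf : f ^ 2 = f + 1) (hD :
      ((a = 1 ∨ a = -1) ∧ (b = 1 ∨ b = -1) ∧ (c = 1 ∨ c = -1)) ∨
      (a = 0 ∧ (b = f - 1 ∨ b = -(f - 1)) ∧ (c = f ∨ c = -f)) ∨
      (b = 0 ∧ (c = f - 1 ∨ c = -(f - 1)) ∧ (a = f ∨ a = -f)) ∨
      (c = 0 ∧ (a = f - 1 ∨ a = -(f - 1)) ∧ (b = f ∨ b = -f))) (a' b' c' : ℝ)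
      (ha : a' = (f * a + (f - 1) * b + c) / 2) (hb : b' = ((f - 1) * a + b - f * c) / 2)
      (hc : c' = (-a + f * b + (f - 1) * c) / 2) :
      ((a' = 1 ∨ a' = -1) ∧ (b' = 1 ∨ b' = -1) ∧ (c' = 1 ∨ c' = -1)) ∨
      (a' = 0 ∧ (b' = f - 1 ∨ b' = -(f - 1)) ∧ (c' = f ∨ c' = -f)) ∨
      (b' = 0 ∧ (c' = f - 1 ∨ c' = -(f - 1)) ∧ (a' = f ∨ a' = -f)) ∨
      (c' = 0 ∧ (a' = f - 1 ∨ a' = -(f - 1)) ∧ (b' = f ∨ b' = -f)) := by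
  rcases hD with ⟨rfl | rfl, rfl | rfl, rfl | rfl⟩ | ⟨rfl, rfl | rfl, rfl | rfl⟩ |
    ⟨rfl, rfl | rfl, rfl | rfl⟩ | ⟨rfl, rfl | rfl, rfl | rfl⟩ <;> grind

lemma norm_of_mem_dodecahedronVertices {w : Space3} (hw : w ∈ dodecahedronVertices) :
    ‖w‖ = √3 := by
  rcases mem_dodecahedronVertices.1 hw with h | h
  · exact norm_of_mem_cubeVertices h
  · apply norm_eq_sqrt_three
    have hf := Real.goldenRatio_sq
    generalize Real.goldenRatio = f at *
    rcases h with ⟨h0, h1, h2⟩ | ⟨h0, h1, h2⟩ | ⟨h0, h1, h2⟩ <;>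
    · simp only [← sq_abs (w _), h0, h1, h2]
      linear_combination 2 * hf

lemma mem_tetrahedronVertices {w : Space3} : w ∈ tetrahedronVertices ↔
    w = !₂[1, 1, 1] ∨ w = !₂[1, -1, -1] ∨ w = !₂[-1, 1, -1] ∨ w = !₂[-1, -1, 1] := by
  constructor
  · rintro ⟨hw, h⟩
    obtain ⟨h0, h1, h2⟩ := mem_cubeVertices.1 hw
    rcases h0 with h0 | h0 <;> rcases h1 with h1 | h1 <;> rcases h2 with h2 | h2 <;>
      rw [h0, h1, h2] at h <;> norm_num at h <;> rw [eq_vec_of_eq h0 h1 h2] <;> simp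
  · rintro (rfl | rfl | rfl | rfl) <;> refine ⟨mem_cubeVertices.2 ?_, ?_⟩ <;> simp

lemma norm_of_mem_tetrahedronVertices {w : Space3} (hw : w ∈ tetrahedronVertices) : ‖w‖ = √3 :=
  norm_of_mem_cubeVertices hw.1

/-- The neighbours of the vertex `(1, 1, 1)` of the tetrahedron. -/
def tetraNeighbours : Fin 3 → Space3 := ![!₂[1, -1, -1], !₂[-1, 1, -1], !₂[-1, -1, 1]]

/-- The neighbours of the vertex `(1, 1, 1)` of the cube. -/
def cubeNeighbours : Fin 3 → Space3 := ![!₂[-1, 1, 1], !₂[1, -1, 1], !₂[1, 1, -1]]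

/-- The neighbours of the vertex `(1, 1, 1)` of the dodecahedron. -/
def dodecaNeighbours : Fin 3 → Space3 :=
  ![!₂[0, Real.goldenRatio - 1, Real.goldenRatio], !₂[Real.goldenRatio, 0, Real.goldenRatio - 1],
    !₂[Real.goldenRatio - 1, Real.goldenRatio, 0]]

lemma conjVector_w_cycle {a b c : ℝ} :
    ∀ i, conjVector (quat (1 / 2) (1 / 2) (1 / 2) (1 / 2))
      ((![!₂[a, b, c], !₂[c, a, b], !₂[b, c, a]] : Fin 3 → Space3) i) =
      (![!₂[a, b, c], !₂[c, a, b], !₂[b, c, a]] : Fin 3 → Space3) (i + 1) := by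
  intro i
  fin_cases i <;> exact conjVector_w _ _ _

/-- A vertex of the three polyhedra. -/
def vertexOne : Space3 := !₂[1, 1, 1]

lemma tetraNeighbours_mem (i : Fin 3) : tetraNeighbours i ∈ tetrahedronVertices := by
  rw [mem_tetrahedronVertices]
  fin_cases i <;> simp [tetraNeighbours]

lemma cubeNeighbours_mem (i : Fin 3) : cubeNeighbours i ∈ cubeVertices := by
  rw [mem_cubeVertices]
  fin_cases i <;> simp [cubeNeighbours]

lemma dodecaNeighbours_mem (i : Fin 3) : dodecaNeighbours i ∈ dodecahedronVertices := by
  fin_cases i <;> exact (vec_mem_dodecahedronVertices rfl).2 (by simp)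

lemma vertexOne_mem_tetrahedronVertices : vertexOne ∈ tetrahedronVertices :=
  mem_tetrahedronVertices.2 (Or.inl rfl)

lemma vertexOne_mem_cubeVertices : vertexOne ∈ cubeVertices :=
  vertexOne_mem_tetrahedronVertices.1

lemma vertexOne_mem_dodecahedronVertices : vertexOne ∈ dodecahedronVertices :=
  Or.inl vertexOne_mem_cubeVertices

lemma isVertexFigure_tetrahedron : IsVertexFigure (stdPolyhedron tetrahedronVertices)
    (toSphere vertexOne (norm_of_mem_tetrahedronVertices vertexOne_mem_tetrahedronVertices))
    fun i => toSphere (tetraNeighbours i)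
      (norm_of_mem_tetrahedronVertices (tetraNeighbours_mem i)) := by
  refine isVertexFigure_stdPolyhedron (fun w hw => norm_of_mem_tetrahedronVertices hw)
    vertexOne_mem_tetrahedronVertices tetraNeighbours_mem ?_ ?_
  · rw [Fintype.linearIndependent_iff]
    intro c hc
    have h0 := congrArg (fun v : Space3 => v 0) hc
    have h1 := congrArg (fun v : Space3 => v 1) hc
    have h2 := congrArg (fun v : Space3 => v 2) hc
    simp [Fin.sum_univ_three, tetraNeighbours, vertexOne] at h0 h1 h2
    intro i
    fin_cases i
    · simp; linarith
    · simp; linarith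
    · simp; linarith
  · intro w hw
    refine ⟨![(1 + w 0 - w 1 - w 2) / 4, (1 - w 0 + w 1 - w 2) / 4, (1 - w 0 - w 1 + w 2) / 4],
      fun i => ?_, ?_⟩
    · rcases mem_tetrahedronVertices.1 hw with rfl | rfl | rfl | rfl <;> fin_cases i <;> simp <;>
        norm_num
    · ext i
      fin_cases i <;> simp [Fin.sum_univ_three, tetraNeighbours, vertexOne] <;> ring

lemma isVertexFigure_cube : IsVertexFigure (stdPolyhedron cubeVertices)
    (toSphere vertexOne (norm_of_mem_cubeVertices vertexOne_mem_cubeVertices))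
    fun i => toSphere (cubeNeighbours i) (norm_of_mem_cubeVertices (cubeNeighbours_mem i)) := by
  refine isVertexFigure_stdPolyhedron (fun w hw => norm_of_mem_cubeVertices hw)
    vertexOne_mem_cubeVertices cubeNeighbours_mem ?_ ?_
  · rw [Fintype.linearIndependent_iff]
    intro c hc
    have h0 := congrArg (fun v : Space3 => v 0) hc
    have h1 := congrArg (fun v : Space3 => v 1) hc
    have h2 := congrArg (fun v : Space3 => v 2) hc
    simp [Fin.sum_univ_three, cubeNeighbours, vertexOne] at h0 h1 h2
    intro i
    fin_cases i
    · simp; linarith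
    · simp; linarith
    · simp; linarith
  · intro w hw
    refine ⟨![(1 - w 0) / 2, (1 - w 1) / 2, (1 - w 2) / 2], fun i => ?_, ?_⟩
    · obtain ⟨h0, h1, h2⟩ := mem_cubeVertices.1 hw
      fin_cases i
      · rcases h0 with h | h <;> norm_num [h]
      · rcases h1 with h | h <;> norm_num [h]
      · rcases h2 with h | h <;> norm_num [h]
    · ext i
      fin_cases i <;> simp [Fin.sum_univ_three, cubeNeighbours, vertexOne] <;> ring

lemma dodecahedron_cone {a b c f : ℝ} (hf : f ^ 2 = f + 1) (hf1 : 1 < f)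
    (hD : ((a = 1 ∨ a = -1) ∧ (b = 1 ∨ b = -1) ∧ (c = 1 ∨ c = -1)) ∨
      (a = 0 ∧ (b = f - 1 ∨ b = -(f - 1)) ∧ (c = f ∨ c = -f)) ∨
      (b = 0 ∧ (c = f - 1 ∨ c = -(f - 1)) ∧ (a = f ∨ a = -f)) ∨
      (c = 0 ∧ (a = f - 1 ∨ a = -(f - 1)) ∧ (b = f ∨ b = -f))) :
    0 ≤ 1 - a + (f - 1) * (1 - b) ∧ 0 ≤ 1 - b + (f - 1) * (1 - c) ∧
      0 ≤ 1 - c + (f - 1) * (1 - a) := by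
  have hf2 : f < 2 := by nlinarith
  rcases hD with ⟨rfl | rfl, rfl | rfl, rfl | rfl⟩ | ⟨rfl, rfl | rfl, rfl | rfl⟩ |
    ⟨rfl, rfl | rfl, rfl | rfl⟩ | ⟨rfl, rfl | rfl, rfl | rfl⟩ <;>
  refine ⟨?_, ?_, ?_⟩ <;> nlinarith

lemma isVertexFigure_dodecahedron : IsVertexFigure (stdPolyhedron dodecahedronVertices)
    (toSphere vertexOne (norm_of_mem_dodecahedronVertices vertexOne_mem_dodecahedronVertices))
    fun i => toSphere (dodecaNeighbours i)
      (norm_of_mem_dodecahedronVertices (dodecaNeighbours_mem i)) := by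
  have hf := Real.goldenRatio_sq
  have hf1 := Real.one_lt_goldenRatio
  refine isVertexFigure_stdPolyhedron (fun w hw => norm_of_mem_dodecahedronVertices hw)
    vertexOne_mem_dodecahedronVertices dodecaNeighbours_mem ?_ ?_
  · rw [Fintype.linearIndependent_iff]
    intro c hc
    have h0 := congrArg (fun v : Space3 => v 0) hc
    have h1 := congrArg (fun v : Space3 => v 1) hc
    have h2 := congrArg (fun v : Space3 => v 2) hc
    simp [Fin.sum_univ_three, dodecaNeighbours, vertexOne] at h0 h1 h2
    generalize Real.goldenRatio = f at *
    have hn : 2 * (f - 1) ≠ 0 := by linarith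
    intro i
    apply mul_left_cancel₀ hn
    rw [mul_zero]
    fin_cases i
    · change 2 * (f - 1) * c 0 = 0
      linear_combination h0 + (f - 1) * h1 + (c 0 + c 2) * hf
    · change 2 * (f - 1) * c 1 = 0
      linear_combination h1 + (f - 1) * h2 + (c 0 + c 1) * hf
    · change 2 * (f - 1) * c 2 = 0
      linear_combination h2 + (f - 1) * h0 + (c 1 + c 2) * hf
  · intro w hw
    rw [← vec_eta w, vec_mem_dodecahedronVertices rfl] at hw
    -- These are the values at x − w of the basis dual to the edges: e₀ + (φ − 1)e₁ vanishes on the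
    -- edges 1 and 2 and equals 2(φ − 1) on the edge 0, and the others follow cyclically. The
    -- numerators are the inequalities of the three faces at the vertex.
    refine ⟨![(1 - w 0 + (Real.goldenRatio - 1) * (1 - w 1)) / (2 * (Real.goldenRatio - 1)),
      (1 - w 1 + (Real.goldenRatio - 1) * (1 - w 2)) / (2 * (Real.goldenRatio - 1)),
      (1 - w 2 + (Real.goldenRatio - 1) * (1 - w 0)) / (2 * (Real.goldenRatio - 1))],
      fun i => ?_, ?_⟩
    · generalize Real.goldenRatio = f at *
      have hg : 0 ≤ 2 * (f - 1) := by linarith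
      fin_cases i <;> refine div_nonneg ?_ hg
      · exact (dodecahedron_cone hf hf1 hw).1
      · exact (dodecahedron_cone hf hf1 hw).2.1
      · exact (dodecahedron_cone hf hf1 hw).2.2
    · ext i
      fin_cases i <;> simp [Fin.sum_univ_three, dodecaNeighbours, vertexOne]
      all_goals generalize Real.goldenRatio = f at *
      all_goals have hn : (f - 1) ≠ 0 := by linarith
      all_goals field_simp
      · linear_combination (2 - w 0 - w 2) * hf
      · linear_combination (2 - w 1 - w 0) * hf
      · linear_combination (2 - w 2 - w 1) * hf

lemma conjVector_unitI_mem_tetrahedronVertices {w : Space3} (hw : w ∈ tetrahedronVertices) :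
    conjVector unitI w ∈ tetrahedronVertices := by
  rw [mem_tetrahedronVertices] at *
  rcases hw with rfl | rfl | rfl | rfl <;> simp [unitI, conjVector_i]

lemma conjVector_unitJ_mem_tetrahedronVertices {w : Space3} (hw : w ∈ tetrahedronVertices) :
    conjVector unitJ w ∈ tetrahedronVertices := by
  rw [mem_tetrahedronVertices] at *
  rcases hw with rfl | rfl | rfl | rfl <;> simp [unitJ, conjVector_j]

lemma conjVector_unitW_mem_tetrahedronVertices {w : Space3} (hw : w ∈ tetrahedronVertices) :
    conjVector unitW w ∈ tetrahedronVertices := by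
  rw [mem_tetrahedronVertices] at *
  simp only [unitW]
  rcases hw with rfl | rfl | rfl | rfl <;> rw [conjVector_w] <;> simp

lemma vec_mem_cubeVertices {a b c : ℝ} : !₂[a, b, c] ∈ cubeVertices ↔
    (a = 1 ∨ a = -1) ∧ (b = 1 ∨ b = -1) ∧ (c = 1 ∨ c = -1) :=
  mem_cubeVertices

lemma neg_eq_or_eq_neg {a b : ℝ} : (-a = b ∨ -a = -b) ↔ (a = b ∨ a = -b) := by
  rw [neg_inj, neg_eq_iff_eq_neg, or_comm]

lemma conjVector_unitI_mem_cubeVertices {w : Space3} (hw : w ∈ cubeVertices) :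
    conjVector unitI w ∈ cubeVertices := by
  rw [← vec_eta w, vec_mem_cubeVertices] at hw
  rw [← vec_eta w, unitI, conjVector_i, vec_mem_cubeVertices]
  simpa only [neg_eq_or_eq_neg] using hw

lemma conjVector_unitJ_mem_cubeVertices {w : Space3} (hw : w ∈ cubeVertices) :
    conjVector unitJ w ∈ cubeVertices := by
  rw [← vec_eta w, vec_mem_cubeVertices] at hw
  rw [← vec_eta w, unitJ, conjVector_j, vec_mem_cubeVertices]
  simpa only [neg_eq_or_eq_neg] using hw

lemma conjVector_unitW_mem_cubeVertices {w : Space3} (hw : w ∈ cubeVertices) :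
    conjVector unitW w ∈ cubeVertices := by
  rw [← vec_eta w, vec_mem_cubeVertices] at hw
  rw [← vec_eta w, unitW, conjVector_w, vec_mem_cubeVertices]
  exact ⟨hw.2.2, hw.1, hw.2.1⟩

lemma conjVector_unitO_mem_cubeVertices {w : Space3} (hw : w ∈ cubeVertices) :
    conjVector unitO w ∈ cubeVertices := by
  rw [← vec_eta w, vec_mem_cubeVertices] at hw
  rw [← vec_eta w, unitO, conjVector_octahedral, vec_mem_cubeVertices, neg_eq_or_eq_neg]
  exact ⟨hw.1, hw.2.2, hw.2.1⟩

lemma conjVector_unitI_mem_dodecahedronVertices {w : Space3} (hw : w ∈ dodecahedronVertices) :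
    conjVector unitI w ∈ dodecahedronVertices := by
  rw [← vec_eta w, vec_mem_dodecahedronVertices rfl] at hw
  rw [← vec_eta w, unitI, conjVector_i, vec_mem_dodecahedronVertices rfl]
  simpa only [neg_eq_or_eq_neg, neg_eq_zero] using hw

lemma conjVector_unitJ_mem_dodecahedronVertices {w : Space3} (hw : w ∈ dodecahedronVertices) :
    conjVector unitJ w ∈ dodecahedronVertices := by
  rw [← vec_eta w, vec_mem_dodecahedronVertices rfl] at hw
  rw [← vec_eta w, unitJ, conjVector_j, vec_mem_dodecahedronVertices rfl]
  simpa only [neg_eq_or_eq_neg, neg_eq_zero] using hw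

lemma conjVector_unitW_mem_dodecahedronVertices {w : Space3} (hw : w ∈ dodecahedronVertices) :
    conjVector unitW w ∈ dodecahedronVertices := by
  rw [← vec_eta w, vec_mem_dodecahedronVertices rfl] at hw
  rw [← vec_eta w, unitW, conjVector_w, vec_mem_dodecahedronVertices rfl]
  tauto

lemma conjVector_unitD_mem_dodecahedronVertices {w : Space3} (hw : w ∈ dodecahedronVertices) :
    conjVector unitD w ∈ dodecahedronVertices := by
  rw [← vec_eta w, vec_mem_dodecahedronVertices rfl] at hw
  rw [← vec_eta w, unitD, conjVector_icosian Real.goldenRatio_sq, vec_mem_dodecahedronVertices rfl]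
  exact icosian_preserves Real.goldenRatio_sq hw _ _ _ rfl rfl rfl

/-! ### Rotation groups of the standard polyhedra -/

/-- `H` contains the rotations of the standard tetrahedron. -/
structure ContainsTetrahedral (H : Subgroup (Equiv.Perm Sphere2)) : Prop where
  i_mem : quatPerm unitI ∈ H
  j_mem : quatPerm unitJ ∈ H
  w_mem : quatPerm unitW ∈ H

namespace ContainsTetrahedral

variable {H K : Subgroup (Equiv.Perm Sphere2)}

lemma hurwitz (h : ContainsTetrahedral H) : ContainsHurwitzUnits (quatMonoid H) :=
  containsHurwitzUnits_quatMonoid h.i_mem h.j_mem h.w_mem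

lemma mono (h : ContainsTetrahedral H) (hHK : H ≤ K) : ContainsTetrahedral K :=
  ⟨hHK h.i_mem, hHK h.j_mem, hHK h.w_mem⟩

lemma inf (h : ContainsTetrahedral H) (h' : ContainsTetrahedral K) : ContainsTetrahedral (H ⊓ K) :=
  ⟨⟨h.i_mem, h'.i_mem⟩, ⟨h.j_mem, h'.j_mem⟩, ⟨h.w_mem, h'.w_mem⟩⟩

end ContainsTetrahedral

lemma containsTetrahedral_tetrahedron :
    ContainsTetrahedral (polyhedronRotations (stdPolyhedron tetrahedronVertices)) where
  i_mem := quatPerm_mem_polyhedronRotations quatPerm_unitI_sq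
    fun _ => conjVector_unitI_mem_tetrahedronVertices
  j_mem := quatPerm_mem_polyhedronRotations quatPerm_unitJ_sq
    fun _ => conjVector_unitJ_mem_tetrahedronVertices
  w_mem := quatPerm_mem_polyhedronRotations quatPerm_unitW_pow
    fun _ => conjVector_unitW_mem_tetrahedronVertices

lemma containsTetrahedral_cube :
    ContainsTetrahedral (polyhedronRotations (stdPolyhedron cubeVertices)) where
  i_mem := quatPerm_mem_polyhedronRotations quatPerm_unitI_sq
    fun _ => conjVector_unitI_mem_cubeVertices
  j_mem := quatPerm_mem_polyhedronRotations quatPerm_unitJ_sq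
    fun _ => conjVector_unitJ_mem_cubeVertices
  w_mem := quatPerm_mem_polyhedronRotations quatPerm_unitW_pow
    fun _ => conjVector_unitW_mem_cubeVertices

lemma containsTetrahedral_dodecahedron :
    ContainsTetrahedral (polyhedronRotations (stdPolyhedron dodecahedronVertices)) where
  i_mem := quatPerm_mem_polyhedronRotations quatPerm_unitI_sq
    fun _ => conjVector_unitI_mem_dodecahedronVertices
  j_mem := quatPerm_mem_polyhedronRotations quatPerm_unitJ_sq
    fun _ => conjVector_unitJ_mem_dodecahedronVertices
  w_mem := quatPerm_mem_polyhedronRotations quatPerm_unitW_pow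
    fun _ => conjVector_unitW_mem_dodecahedronVertices

lemma unitO_mem_cube : quatPerm unitO ∈ polyhedronRotations (stdPolyhedron cubeVertices) :=
  quatPerm_mem_polyhedronRotations quatPerm_unitO_pow fun _ => conjVector_unitO_mem_cubeVertices

lemma unitD_mem_dodecahedron :
    quatPerm unitD ∈ polyhedronRotations (stdPolyhedron dodecahedronVertices) :=
  quatPerm_mem_polyhedronRotations quatPerm_unitD_pow
    fun _ => conjVector_unitD_mem_dodecahedronVertices

lemma conjVector_w_vertexOne :
    conjVector (quat (1 / 2) (1 / 2) (1 / 2) (1 / 2)) vertexOne = vertexOne :=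
  conjVector_w 1 1 1

theorem isVertexTransitive_tetrahedron {H : Subgroup (Equiv.Perm Sphere2)}
    (hH : H ≤ polyhedronRotations (stdPolyhedron tetrahedronVertices))
    (hT : ContainsTetrahedral H) : IsVertexTransitive H (stdPolyhedron tetrahedronVertices)
      (toSphere vertexOne (norm_of_mem_tetrahedronVertices vertexOne_mem_tetrahedronVertices))
      fun i => toSphere (tetraNeighbours i)
        (norm_of_mem_tetrahedronVertices (tetraNeighbours_mem i)) := by
  refine isVertexTransitive_stdPolyhedron (fun w hw => norm_of_mem_tetrahedronVertices hw)
    vertexOne_mem_tetrahedronVertices tetraNeighbours_mem hH (fun w hw => ?_)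
    ⟨_, hT.hurwitz.w_mem, conjVector_w_vertexOne, conjVector_w_cycle⟩
  change Reach _ _ _
  have h : Reach (quatMonoid H) vertexOne !₂[1, 1, 1] := Reach.refl _ _
  rcases mem_tetrahedronVertices.1 hw with rfl | rfl | rfl | rfl
  · exact h
  · exact hT.hurwitz.reach_flip₁₂ h
  · exact hT.hurwitz.reach_flip₀₂ h
  · exact hT.hurwitz.reach_flip₀₁ h

namespace ContainsHurwitzUnits

variable {M : Submonoid ℍ[ℝ]} {x : Space3}

/-- Reachability of all vertices of the cube from that of one vertex of each of the two inscribed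
tetrahedra. -/
lemma reach_cube (hM : ContainsHurwitzUnits M) (h : Reach M x !₂[1, 1, 1])
    (h' : Reach M x !₂[1, 1, -1]) {w : Space3} (hw : w ∈ cubeVertices) : Reach M x w := by
  have h'' := hM.reach_flip₀₂ h'
  rw [← vec_eta w]
  obtain ⟨h0 | h0, h1 | h1, h2 | h2⟩ := mem_cubeVertices.1 hw <;> rw [h0, h1, h2]
  · exact h
  · exact h'
  · simpa using hM.reach_flip₁₂ h'
  · exact hM.reach_flip₁₂ h
  · simpa using hM.reach_flip₀₂ h'
  · exact hM.reach_flip₀₂ h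
  · exact hM.reach_flip₀₁ h
  · exact hM.reach_flip₀₁ h'

end ContainsHurwitzUnits

theorem isVertexTransitive_cube {H : Subgroup (Equiv.Perm Sphere2)}
    (hH : H ≤ polyhedronRotations (stdPolyhedron cubeVertices))
    (hT : ContainsTetrahedral H) (hO : quatPerm unitO ∈ H) :
    IsVertexTransitive H (stdPolyhedron cubeVertices)
      (toSphere vertexOne (norm_of_mem_cubeVertices vertexOne_mem_cubeVertices))
      fun i => toSphere (cubeNeighbours i) (norm_of_mem_cubeVertices (cubeNeighbours_mem i)) := by
  refine isVertexTransitive_stdPolyhedron (fun w hw => norm_of_mem_cubeVertices hw)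
    vertexOne_mem_cubeVertices cubeNeighbours_mem hH (fun w hw => ?_)
    ⟨_, hT.hurwitz.w_mem, conjVector_w_vertexOne, conjVector_w_cycle⟩
  have h : Reach (quatMonoid H) vertexOne !₂[1, 1, 1] := Reach.refl _ _
  refine hT.hurwitz.reach_cube h ?_ hw
  have h1 := h.conj (coe_mem_quatMonoid.2 hO)
  rw [unitO, conjVector_octahedral] at h1
  -- The cycle has order three, so four applications act as one, taking (1, −1, 1) to (1, 1, −1).
  exact hT.hurwitz.reach_cycle (hT.hurwitz.reach_cycle (hT.hurwitz.reach_cycle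
    (hT.hurwitz.reach_cycle h1)))

theorem isVertexTransitive_dodecahedron {H : Subgroup (Equiv.Perm Sphere2)}
    (hH : H ≤ polyhedronRotations (stdPolyhedron dodecahedronVertices))
    (hT : ContainsTetrahedral H) (hD : quatPerm unitD ∈ H) :
    IsVertexTransitive H (stdPolyhedron dodecahedronVertices)
      (toSphere vertexOne (norm_of_mem_dodecahedronVertices vertexOne_mem_dodecahedronVertices))
      fun i => toSphere (dodecaNeighbours i)
        (norm_of_mem_dodecahedronVertices (dodecaNeighbours_mem i)) := by
  refine isVertexTransitive_stdPolyhedron (fun w hw => norm_of_mem_dodecahedronVertices hw)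
    vertexOne_mem_dodecahedronVertices dodecaNeighbours_mem hH (fun w hw => ?_)
    ⟨_, hT.hurwitz.w_mem, conjVector_w_vertexOne, conjVector_w_cycle⟩
  change Reach _ _ _
  have hM := hT.hurwitz
  have h : Reach (quatMonoid H) vertexOne !₂[1, 1, 1] := Reach.refl _ _
  have hf := Real.goldenRatio_sq
  have hr : ∀ {a b c a' b' c' : ℝ}, Reach (quatMonoid H) vertexOne !₂[a, b, c] →
      (Real.goldenRatio * a + (Real.goldenRatio - 1) * b + c) / 2 = a' →
      ((Real.goldenRatio - 1) * a + b - Real.goldenRatio * c) / 2 = b' →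
      (-a + Real.goldenRatio * b + (Real.goldenRatio - 1) * c) / 2 = c' →
      Reach (quatMonoid H) vertexOne !₂[a', b', c'] := by
    intro a b c a' b' c' h0 ha hb hc
    have h1 := h0.conj (coe_mem_quatMonoid.2 hD)
    rwa [unitD, conjVector_icosian hf, ha, hb, hc] at h1
  rw [← vec_eta w, vec_mem_dodecahedronVertices rfl] at hw
  rw [← vec_eta w]
  generalize Real.goldenRatio = f at *
  -- The rotation of order five carries the vertex around a pentagon and reaches (1, 1, −1), in the
  -- second inscribed tetrahedron; the tetrahedral rotations supply all remaining vertices.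
  have h1 : Reach (quatMonoid H) vertexOne !₂[f, 0, f - 1] :=
    hr h (by ring) (by ring) (by ring)
  have h2 : Reach (quatMonoid H) vertexOne !₂[f, 0, -(f - 1)] :=
    hr h1 (by linear_combination hf / 2) (by ring) (by linear_combination hf / 2)
  have h3 : Reach (quatMonoid H) vertexOne !₂[1, 1, -1] :=
    hr h2 (by linear_combination hf / 2) (by linear_combination hf) (by linear_combination -hf / 2)
  have h1' := hM.reach_flip₀₂ h1
  have h2' := hM.reach_flip₀₂ h2
  rw [neg_neg] at h2'
  rcases hw with hw | ⟨e, e1 | e1, e2 | e2⟩ | ⟨e, e1 | e1, e2 | e2⟩ | ⟨e, e1 | e1, e2 | e2⟩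
  · exact hM.reach_cube h h3 (vec_mem_cubeVertices.2 hw)
  all_goals rw [e, e1, e2]
  · exact hM.reach_cycle (hM.reach_cycle h1)
  · exact hM.reach_cycle (hM.reach_cycle h2')
  · exact hM.reach_cycle (hM.reach_cycle h2)
  · exact hM.reach_cycle (hM.reach_cycle h1')
  · exact h1
  · exact h2'
  · exact h2
  · exact h1'
  · exact hM.reach_cycle h1
  · exact hM.reach_cycle h2'
  · exact hM.reach_cycle h2
  · exact hM.reach_cycle h1'

lemma toSphere_neg {w : Space3} (hw : ‖w‖ = √3) :
    -toSphere w hw = toSphere (-w) ((norm_neg w).trans hw) :=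
  Subtype.ext (smul_neg _ _).symm

lemma inner_vertexOne (w : Space3) : inner ℝ vertexOne w = w 0 + w 1 + w 2 := by
  simp [vertexOne, PiLp.inner_apply, Fin.sum_univ_three]

lemma inner_toSphere {v w : Space3} (hv : ‖v‖ = √3) (hw : ‖w‖ = √3) :
    inner ℝ (toSphere v hv : Space3) (toSphere w hw) = (√3)⁻¹ * ((√3)⁻¹ * inner ℝ v w) := by
  simp only [toSphere, inner_smul_left, inner_smul_right]
  rfl

lemma inner_toSphere_eq_iff {u v w : Space3} (hu : ‖u‖ = √3) (hv : ‖v‖ = √3) (hw : ‖w‖ = √3) :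
    inner ℝ (toSphere u hu : Space3) (toSphere v hv) =
      inner ℝ (toSphere u hu : Space3) (toSphere w hw) ↔ inner ℝ u v = inner ℝ u w := by
  have h := inv_ne_zero sqrt_three_ne_zero
  rw [inner_toSphere, inner_toSphere, mul_right_inj' h, mul_right_inj' h]

/-- A vertex-transitive group of rotations that permutes the nearest neighbours of a vertex
cyclically is the full rotation group. -/
lemma polyhedronRotations_stdPolyhedron_le {W : Set Space3} (hW : ∀ w ∈ W, ‖w‖ = √3)
    {y : Fin 3 → Space3} (hx : vertexOne ∈ W) (hy : ∀ i, y i ∈ W)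
    {H : Subgroup (Equiv.Perm Sphere2)}
    (h : IsVertexTransitive H (stdPolyhedron W) (toSphere vertexOne (hW _ hx))
      fun i => toSphere (y i) (hW _ (hy i)))
    (hne : y 0 0 ≠ 1) (hne' : y 0 1 ≠ -1)
    (hnear : ∀ w ∈ W, w 0 + w 1 + w 2 = y 0 0 + y 0 1 + y 0 2 → ∃ i, w = y i) :
    polyhedronRotations (stdPolyhedron W) ≤ H := by
  refine h.polyhedronRotations_le (toSphere_mem_stdPolyhedron.2 (hy 0)) ?_ ?_ ?_
    (toSphere_mem_stdPolyhedron.2 hx)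
  · rw [Ne, toSphere_injective]
    intro e
    exact hne (by rw [← e]; rfl)
  · rw [toSphere_neg, Ne, toSphere_injective]
    intro e
    exact hne' (by rw [← e]; rfl)
  · intro p hp hpy
    obtain ⟨w, hw, hwW, rfl⟩ := exists_toSphere hp
    rw [inner_toSphere_eq_iff, inner_vertexOne, inner_vertexOne] at hpy
    obtain ⟨i, hi⟩ := hnear w hwW hpy
    exact ⟨i, toSphere_injective.2 hi⟩

lemma polyhedronRotations_cube_le {H : Subgroup (Equiv.Perm Sphere2)}
    (hT : ContainsTetrahedral H) (hO : quatPerm unitO ∈ H) :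
    polyhedronRotations (stdPolyhedron cubeVertices) ≤ H := by
  -- `H` need not preserve the cube, but its intersection with the rotations of the cube contains
  -- the same generators.
  refine le_trans (polyhedronRotations_stdPolyhedron_le (fun w hw => norm_of_mem_cubeVertices hw)
    vertexOne_mem_cubeVertices cubeNeighbours_mem (isVertexTransitive_cube
      (H := H ⊓ polyhedronRotations (stdPolyhedron cubeVertices)) inf_le_right
      (hT.inf containsTetrahedral_cube) ⟨hO, unitO_mem_cube⟩) ?_ ?_ ?_) inf_le_left
  · simp [cubeNeighbours]; norm_num
  · simp [cubeNeighbours]; norm_num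
  · intro w hw
    have hs : cubeNeighbours 0 0 + cubeNeighbours 0 1 + cubeNeighbours 0 2 = 1 := by
      simp [cubeNeighbours]
    rw [hs]
    intro h
    obtain ⟨h0 | h0, h1 | h1, h2 | h2⟩ := mem_cubeVertices.1 hw <;> rw [h0, h1, h2] at h <;>
      norm_num at h
    · exact ⟨2, eq_vec_of_eq h0 h1 h2⟩
    · exact ⟨1, eq_vec_of_eq h0 h1 h2⟩
    · exact ⟨0, eq_vec_of_eq h0 h1 h2⟩

lemma polyhedronRotations_dodecahedron_le {H : Subgroup (Equiv.Perm Sphere2)}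
    (hT : ContainsTetrahedral H) (hD : quatPerm unitD ∈ H) :
    polyhedronRotations (stdPolyhedron dodecahedronVertices) ≤ H := by
  have hf := Real.goldenRatio_sq
  have hf1 := Real.one_lt_goldenRatio
  have hf2 := Real.goldenRatio_lt_two
  refine le_trans (polyhedronRotations_stdPolyhedron_le
    (fun w hw => norm_of_mem_dodecahedronVertices hw)
    vertexOne_mem_dodecahedronVertices dodecaNeighbours_mem (isVertexTransitive_dodecahedron
      (H := H ⊓ polyhedronRotations (stdPolyhedron dodecahedronVertices)) inf_le_right
      (hT.inf containsTetrahedral_dodecahedron) ⟨hD, unitD_mem_dodecahedron⟩) ?_ ?_ ?_) inf_le_left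
  · simp [dodecaNeighbours]
  · change Real.goldenRatio - 1 ≠ -1
    linarith
  · intro w hw
    have hs : dodecaNeighbours 0 0 + dodecaNeighbours 0 1 + dodecaNeighbours 0 2 =
        2 * Real.goldenRatio - 1 := by
      simp [dodecaNeighbours]; ring
    rw [hs]
    intro h
    rw [← vec_eta w, vec_mem_dodecahedronVertices rfl] at hw
    rcases hw with ⟨h0 | h0, h1 | h1, h2 | h2⟩ | ⟨h0, h1 | h1, h2 | h2⟩ |
      ⟨h1, h2 | h2, h0 | h0⟩ | ⟨h2, h0 | h0, h1 | h1⟩ <;> rw [h0, h1, h2] at h <;>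
      first
      | exact ⟨0, eq_vec_of_eq h0 h1 h2⟩
      | exact ⟨1, eq_vec_of_eq h0 h1 h2⟩
      | exact ⟨2, eq_vec_of_eq h0 h1 h2⟩
      | (exfalso; linarith)

/-- The rotation group of a regular tetrahedron has at most twelve elements. -/
lemma card_polyhedronRotations_tetrahedron :
    Finite (polyhedronRotations (stdPolyhedron tetrahedronVertices)) ∧
      Nat.card (polyhedronRotations (stdPolyhedron tetrahedronVertices)) ≤ 12 := by
  classical
  set P := stdPolyhedron tetrahedronVertices with hP
  set x := toSphere vertexOne (norm_of_mem_tetrahedronVertices vertexOne_mem_tetrahedronVertices)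
  set y : Fin 3 → Sphere2 := fun i => toSphere (tetraNeighbours i)
        (norm_of_mem_tetrahedronVertices (tetraNeighbours_mem i)) with hy
  have hxP : x ∈ P := toSphere_mem_stdPolyhedron.2 vertexOne_mem_tetrahedronVertices
  have hyP : ∀ i, y i ∈ P := fun i => toSphere_mem_stdPolyhedron.2 (tetraNeighbours_mem i)
  set F : Finset Sphere2 := {x, y 0, y 1, y 2} with hF
  have hPF : ∀ p ∈ P, p ∈ F := by
    intro p hp
    obtain ⟨w, hw, hwW, rfl⟩ := exists_toSphere hp
    simp only [hF, Finset.mem_insert, Finset.mem_singleton]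
    rcases mem_tetrahedronVertices.1 hwW with rfl | rfl | rfl | rfl
    · exact Or.inl rfl
    · exact Or.inr (Or.inl rfl)
    · exact Or.inr (Or.inr (Or.inl rfl))
    · exact Or.inr (Or.inr (Or.inr rfl))
  have hmem : ∀ {g : Equiv.Perm Sphere2} {p}, g ∈ polyhedronRotations P → p ∈ P → g p ∈ P := by
    intro g p hg hp
    have : g • p ∈ g • P := Set.smul_mem_smul_set hp
    rwa [smul_eq_of_mem_polyhedronRotations hg] at this
  have hne : x ≠ y 0 := by
    rw [hy, Ne, toSphere_injective]
    intro e
    have := congrArg (fun v : Space3 => v 1) e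
    norm_num [vertexOne, tetraNeighbours] at this
  have hne' : -x ≠ y 0 := by
    rw [hy, toSphere_neg, Ne, toSphere_injective]
    intro e
    have := congrArg (fun v : Space3 => v 0) e
    norm_num [vertexOne, tetraNeighbours] at this
  -- The images of x and `y 0` determine a rotation, and there are 4 · 3 ordered pairs of distinct
  -- vertices.
  let e : polyhedronRotations P → F.offDiag := fun g => ⟨(g.1 x, g.1 (y 0)),
    Finset.mem_offDiag.2 ⟨hPF _ (hmem g.2 hxP), hPF _ (hmem g.2 (hyP 0)),
      fun h => hne (g.1.injective h)⟩⟩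
  have he : Function.Injective e := by
    intro g g' h
    have h1 := congrArg Subtype.val h
    exact Subtype.ext (IsVertexTransitive.eq_of_rotation_eq_on_two g.2.1 g'.2.1 hne hne'
      (congrArg Prod.fst h1) (congrArg Prod.snd h1))
  refine ⟨Finite.of_injective e he, (Nat.card_le_card_of_injective e he).trans ?_⟩
  rw [Nat.card_eq_fintype_card, Fintype.card_coe, Finset.offDiag_card]
  have : F.card ≤ 4 := Finset.card_le_four
  interval_cases F.card <;> norm_num

lemma eq_polyhedronRotations_tetrahedron {G : Subgroup (Equiv.Perm Sphere2)}
    (hG : Nat.card G = 12) (h : G ≤ polyhedronRotations (stdPolyhedron tetrahedronVertices)) :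
    G = polyhedronRotations (stdPolyhedron tetrahedronVertices) := by
  obtain ⟨hf, hc⟩ := card_polyhedronRotations_tetrahedron
  exact Subgroup.eq_of_le_of_card_ge h (hc.trans hG.ge)

/-! ### Invariant sets as unions of orbits -/

/-- `H` is a group of rotations of the polyhedron with vertex set `P` that is transitive on its
vertices and on the centers of its faces of each positive dimension. -/
structure IsFaceTransitive (H : Subgroup (Equiv.Perm Sphere2)) (P : Set Sphere2) : Prop where
  le : H ≤ polyhedronRotations P
  exists_vertex : ∀ p ∈ P, ∀ q ∈ P, ∃ g ∈ H, g p = q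
  exists_center : ∀ k ≠ 0, ∀ p ∈ projectedCenters P k, ∀ q ∈ projectedCenters P k, ∃ g ∈ H, g p = q

lemma IsVertexTransitive.isFaceTransitive {H : Subgroup (Equiv.Perm Sphere2)} {P : Set Sphere2}
    {x : Sphere2} {y : Fin 3 → Sphere2} (h : IsVertexTransitive H P x y)
    (hP : IsVertexFigure P x y) : IsFaceTransitive H P where
  le := h.le
  exists_vertex p hp q hq := by
    obtain ⟨g, hg, rfl⟩ := h.exists_eq p hp
    obtain ⟨g', hg', rfl⟩ := h.exists_eq q hq
    refine ⟨g' * g⁻¹, mul_mem hg' (inv_mem hg), ?_⟩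
    rw [Equiv.Perm.mul_apply]
    exact congrArg g' (g.symm_apply_apply x)
  exists_center k hk p hp q hq := h.exists_eq_of_mem_projectedCenters hP hk hp hq

/-- `PreservesSet H α`: the group `H` maps `α` onto itself. -/
def PreservesSet (H : Subgroup (Equiv.Perm Sphere2)) (α : Set Sphere2) : Prop :=
  H ≤ MulAction.stabilizer (Equiv.Perm Sphere2) α

lemma preservesSet_of_forall {H : Subgroup (Equiv.Perm Sphere2)} {α : Set Sphere2}
    (h : ∀ g ∈ H, ∀ p ∈ α, g p ∈ α) : PreservesSet H α := by
  intro g hg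
  refine MulAction.mem_stabilizer_iff.2 (Set.Subset.antisymm ?_ fun p hp => ?_)
  · rintro _ ⟨p, hp, rfl⟩
    exact h g hg p hp
  · rw [Set.mem_smul_set_iff_inv_smul_mem]
    exact h _ (inv_mem hg) p hp

lemma PreservesSet.apply_mem {H : Subgroup (Equiv.Perm Sphere2)} {α : Set Sphere2}
    (h : PreservesSet H α) {g : Equiv.Perm Sphere2} (hg : g ∈ H) {p : Sphere2} (hp : p ∈ α) :
    g p ∈ α := by
  have : g • p ∈ g • α := Set.smul_mem_smul_set hp
  rwa [MulAction.mem_stabilizer_iff.1 (h hg)] at this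

namespace IsFaceTransitive

variable {H : Subgroup (Equiv.Perm Sphere2)} {P : Set Sphere2}

lemma preservesSet_projectedCenters (h : IsFaceTransitive H P) {k : ℕ} (hk : k ≠ 0) :
    PreservesSet H (projectedCenters P k) := by
  intro g hg
  have hg' := h.le hg
  obtain ⟨f, rfl⟩ := exists_spherePerm hg'.1
  refine MulAction.mem_stabilizer_iff.2 ?_
  rw [← smul_projectedCenters P hk f, smul_eq_of_mem_polyhedronRotations hg']

lemma preservesSet_of_mem_orbitFamily (h : IsFaceTransitive H P) {C : Set Sphere2}
    (hC : C ∈ orbitFamily P H) : PreservesSet H C := by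
  rcases hC with (rfl | rfl | rfl) | ⟨X, -, rfl⟩
  · exact h.le.trans inf_le_right
  · exact h.preservesSet_projectedCenters two_ne_zero
  · exact h.preservesSet_projectedCenters one_ne_zero
  · refine preservesSet_of_forall fun g hg p hp => ?_
    exact MulAction.mem_orbit_of_mem_orbit (⟨g, hg⟩ : H) hp

/-- The unions of members of the family are the invariant sets. -/
theorem isUnionOfMembers_iff (h : IsFaceTransitive H P) {α : Set Sphere2} :
    IsUnionOfMembers α (orbitFamily P H) ↔ PreservesSet H α := by
  constructor
  · rintro ⟨D, hD, rfl⟩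
    refine preservesSet_of_forall fun g hg p ⟨C, hC, hp⟩ => ⟨C, hC, ?_⟩
    exact (h.preservesSet_of_mem_orbitFamily (hD hC)).apply_mem hg hp
  · intro hα
    -- The members of the family cover the sphere, and each lies within one orbit, so a member that
    -- meets the invariant set is contained in it.
    refine ⟨{C | C ∈ orbitFamily P H ∧ C ⊆ α}, fun C hC => hC.1, Set.Subset.antisymm ?_ ?_⟩
    · intro p hp
      by_cases hP : p ∈ P
      · refine ⟨P, ⟨Or.inl (Or.inl rfl), fun q hq => ?_⟩, hP⟩
        obtain ⟨g, hg, rfl⟩ := h.exists_vertex p hP q hq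
        exact hα.apply_mem hg hp
      by_cases hF : p ∈ faceCenters P
      · refine ⟨faceCenters P, ⟨Or.inl (Or.inr (Or.inl rfl)), fun q hq => ?_⟩, hF⟩
        obtain ⟨g, hg, rfl⟩ := h.exists_center 2 two_ne_zero p hF q hq
        exact hα.apply_mem hg hp
      by_cases hE : p ∈ edgeMidpoints P
      · refine ⟨edgeMidpoints P, ⟨Or.inl (Or.inr (Or.inr rfl)), fun q hq => ?_⟩, hE⟩
        obtain ⟨g, hg, rfl⟩ := h.exists_center 1 one_ne_zero p hE q hq
        exact hα.apply_mem hg hp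
      · refine ⟨MulAction.orbit H p, ⟨Or.inr ⟨p, ?_, rfl⟩, ?_⟩, MulAction.mem_orbit_self p⟩
        · rintro ((h1 | h1) | h1)
          · exact hP h1
          · exact hF h1
          · exact hE h1
        · rintro _ ⟨g, rfl⟩
          exact hα.apply_mem g.2 hp
    · rintro p ⟨C, ⟨-, hC⟩, hp⟩
      exact hC hp

end IsFaceTransitive

/-! ### Conjugation and polyhedra in general position -/

/-- The conjugate `g⁻¹ H g`. -/
def conjGroup (g : Equiv.Perm Sphere2) (H : Subgroup (Equiv.Perm Sphere2)) :
    Subgroup (Equiv.Perm Sphere2) := H.comap (MulAut.conj g).toMonoidHom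

section conjGroup

variable {g k : Equiv.Perm Sphere2} {H K : Subgroup (Equiv.Perm Sphere2)}

lemma mem_conjGroup : k ∈ conjGroup g H ↔ g * k * g⁻¹ ∈ H := Iff.rfl

lemma conj_mem_conjGroup (hk : k ∈ H) : g⁻¹ * k * g ∈ conjGroup g H := by
  rw [mem_conjGroup]
  convert hk using 1
  group

lemma conjGroup_mono (h : H ≤ K) : conjGroup g H ≤ conjGroup g K := Subgroup.comap_mono h

lemma conjGroup_le_conjGroup : conjGroup g H ≤ conjGroup g K ↔ H ≤ K := by
  refine ⟨fun h k hk => ?_, conjGroup_mono⟩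
  have := h (conj_mem_conjGroup hk)
  rw [mem_conjGroup] at this
  convert this using 1
  group

lemma conjGroup_eq_of_mem (hg : g ∈ H) : conjGroup g H = H := by
  ext k
  rw [mem_conjGroup, H.mul_mem_cancel_right (inv_mem hg), H.mul_mem_cancel_left hg]

lemma conjGroup_conjGroup {s : Equiv.Perm Sphere2} :
    conjGroup s (conjGroup g H) = conjGroup (g * s) H := by
  ext k
  rw [mem_conjGroup, mem_conjGroup, mem_conjGroup, mul_inv_rev]
  simp only [mul_assoc]


/-- Conjugate groups are isomorphic. -/
def conjGroupEquiv (g : Equiv.Perm Sphere2) (H : Subgroup (Equiv.Perm Sphere2)) :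
    conjGroup g H ≃* H where
  toFun k := ⟨g * k * g⁻¹, k.2⟩
  invFun k := ⟨g⁻¹ * k * g, conj_mem_conjGroup k.2⟩
  left_inv k := Subtype.ext (by simp [mul_assoc])
  right_inv k := Subtype.ext (by simp [mul_assoc])
  map_mul' k l := Subtype.ext (by simp [mul_assoc])

lemma conjGroup_polyhedronRotations (hg : g ∈ rotationGroup) (P : Set Sphere2) :
    conjGroup g (polyhedronRotations (g • P)) = polyhedronRotations P := by
  ext k
  rw [mem_conjGroup, polyhedronRotations, polyhedronRotations, Subgroup.mem_inf, Subgroup.mem_inf]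
  refine and_congr ?_ ?_
  · rw [rotationGroup.mul_mem_cancel_right (inv_mem hg), rotationGroup.mul_mem_cancel_left hg]
  · rw [MulAction.mem_stabilizer_iff, MulAction.mem_stabilizer_iff, smul_smul, inv_mul_cancel_right,
      ← smul_smul, smul_left_cancel_iff]

lemma IsFaceTransitive.of_conjGroup {P : Set Sphere2} (hg : g ∈ rotationGroup)
    (h : IsFaceTransitive (conjGroup g H) P) : IsFaceTransitive H (g • P) where
  le := by
    rw [← conjGroup_le_conjGroup (g := g), conjGroup_polyhedronRotations hg]
    exact h.le
  exists_vertex := by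
    rintro _ ⟨p, hp, rfl⟩ _ ⟨q, hq, rfl⟩
    obtain ⟨k, hk, rfl⟩ := h.exists_vertex p hp q hq
    exact ⟨_, hk, by simp⟩
  exists_center := by
    intro n hn
    obtain ⟨f, rfl⟩ := exists_spherePerm hg
    rw [smul_projectedCenters P hn f]
    rintro _ ⟨p, hp, rfl⟩ _ ⟨q, hq, rfl⟩
    obtain ⟨k, hk, rfl⟩ := h.exists_center n hn p hp q hq
    exact ⟨_, hk, by simp⟩

end conjGroup

/-- If `-W` is the image of `W` under a rotation, then all inscribed copies of `W` are obtained by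
rotations. -/
lemma IsInscribedCopy.exists_eq_quatPerm_smul {P : Set Sphere2} {W : Set Space3}
    (hW : ∀ w ∈ W, ‖w‖ = √3) (hne : W.Nonempty) {s : unitary ℍ[ℝ]}
    (hs : ∀ w, conjVector (star s : unitary ℍ[ℝ]) w ∈ W ↔ -w ∈ W) (hP : IsInscribedCopy P W) :
    ∃ q, P = quatPerm q • stdPolyhedron W := by
  obtain ⟨f, rfl⟩ := hP.exists_eq hW hne
  obtain ⟨q, rfl | rfl⟩ := exists_quatIso_or_neg f
  · exact ⟨q, rfl⟩
  · refine ⟨q * s, ?_⟩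
    rw [map_mul, map_mul, mul_smul, mul_smul]
    congr 1
    ext p
    have hinv : (spherePerm (LinearIsometryEquiv.neg ℝ))⁻¹ =
        spherePerm (LinearIsometryEquiv.neg ℝ) := by
      rw [inv_eq_iff_mul_eq_one, ← map_mul, isometryNeg_mul_self, map_one]
    rw [Set.mem_smul_set_iff_inv_smul_mem, Set.mem_smul_set_iff_inv_smul_mem, hinv, ← map_inv]
    have h := hs (√3 • (p : Space3))
    rw [← smul_neg] at h
    refine h.symm.trans ?_
    have h2 : √3 • ((quatPerm s⁻¹ p : Sphere2) : Space3) =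
        conjVector (star s : unitary ℍ[ℝ]) (√3 • (p : Space3)) := by
      rw [coe_quatPerm]
      exact ((quatIso s⁻¹).map_smul _ _).symm
    change _ ↔ √3 • ((quatPerm s⁻¹ p : Sphere2) : Space3) ∈ W
    rw [h2]

lemma neg_mem_cubeVertices {w : Space3} : -w ∈ cubeVertices ↔ w ∈ cubeVertices := by
  rw [mem_cubeVertices, mem_cubeVertices]
  simp only [PiLp.neg_apply, neg_eq_or_eq_neg]

lemma neg_mem_dodecahedronVertices {w : Space3} :
    -w ∈ dodecahedronVertices ↔ w ∈ dodecahedronVertices := by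
  rw [mem_dodecahedronVertices, mem_dodecahedronVertices, neg_mem_cubeVertices]
  simp only [PiLp.neg_apply, neg_eq_zero, abs_neg]

/-- A quarter turn about a coordinate axis takes the tetrahedron to its antipode. Thus even copies
obtained by orientation-reversing isometries are obtained by rotations. -/
lemma conjVector_star_unitO_mem_tetrahedronVertices (w : Space3) :
    conjVector (star unitO : unitary ℍ[ℝ]) w ∈ tetrahedronVertices ↔ -w ∈ tetrahedronVertices := by
  have h : √(2 : ℝ) ^ 2 = 2 := Real.sq_sqrt (by norm_num)
  have hw : conjVector (star unitO : unitary ℍ[ℝ]) w = !₂[w 0, w 2, -w 1] := by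
    conv_lhs => rw [← vec_eta w]
    rw [conjVector_vec, Unitary.coe_star, unitO, star_quat]
    ext i
    fin_cases i <;> simp
    · linear_combination w 0 / 2 * h
    · linear_combination w 2 / 2 * h
    · linear_combination w 1 / 2 * h
  rw [hw, tetrahedronVertices, Set.mem_ofPred_eq, Set.mem_ofPred_eq, neg_mem_cubeVertices,
    vec_mem_cubeVertices, neg_eq_or_eq_neg, mem_cubeVertices]
  refine and_congr ⟨fun h => ⟨h.1, h.2.2, h.2.1⟩, fun h => ⟨h.1, h.2.2, h.2.1⟩⟩ ?_
  simp only [PiLp.neg_apply]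
  refine Eq.congr ?_ rfl
  simp only [Matrix.cons_val]
  ring

theorem IsRegularTetrahedron.exists_eq {P : Set Sphere2} (hP : IsRegularTetrahedron P) :
    ∃ q, P = quatPerm q • stdPolyhedron tetrahedronVertices :=
  IsInscribedCopy.exists_eq_quatPerm_smul (fun _ hw => norm_of_mem_tetrahedronVertices hw)
    ⟨_, vertexOne_mem_tetrahedronVertices⟩ conjVector_star_unitO_mem_tetrahedronVertices hP

theorem IsCube.exists_eq {P : Set Sphere2} (hP : IsCube P) :
    ∃ q, P = quatPerm q • stdPolyhedron cubeVertices :=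
  IsInscribedCopy.exists_eq_quatPerm_smul (s := 1) (fun _ hw => norm_of_mem_cubeVertices hw)
    ⟨_, vertexOne_mem_cubeVertices⟩
    (fun w => by rw [star_one, OneMemClass.coe_one, conjVector_one, neg_mem_cubeVertices]) hP

theorem IsRegularDodecahedron.exists_eq {P : Set Sphere2} (hP : IsRegularDodecahedron P) :
    ∃ q, P = quatPerm q • stdPolyhedron dodecahedronVertices :=
  IsInscribedCopy.exists_eq_quatPerm_smul (s := 1)
    (fun _ hw => norm_of_mem_dodecahedronVertices hw) ⟨_, vertexOne_mem_dodecahedronVertices⟩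
    (fun w => by rw [star_one, OneMemClass.coe_one, conjVector_one, neg_mem_dodecahedronVertices])
    hP

lemma isFaceTransitive_tetrahedron :
    IsFaceTransitive (polyhedronRotations (stdPolyhedron tetrahedronVertices))
      (stdPolyhedron tetrahedronVertices) :=
  (isVertexTransitive_tetrahedron le_rfl containsTetrahedral_tetrahedron).isFaceTransitive
    isVertexFigure_tetrahedron

lemma isFaceTransitive_cube :
    IsFaceTransitive (polyhedronRotations (stdPolyhedron cubeVertices))
      (stdPolyhedron cubeVertices) :=
  (isVertexTransitive_cube le_rfl containsTetrahedral_cube unitO_mem_cube).isFaceTransitive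
    isVertexFigure_cube

lemma isFaceTransitive_dodecahedron :
    IsFaceTransitive (polyhedronRotations (stdPolyhedron dodecahedronVertices))
      (stdPolyhedron dodecahedronVertices) :=
  (isVertexTransitive_dodecahedron le_rfl containsTetrahedral_dodecahedron
    unitD_mem_dodecahedron).isFaceTransitive isVertexFigure_dodecahedron

lemma IsFaceTransitive.smul {P : Set Sphere2} (h : IsFaceTransitive (polyhedronRotations P) P)
    {g : Equiv.Perm Sphere2} (hg : g ∈ rotationGroup) :
    IsFaceTransitive (polyhedronRotations (g • P)) (g • P) :=
  IsFaceTransitive.of_conjGroup hg (by rwa [conjGroup_polyhedronRotations hg])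

/-! ### Elements excluded by the structure of A₄ -/

lemma eq_one_of_pow_five {K : Type*} [Group K] (e : K ≃* alternatingGroup (Fin 4)) {x : K}
    (hx : x ^ 5 = 1) : x = 1 := by
  apply e.injective
  rw [map_one]
  have h5 : e x ^ 5 = 1 := by rw [← map_pow, hx, map_one]
  have h12 : e x ^ 12 = 1 := by
    have hc : Nat.card (alternatingGroup (Fin 4)) = 12 := by
      rw [nat_card_alternatingGroup, Nat.card_eq_fintype_card, Fintype.card_fin]
      rfl
    rw [← hc, pow_card_eq_one']
  have h := pow_gcd_eq_one.2 ⟨h5, h12⟩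
  rwa [show Nat.gcd 5 12 = 1 by norm_num, pow_one] at h

lemma sq_eq_one_of_pow_four {K : Type*} [Group K] (e : K ≃* alternatingGroup (Fin 4)) {x : K}
    (hx : x ^ 4 = 1) : x ^ 2 = 1 := by
  apply e.injective
  rw [map_one, map_pow]
  have h : ∀ y : alternatingGroup (Fin 4), y ^ 4 = 1 → y ^ 2 = 1 := by decide
  exact h _ (by rw [← map_pow, hx, map_one])

lemma quatPerm_ne_one {q : unitary ℍ[ℝ]} (hq : (q : ℍ[ℝ]).imI ≠ 0) : quatPerm q ≠ 1 := by
  intro h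
  rw [← map_one quatPerm] at h
  rcases eq_or_eq_neg_of_quatPerm_eq h with h | h <;>
    exact hq (by simp [h])

lemma quatPerm_unitI_ne_one : quatPerm unitI ≠ 1 := quatPerm_ne_one (by simp [unitI])

lemma quatPerm_unitD_ne_one : quatPerm unitD ≠ 1 := quatPerm_ne_one (by simp [unitD])

lemma IsFaceTransitive.le_rotationGroup {H : Subgroup (Equiv.Perm Sphere2)} {P : Set Sphere2}
    (h : IsFaceTransitive H P) : H ≤ rotationGroup := h.le.trans inf_le_left

section Alternating

variable {G : Subgroup (Equiv.Perm Sphere2)}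

lemma unitO_notMem (e : G ≃* alternatingGroup (Fin 4)) : quatPerm unitO ∉ G := by
  intro h
  have h1 := sq_eq_one_of_pow_four e (x := ⟨_, h⟩) (Subtype.ext quatPerm_unitO_pow)
  have h2 : quatPerm unitO ^ 2 = 1 := congrArg Subtype.val h1
  rw [← map_pow, unitO_sq] at h2
  exact quatPerm_unitI_ne_one h2

lemma notMem_of_pow_five (e : G ≃* alternatingGroup (Fin 4)) {g : Equiv.Perm Sphere2}
    (hg : g ^ 5 = 1) (hg1 : g ≠ 1) : g ∉ G := fun h =>
  hg1 (congrArg Subtype.val (eq_one_of_pow_five e (x := ⟨_, h⟩) (Subtype.ext hg)))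

lemma unitD_notMem (e : G ≃* alternatingGroup (Fin 4)) : quatPerm unitD ∉ G :=
  notMem_of_pow_five e quatPerm_unitD_pow quatPerm_unitD_ne_one

/-- The unit quaternion `(i + j) / √2`. -/
def unitS : unitary ℍ[ℝ] :=
  ⟨quat 0 (√2 / 2) (√2 / 2) 0, mem_unitary_iff.2 (by
    have h : √(2 : ℝ) ^ 2 = 2 := Real.sq_sqrt (by norm_num)
    simp only [quat_re, quat_imI, quat_imJ, quat_imK]
    linear_combination h / 2)⟩

/-- The half-turn about i + j exchanges i with j and negates k. It normalizes the Hurwitz units and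
exchanges the two icosians of `finite_trichotomy`, hence the two icosahedral groups above the
tetrahedral one. -/
lemma unitS_conj (a b c d : ℝ) :
    (unitS : ℍ[ℝ]) * quat a b c d * star (unitS : ℍ[ℝ]) = quat a c b (-d) := by
  have h : √(2 : ℝ) ^ 2 = 2 := Real.sq_sqrt (by norm_num)
  rw [unitS, star_quat, quat_mul, quat_mul]
  congr 1
  · linear_combination a / 2 * h
  · linear_combination c / 2 * h
  · linear_combination b / 2 * h
  · linear_combination -d / 2 * h

lemma coe_mem_quatMonoid_conjGroup {s q : unitary ℍ[ℝ]} :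
    quatPerm q ∈ conjGroup (quatPerm s) G ↔
      (s : ℍ[ℝ]) * q * star (s : ℍ[ℝ]) ∈ quatMonoid G := by
  rw [mem_conjGroup, ← map_inv, ← map_mul, ← map_mul, ← coe_mem_quatMonoid]
  rfl

lemma ContainsTetrahedral.conjGroup_unitS (h : ContainsTetrahedral G) :
    ContainsTetrahedral (conjGroup (quatPerm unitS) G) where
  i_mem := by
    rw [coe_mem_quatMonoid_conjGroup, unitI, unitS_conj, neg_zero]
    exact h.hurwitz.j_mem
  j_mem := by
    rw [coe_mem_quatMonoid_conjGroup, unitJ, unitS_conj, neg_zero]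
    exact h.hurwitz.i_mem
  w_mem := by
    rw [coe_mem_quatMonoid_conjGroup, unitW, unitS_conj]
    exact h.hurwitz.half_mem (by norm_num) (by norm_num) (by norm_num) (by norm_num)

/-- A group isomorphic to `A₄` that contains the rotations of the standard tetrahedron is contained
in every finite group that does so. -/
lemma ContainsTetrahedral.le_of_mulEquiv (h : ContainsTetrahedral G)
    (e : G ≃* alternatingGroup (Fin 4)) (hG : G ≤ rotationGroup)
    {K : Subgroup (Equiv.Perm Sphere2)} (hK : ContainsTetrahedral K) : G ≤ K := by
  have : Finite G := Finite.of_equiv _ e.symm.toEquiv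
  rcases h.hurwitz.finite_trichotomy hK.hurwitz (finite_quatMonoid G) with h1 | h1 | h1 | h1
  · exact le_of_quatMonoid_le hG h1
  · exact absurd ((coe_mem_quatMonoid (q := unitO)).1 h1) (unitO_notMem e)
  · exact absurd ((coe_mem_quatMonoid (q := unitD)).1 h1) (unitD_notMem e)
  · refine absurd ?_ (unitD_notMem ((conjGroupEquiv (quatPerm unitS) G).trans e))
    rw [coe_mem_quatMonoid_conjGroup, unitD, unitS_conj, neg_zero]
    exact h1

lemma containsTetrahedral_of_mulEquiv (e : G ≃* alternatingGroup (Fin 4))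
    (hG : G ≤ polyhedronRotations (stdPolyhedron tetrahedronVertices)) :
    ContainsTetrahedral G ∧
      G = polyhedronRotations (stdPolyhedron tetrahedronVertices) := by
  have hc : Nat.card G = 12 := by
    rw [Nat.card_congr e.toEquiv, nat_card_alternatingGroup, Nat.card_eq_fintype_card,
      Fintype.card_fin]
    rfl
  have h := eq_polyhedronRotations_tetrahedron hc hG
  exact ⟨h ▸ containsTetrahedral_tetrahedron, h⟩

end Alternating

/-! ### The stabilizer of a finite set -/

/-- A nonempty set preserved by the rotations of the tetrahedron has at least three points. -/
lemma ContainsTetrahedral.exists_three {H : Subgroup (Equiv.Perm Sphere2)}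
    (h : ContainsTetrahedral H) (p : Sphere2) :
    ∃ a ∈ H, ∃ b ∈ H, p ≠ a p ∧ p ≠ b p ∧ a p ≠ b p := by
  have hne : ∀ {a b : unitary ℍ[ℝ]} (i : Fin 3),
      conjVector a (p : Space3) i ≠ conjVector b (p : Space3) i → quatPerm a p ≠ quatPerm b p := by
    intro a b i hi e
    refine hi ?_
    rw [← coe_quatPerm, ← coe_quatPerm, e]
  have hne1 : ∀ {b : unitary ℍ[ℝ]} (i : Fin 3),
      (p : Space3) i ≠ conjVector b (p : Space3) i → p ≠ quatPerm b p := by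
    intro b i hi e
    refine hi ?_
    rw [← coe_quatPerm, ← e]
  have hI : conjVector unitI (p : Space3) = !₂[p.1 0, -p.1 1, -p.1 2] := by
    conv_lhs => rw [← vec_eta p.1]
    exact conjVector_i _ _ _
  have hJ : conjVector unitJ (p : Space3) = !₂[-p.1 0, p.1 1, -p.1 2] := by
    conv_lhs => rw [← vec_eta p.1]
    exact conjVector_j _ _ _
  have hW : conjVector unitW (p : Space3) = !₂[p.1 2, p.1 0, p.1 1] := by
    conv_lhs => rw [← vec_eta p.1]
    exact conjVector_w _ _ _
  have hW2 : conjVector (unitW * unitW : unitary ℍ[ℝ]) (p : Space3) = !₂[p.1 1, p.1 2, p.1 0] := by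
    rw [Submonoid.coe_mul, conjVector_mul, hW]
    exact conjVector_w _ _ _
  have hs := Sphere2.sum_sq p
  -- If at least two coordinates are nonzero, p and its images under the half-turns i and j are
  -- distinct. Otherwise p is on a coordinate axis, and the rotations by w and w² take it to the
  -- other two axes.
  by_cases h2 : p.1 2 = 0
  · by_cases h1 : p.1 1 = 0
    · have h0 : p.1 0 ≠ 0 := by rintro h0; rw [h0, h1, h2] at hs; norm_num at hs
      refine ⟨_, h.w_mem, _, (by rw [map_mul]; exact mul_mem h.w_mem h.w_mem :
        quatPerm (unitW * unitW) ∈ H), hne1 0 ?_, hne1 0 ?_, hne 1 ?_⟩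
      · rw [hW]; simpa [h2] using h0
      · rw [hW2]; simpa [h1] using h0
      · rw [hW, hW2]; simpa [h2] using h0
    · by_cases h0 : p.1 0 = 0
      · refine ⟨_, h.w_mem, _, (by rw [map_mul]; exact mul_mem h.w_mem h.w_mem :
          quatPerm (unitW * unitW) ∈ H), hne1 1 ?_, hne1 1 ?_, hne 2 ?_⟩
        · rw [hW]; simpa [h0] using h1
        · rw [hW2]; simpa [h2] using h1
        · rw [hW, hW2]; simpa [h0] using h1
      · refine ⟨_, h.i_mem, _, h.j_mem, hne1 1 ?_, hne1 0 ?_, hne 1 ?_⟩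
        · rw [hI]; simpa [self_eq_neg] using h1
        · rw [hJ]; simpa [self_eq_neg] using h0
        · rw [hI, hJ]; simpa [neg_eq_self] using h1
  · by_cases h1 : p.1 1 = 0
    · by_cases h0 : p.1 0 = 0
      · refine ⟨_, h.w_mem, _, (by rw [map_mul]; exact mul_mem h.w_mem h.w_mem :
          quatPerm (unitW * unitW) ∈ H), hne1 2 ?_, hne1 2 ?_, hne 0 ?_⟩
        · rw [hW]; simpa [h1] using h2
        · rw [hW2]; simpa [h0] using h2
        · rw [hW, hW2]; simpa [h1] using h2
      · refine ⟨_, h.i_mem, _, h.j_mem, hne1 2 ?_, hne1 2 ?_, hne 0 ?_⟩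
        · rw [hI]; simpa [self_eq_neg] using h2
        · rw [hJ]; simpa [self_eq_neg] using h2
        · rw [hI, hJ]; simpa [self_eq_neg] using h0
    · refine ⟨_, h.i_mem, _, h.j_mem, hne1 2 ?_, hne1 2 ?_, hne 1 ?_⟩
      · rw [hI]; simpa [self_eq_neg] using h2
      · rw [hJ]; simpa [self_eq_neg] using h2
      · rw [hI, hJ]; simpa [neg_eq_self] using h1

lemma isCube_smul {g : Equiv.Perm Sphere2} (hg : g ∈ rotationGroup) :
    IsCube (g • stdPolyhedron cubeVertices) := by
  obtain ⟨f, rfl⟩ := exists_spherePerm hg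
  exact isInscribedCopy_smul_stdPolyhedron (fun _ hw => norm_of_mem_cubeVertices hw) f

lemma isRegularDodecahedron_smul {g : Equiv.Perm Sphere2} (hg : g ∈ rotationGroup) :
    IsRegularDodecahedron (g • stdPolyhedron dodecahedronVertices) := by
  obtain ⟨f, rfl⟩ := exists_spherePerm hg
  exact isInscribedCopy_smul_stdPolyhedron (fun _ hw => norm_of_mem_dodecahedronVertices hw) f

lemma le_polyhedronRotations_smul {g : Equiv.Perm Sphere2} (hg : g ∈ rotationGroup)
    {H : Subgroup (Equiv.Perm Sphere2)} {P : Set Sphere2}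
    (h : conjGroup g H ≤ polyhedronRotations P) : H ≤ polyhedronRotations (g • P) := by
  rwa [← conjGroup_le_conjGroup (g := g), conjGroup_polyhedronRotations hg]

lemma polyhedronRotations_smul_le {g : Equiv.Perm Sphere2} (hg : g ∈ rotationGroup)
    {H : Subgroup (Equiv.Perm Sphere2)} {P : Set Sphere2}
    (h : polyhedronRotations P ≤ conjGroup g H) : polyhedronRotations (g • P) ≤ H := by
  rwa [← conjGroup_le_conjGroup (g := g), conjGroup_polyhedronRotations hg]

lemma conjGroup_le_rotationGroup {g : Equiv.Perm Sphere2} (hg : g ∈ rotationGroup)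
    {H : Subgroup (Equiv.Perm Sphere2)} (hH : H ≤ rotationGroup) :
    conjGroup g H ≤ rotationGroup := by
  rw [← conjGroup_eq_of_mem hg]
  exact conjGroup_mono hH

/-- A finite Möbius group containing the conjugate by `g` of the standard tetrahedral group and not
equal to it contains the rotation group of a cube or a dodecahedron. -/
lemma eq_or_exists_polyhedronRotations_le {G A : Subgroup (Equiv.Perm Sphere2)} [Finite A]
    (e : G ≃* alternatingGroup (Fin 4)) (hG : G ≤ rotationGroup) (hGA : G ≤ A)
    (hA : A ≤ mobiusGroup) {g : Equiv.Perm Sphere2} (hg : g ∈ rotationGroup)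
    (hGT : ContainsTetrahedral (conjGroup g G)) :
    A = G ∨ (∃ O, IsCube O ∧ G ≤ polyhedronRotations O ∧ polyhedronRotations O ≤ A) ∨
      ∃ I, IsRegularDodecahedron I ∧ G ≤ polyhedronRotations I ∧ polyhedronRotations I ≤ A := by
  have hAT : ContainsTetrahedral (conjGroup g A) := hGT.mono (conjGroup_mono hGA)
  have : Finite (conjGroup g A) := Finite.of_equiv _ (conjGroupEquiv g A).symm.toEquiv
  have hAm : conjGroup g A ≤ mobiusGroup := by
    rw [← conjGroup_eq_of_mem (rotationGroup_le_mobiusGroup hg)]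
    exact conjGroup_mono hA
  have hAr : conjGroup g A ≤ rotationGroup := le_rotationGroup_of_finite _ hAm hAT.i_mem hAT.j_mem
  have hdodeca : ∀ {k : Equiv.Perm Sphere2}, k ∈ rotationGroup →
      ContainsTetrahedral (conjGroup k G) → quatPerm unitD ∈ conjGroup k A →
      ∃ I, IsRegularDodecahedron I ∧ G ≤ polyhedronRotations I ∧ polyhedronRotations I ≤ A := by
    intro k hk hkG hD
    exact ⟨_, isRegularDodecahedron_smul hk,
      le_polyhedronRotations_smul hk (hkG.le_of_mulEquiv ((conjGroupEquiv k G).trans e)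
        (conjGroup_le_rotationGroup hk hG) containsTetrahedral_dodecahedron),
      polyhedronRotations_smul_le hk
        (polyhedronRotations_dodecahedron_le (hkG.mono (conjGroup_mono hGA)) hD)⟩
  rcases hAT.hurwitz.finite_trichotomy hGT.hurwitz (finite_quatMonoid _) with h | h | h | h
  · exact Or.inl (le_antisymm (conjGroup_le_conjGroup.1 (le_of_quatMonoid_le hAr h)) hGA)
  · refine Or.inr (Or.inl ⟨_, isCube_smul hg,
      le_polyhedronRotations_smul hg (hGT.le_of_mulEquiv ((conjGroupEquiv g G).trans e)
        (conjGroup_le_rotationGroup hg hG) containsTetrahedral_cube),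
      polyhedronRotations_smul_le hg
        (polyhedronRotations_cube_le hAT ((coe_mem_quatMonoid (q := unitO)).1 h))⟩)
  · exact Or.inr (Or.inr (hdodeca hg hGT ((coe_mem_quatMonoid (q := unitD)).1 h)))
  -- The second icosian becomes the first after a further conjugation by `unitS`; this yields the
  -- other dodecahedron.
  · refine Or.inr (Or.inr (hdodeca (k := g * quatPerm unitS)
      (mul_mem hg (quatPerm_mem_rotationGroup _)) ?_ ?_))
    · rw [← conjGroup_conjGroup]
      exact hGT.conjGroup_unitS
    · rw [← conjGroup_conjGroup, coe_mem_quatMonoid_conjGroup, unitD, unitS_conj, neg_zero]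
      exact h

lemma le_mobiusStabilizer_iff {H : Subgroup (Equiv.Perm Sphere2)} (hH : H ≤ rotationGroup)
    {α : Set Sphere2} : H ≤ mobiusStabilizer α ↔ PreservesSet H α :=
  ⟨fun h => h.trans inf_le_right, fun h => le_inf (hH.trans rotationGroup_le_mobiusGroup) h⟩

theorem mainTheorem6 (G : Subgroup (Equiv.Perm Sphere2))
    (hG : Nonempty (G ≃* alternatingGroup (Fin 4)))
    (T : Set Sphere2) (hT : IsRegularTetrahedron T) (hGT : G ≤ polyhedronRotations T)
    (α : Set Sphere2) (hα : α.Finite) :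
    mobiusStabilizer α = G ↔
      IsUnionOfMembers α (orbitFamily T G) ∧
      (∀ I : Set Sphere2, IsRegularDodecahedron I → G ≤ polyhedronRotations I →
        ¬ IsUnionOfMembers α (orbitFamily I (polyhedronRotations I))) ∧
      (∀ O : Set Sphere2, IsCube O → G ≤ polyhedronRotations O →
        ¬ IsUnionOfMembers α (orbitFamily O (polyhedronRotations O))) := by
  obtain ⟨e⟩ := hG
  have hGr : G ≤ rotationGroup := hGT.trans inf_le_left
  obtain ⟨t, rfl⟩ := hT.exists_eq
  have ht := quatPerm_mem_rotationGroup t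
  have hI : ∀ {I : Set Sphere2}, IsRegularDodecahedron I →
      IsFaceTransitive (polyhedronRotations I) I := by
    intro I hI
    obtain ⟨q, rfl⟩ := hI.exists_eq
    exact isFaceTransitive_dodecahedron.smul (quatPerm_mem_rotationGroup q)
  have hO : ∀ {O : Set Sphere2}, IsCube O → IsFaceTransitive (polyhedronRotations O) O := by
    intro O hO
    obtain ⟨q, rfl⟩ := hO.exists_eq
    exact isFaceTransitive_cube.smul (quatPerm_mem_rotationGroup q)
  obtain ⟨hGC, hGeq⟩ := containsTetrahedral_of_mulEquiv ((conjGroupEquiv (quatPerm t) G).trans e)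
    (by rw [← conjGroup_polyhedronRotations ht]; exact conjGroup_mono hGT)
  have hGF : IsFaceTransitive G (quatPerm t • stdPolyhedron tetrahedronVertices) := by
    refine IsFaceTransitive.of_conjGroup ht ?_
    rw [hGeq]
    exact isFaceTransitive_tetrahedron
  rw [hGF.isUnionOfMembers_iff, ← le_mobiusStabilizer_iff hGr]
  have key : ∀ {P : Set Sphere2}, IsFaceTransitive (polyhedronRotations P) P →
      (IsUnionOfMembers α (orbitFamily P (polyhedronRotations P)) ↔
        polyhedronRotations P ≤ mobiusStabilizer α) := by
    intro P hP
    rw [hP.isUnionOfMembers_iff, le_mobiusStabilizer_iff hP.le_rotationGroup]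
  constructor
  · intro h
    refine ⟨h.ge, fun I hI' _ hu => ?_, fun O hO' _ hu => ?_⟩
    -- Otherwise `G` would contain the whole icosahedral group, and with it a rotation of order
    -- five.
    · rw [key (hI hI'), h] at hu
      obtain ⟨q, rfl⟩ := hI'.exists_eq
      have hc := conjGroup_mono (g := quatPerm q) hu
      rw [conjGroup_polyhedronRotations (quatPerm_mem_rotationGroup q)] at hc
      exact unitD_notMem ((conjGroupEquiv (quatPerm q) G).trans e) (hc unitD_mem_dodecahedron)
    · rw [key (hO hO'), h] at hu
      obtain ⟨q, rfl⟩ := hO'.exists_eq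
      have hc := conjGroup_mono (g := quatPerm q) hu
      rw [conjGroup_polyhedronRotations (quatPerm_mem_rotationGroup q)] at hc
      exact unitO_notMem ((conjGroupEquiv (quatPerm q) G).trans e) (hc unitO_mem_cube)
  · rintro ⟨hGA, hnI, hnO⟩
    have hαne : α.Nonempty := by
      rw [Set.nonempty_iff_ne_empty]
      rintro rfl
      -- The empty set is the empty union, so condition 3 fails for the cube in the same position as
      -- the tetrahedron.
      refine hnO _ (isCube_smul ht) (le_polyhedronRotations_smul ht
        (hGC.le_of_mulEquiv ((conjGroupEquiv (quatPerm t) G).trans e)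
          (conjGroup_le_rotationGroup ht hGr) containsTetrahedral_cube)) ⟨∅, by simp, by simp⟩
    obtain ⟨p, hp⟩ := hαne
    -- The orbit of p under `G` supplies the three points of `α` that make the stabilizer finite.
    obtain ⟨a, ha, b, hb, h1, h2, h3⟩ := hGC.exists_three ((quatPerm t)⁻¹ p)
    have hmem : ∀ {k}, k ∈ conjGroup (quatPerm t) G →
        quatPerm t (k ((quatPerm t)⁻¹ p)) ∈ α := fun hk =>
      ((le_mobiusStabilizer_iff hGr).1 hGA).apply_mem hk hp
    have : Finite (mobiusStabilizer α) := finite_mobiusStabilizer hα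
      (hmem (one_mem _)) (hmem ha) (hmem hb) ((quatPerm t).injective.ne h1)
      ((quatPerm t).injective.ne h2) ((quatPerm t).injective.ne h3)
    rcases eq_or_exists_polyhedronRotations_le e hGr hGA inf_le_left ht hGC with
      h | ⟨O, hO', hGO, hOA⟩ | ⟨I, hI', hGI, hIA⟩
    · exact h
    · exact absurd ((key (hO hO')).2 hOA) (hnO O hO' hGO)
    · exact absurd ((key (hI hI')).2 hIA) (hnI I hI' hGI)

end
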